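/- **Definitions.** A closed path of length $\nu$ on the square lattice $\mathbb Z^2$ is a cyclic sequence $(P_i)_{i\in\mathbb Z/\nu}$ of lattice points such that $P_i,P_{i+1}$ are nearest neighbours and $P_{i+1}\neq P_{i-1}$ (no U-turns). A *distorted disk* is an oriented surface obtained by gluing finitely many unit squares along their sides, drawn isometrically on the square lattice (each square sits on a lattice tile, overlaps being allowed), which is topologically a disk (connected, $V-E+F=1$), all of whose bulk vertices have degree four and all of whose boundary vertices have degree two, three or four; two such drawn surfaces are identified if they differ by a relabelling of the squares. A *self-overlapping polygon* (SOP) is a closed path $\gamma$ that is the boundary of a distorted disk located on its left. Its boundary length is its number of edges, its area is the number of squares of a distorted disk bounded by $\gamma$, and its multiplicity $\mu_\gamma$ is the number of distorted disks bounded by $\gamma$. SOPs are counted modulo lattice translations (rotated and reflected configurations are counted as distinct): $\mathcal W_{2n,p,\mu}$, $\hat W_{2n,p}$ and $\hat w_{2n}$ are the numbers of elements of the sets $\mathrm{SOP}_{2n,p,\mu}$, $\mathrm{SOP}_{2n,p}$ and $\mathrm{SOP}_{2n}$ of SOPs of boundary length $2n$, area $p$ and multiplicity $\mu$, of boundary length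 $2n$ and area $p$, and of boundary length $2n$, respectively, each SOP being counted once. An upper (lower) edge of $\gamma$ is a horizontal edge of $\gamma$ at the maximal (minimal) height reached by $\gamma$. Given SOPs $\gamma_1,\gamma_2$, an upper edge $e_{\rm u}$ of $\gamma_1$ and a lower edge $e_{\rm l}$ of $\gamma_2$, the gluing $\gamma_1\sqcup\gamma_2=\gamma_1(e_{\rm u})\sqcup\gamma_2(e_{\rm l})$ is obtained by translating $\gamma_2$ so that $e_{\rm l}$ lies one lattice unit above $e_{\rm u}$ and by replacing $e_{\rm u}$ and $e_{\rm l}$ by the two vertical sides of the tile located between them. **Proposition.** The multiplicity of any closed path and all the sets $\mathrm{SOP}_{2n}$ are finite, the area of a SOP is well defined, and any SOP has at least one upper edge and one lower edge. For all SOPs $\gamma_1,\gamma_2$ and any upper edge of $\gamma_1$ and lower edge of $\gamma_2$, $\gamma_1\sqcup\gamma_2$ is a SOP whose boundary length is the sum of the boundary lengths of $\gamma_1$ and $\gamma_2$, whose area is the sum of the areas of $\gamma_1$ and $\gamma_2$ plus one, and whose multiplicity is $\mu_{\gamma_1}\mu_{\gamma_2}$. Gluing maps $(\gamma_1,\gamma_2)\mapsto\gamma_1\sqcup\gamma_2$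 on SOPs modulo translations, obtained by choosing an upper edge of $\gamma_1$ and a lower edge of $\gamma_2$ for each pair $(\gamma_1,\gamma_2)$, exist, and, for any such choice and all $n_i,p_i,\mu_i$, the gluing defines injective maps $$\mathrm{SOP}_{2n_1,p_1,\mu_1}\times\mathrm{SOP}_{2n_2,p_2,\mu_2}\to\mathrm{SOP}_{2(n_1+n_2),p_1+p_2+1,\mu_1\mu_2},$$ $$\mathrm{SOP}_{2n_1,p_1}\times\mathrm{SOP}_{2n_2,p_2}\to\mathrm{SOP}_{2(n_1+n_2),p_1+p_2+1},\qquad \mathrm{SOP}_{2n_1}\times\mathrm{SOP}_{2n_2}\to\mathrm{SOP}_{2(n_1+n_2)}.$$ Consequently, $$\mathcal W_{2(n_1+n_2),p_1+p_2+1,\mu_1\mu_2}\ge\mathcal W_{2n_1,p_1,\mu_1}\mathcal W_{2n_2,p_2,\mu_2},$$ $$\hat W_{2(n_1+n_2),p_1+p_2+1}\ge\hat W_{2n_1,p_1}\hat W_{2n_2,p_2},\qquad \hat w_{2(n_1+n_2)}\ge\hat w_{2n_1}\hat w_{2n_2}.$$ -/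

import Mathlib

/-! # Self-overlapping polygons on the square lattice

Closed lattice paths, discretized flat disks drawn isometrically on the square lattice,
self-overlapping polygons (SOP), their length, area and multiplicity, and the gluing of two SOP
along an upper edge of the first one and a lower edge of the second one. -/

namespace SOPoly

/-- Points of the square lattice. -/
abbrev Pt : Type := ℤ × ℤ

/-- Nearest neighbours on the square lattice. -/
def Adj (P Q : Pt) : Prop := (Q.1 - P.1).natAbs + (Q.2 - P.2).natAbs = 1

/-- A closed path (polygon) on the square lattice: a cyclic sequence of lattice points in which
consecutive points are nearest neighbours, and without U-turns: any two cyclically consecutive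
points `P, Q` are followed by a point `R ≠ P`. -/
structure IsClosedPath (γ : Cycle Pt) : Prop where
  chain : γ.Chain Adj
  no_uturn : ∀ (P Q : Pt) (l : List Pt), ((P :: Q :: l : List Pt) : Cycle Pt) = γ →
    ∃ (R : Pt) (l' : List Pt), l = R :: l' ∧ R ≠ P

/-! ### Discretized surfaces made of squares, drawn isometrically on the lattice -/

/-- The sides of `p` squares. The sides of a square are numbered anticlockwise: bottom, right, top,
left. The pair `(f, k)` also denotes the corner of the square `f` where the side `k` starts. -/
abbrev Side (p : ℕ) : Type := Fin p × Fin 4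

/-- The next side of the same square, anticlockwise. As a corner, this is the endpoint of `s`. -/
def Side.next {p : ℕ} (s : Side p) : Side p := (s.1, s.2 + 1)

/-- Position of the four corners of a tile, with respect to the lower left one. -/
def cornerOffset : Fin 4 → Pt := ![(0, 0), (1, 0), (1, 1), (0, 1)]

/-- `p` squares glued along their sides and drawn isometrically on the square lattice. The square
`f` is put on the tile with lower left corner `tile f`. The involution `glue` pairs the sides that
are glued together; its fixed points are the sides that are left free, i.e. the boundary edges.
Two sides that are glued together sit on the same lattice edge, with opposite orientations. -/
structure SquareSurface (p : ℕ) where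
  tile : Fin p → Pt
  glue : Side p → Side p
  glue_glue : ∀ s, glue (glue s) = s
  isometric : ∀ s, glue s ≠ s →
    tile (glue s).1 + cornerOffset (glue s).2 = tile s.1 + cornerOffset s.next.2 ∧
    tile (glue s).1 + cornerOffset (glue s).next.2 = tile s.1 + cornerOffset s.2

namespace SquareSurface

variable {p : ℕ} (D : SquareSurface p)

/-- The lattice point at which a side, oriented anticlockwise, starts. -/
def start (s : Side p) : Pt := D.tile s.1 + cornerOffset s.2

/-- The corners identified by the gluing: when the side `s` is glued to another side, its starting
point is identified with the endpoint of that side. -/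
def CornerRel (c d : Side p) : Prop := D.glue c ≠ c ∧ d = (D.glue c).next

/-- The vertices of the surface: corners of squares, modulo the identifications implied by the
gluing of the sides. -/
def Vertex : Type := Quot D.CornerRel

/-- The vertex at a given corner. -/
def vertex (c : Side p) : D.Vertex := Quot.mk _ c

/-- The edges of the surface: sides of squares, two sides glued together forming one edge. -/
def Edge : Type := Quot (fun s t : Side p => t = D.glue s)

/-- A vertex belongs to the boundary when a boundary edge starts there. -/
def IsBoundaryVertex (v : D.Vertex) : Prop := ∃ s : Side p, D.glue s = s ∧ D.vertex s = v

/-- Number of corners of squares that meet at a vertex. -/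
noncomputable def corners (v : D.Vertex) : ℕ := Nat.card {c : Side p // D.vertex c = v}

/-- A discretized flat disk (distorted disk): the surface is connected, of Euler characteristic
`V - E + F = 1`; the bulk vertices have degree four (no curvature); the boundary vertices have
degree two, three or four. At a bulk vertex, the degree (number of incident edges) is the number of
corners meeting there; at a boundary vertex, it is this number plus one. -/
structure IsDisk : Prop where
  pos : 0 < p
  connected : ∀ f g : Fin p,
    Relation.ReflTransGen (fun a b => ∃ k : Fin 4, (D.glue (a, k)).1 = b) f g
  euler : (Nat.card D.Vertex : ℤ) - Nat.card D.Edge + p = 1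
  bulk_degree : ∀ v, ¬ D.IsBoundaryVertex v → D.corners v = 4
  boundary_degree : ∀ v, D.IsBoundaryVertex v → D.corners v + 1 ∈ ({2, 3, 4} : Set ℕ)

/-- The boundary of the surface is the closed path `γ`, with the surface on the left: the boundary
edges can be arranged in a cyclic sequence `β` without repetition, each one ending at the vertex of
the surface where the next one starts, and their starting points form the cyclic sequence `γ`. -/
def Bounds (γ : Cycle Pt) : Prop :=
  ∃ β : Cycle (Side p), β.Nodup ∧ (∀ s, s ∈ β ↔ D.glue s = s) ∧
    β.Chain (fun s t => D.vertex s.next = D.vertex t) ∧ β.map D.start = γ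

end SquareSurface

/-! ### Self-overlapping polygons -/

/-- The distorted disks bounded by `γ`, with their squares numbered. -/
structure Filling (γ : Cycle Pt) where
  faces : ℕ
  disk : SquareSurface faces
  isDisk : disk.IsDisk
  bounds : disk.Bounds γ

/-- Two numbered disks are the same when they differ by a renumbering of the squares. -/
def Filling.Iso {γ : Cycle Pt} (A B : Filling γ) : Prop :=
  ∃ e : Fin A.faces ≃ Fin B.faces, (∀ f, B.disk.tile (e f) = A.disk.tile f) ∧
    ∀ s : Side A.faces, B.disk.glue (e s.1, s.2) = (e (A.disk.glue s).1, (A.disk.glue s).2)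

theorem Filling.iso_equivalence (γ : Cycle Pt) : Equivalence (Filling.Iso (γ := γ)) where
  refl A := ⟨Equiv.refl _, fun _ => rfl, fun _ => rfl⟩
  symm := by
    rintro A B ⟨e, h₁, h₂⟩
    refine ⟨e.symm, fun f => ?_, fun s => ?_⟩
    · rw [← h₁, e.apply_symm_apply]
    · have h := h₂ (e.symm s.1, s.2)
      simp only [e.apply_symm_apply] at h
      rw [show B.disk.glue s = _ from h]
      simp
  trans := by
    rintro A B C ⟨e, h₁, h₂⟩ ⟨e', h₁', h₂'⟩
    refine ⟨e.trans e', fun f => ?_, fun s => ?_⟩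
    · simp [h₁', h₁]
    · have h := h₂' (e s.1, s.2)
      rw [h₂ s] at h
      exact h

/-- The distorted disks bounded by `γ`. -/
def DistortedDisk (γ : Cycle Pt) : Type :=
  Quotient (⟨Filling.Iso, Filling.iso_equivalence γ⟩ : Setoid (Filling γ))

/-- The multiplicity `μ_γ`: the number of distorted disks bounded by `γ`. -/
noncomputable def multiplicity (γ : Cycle Pt) : ℕ := Nat.card (DistortedDisk γ)

/-- A self-overlapping polygon, with its canonical anticlockwise orientation: a closed path that
bounds a distorted disk located on its left. -/
def IsSOP (γ : Cycle Pt) : Prop := IsClosedPath γ ∧ Nonempty (Filling γ)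

/-- `γ` has area `p`: it bounds a distorted disk that has `p` faces. -/
def HasArea (γ : Cycle Pt) (p : ℕ) : Prop := ∃ A : Filling γ, A.faces = p

/-! ### Counting, modulo lattice translations -/

/-- Two closed paths are identified when they differ by a lattice translation. -/
def Translate (γ γ' : Cycle Pt) : Prop := ∃ v : Pt, γ' = γ.map (· + v)

theorem map_map_add (γ : Cycle Pt) (v w : Pt) :
    (γ.map (· + v)).map (· + w) = γ.map (· + (v + w)) := by
  induction γ using Quotient.inductionOn' with
  | h l =>
    change ((List.map _ (List.map _ l) : List Pt) : Cycle Pt) = ((List.map _ l : List Pt) : Cycle Pt)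
    simp [Function.comp_def, add_assoc]

theorem map_add_zero (γ : Cycle Pt) : γ.map (· + (0 : Pt)) = γ := by
  induction γ using Quotient.inductionOn' with
  | h l =>
    change ((List.map _ l : List Pt) : Cycle Pt) = (l : Cycle Pt)
    simp

theorem translate_equivalence : Equivalence Translate where
  refl γ := ⟨0, (map_add_zero γ).symm⟩
  symm := by
    rintro γ _ ⟨v, rfl⟩
    exact ⟨-v, by rw [map_map_add, add_neg_cancel, map_add_zero]⟩
  trans := by
    rintro γ _ _ ⟨v, rfl⟩ ⟨w, rfl⟩
    exact ⟨v + w, by rw [map_map_add]⟩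

/-- Cyclic sequences of lattice points modulo lattice translations. Configurations that are related
by a rotation or a reflection are not identified. -/
def PathClass : Type := Quotient (⟨Translate, translate_equivalence⟩ : Setoid (Cycle Pt))

/-- The class of a cyclic sequence of lattice points modulo translations. -/
def toClass (γ : Cycle Pt) : PathClass := Quotient.mk _ γ

/-- `SOP_{2n}`: the SOP of boundary length `2n`, modulo translations. -/
def sopLength (n : ℕ) : Set PathClass :=
  toClass '' {γ | IsSOP γ ∧ γ.length = 2 * n}

/-- `SOP_{2n,p}`: the SOP of boundary length `2n` and area `p`, modulo translations. -/
def sopArea (n p : ℕ) : Set PathClass :=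
  toClass '' {γ | IsSOP γ ∧ γ.length = 2 * n ∧ HasArea γ p}

/-- `SOP_{2n,p,μ}`: the SOP of boundary length `2n`, area `p` and multiplicity `μ`, modulo
translations. -/
def sopMult (n p μ : ℕ) : Set PathClass :=
  toClass '' {γ | IsSOP γ ∧ γ.length = 2 * n ∧ HasArea γ p ∧ multiplicity γ = μ}

/-- The number of SOP of boundary length `2n`, area `p` and multiplicity `μ`. -/
noncomputable def calW (n p μ : ℕ) : ℕ := (sopMult n p μ).ncard

/-- The number of SOP of boundary length `2n` and area `p`, each counted once. -/
noncomputable def hatW (n p : ℕ) : ℕ := (sopArea n p).ncard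

/-- The number of SOP of boundary length `2n`, each counted once. -/
noncomputable def hatw (n : ℕ) : ℕ := (sopLength n).ncard

/-! ### Gluing -/

/-- An upper edge of `γ`: a horizontal edge located at the maximal height reached by `γ`. An edge of
`γ` is given by the list `root` of the successive points of `γ` in which this edge goes from the
last point to the first one. -/
structure UpperEdge (γ : Cycle Pt) where
  root : List Pt
  ne_nil : root ≠ []
  coe_root : (root : Cycle Pt) = γ
  horizontal : (root.getLast ne_nil).2 = (root.head ne_nil).2
  highest : ∀ P ∈ root, P.2 ≤ (root.head ne_nil).2

/-- A lower edge of `γ`: a horizontal edge located at the minimal height reached by `γ`. -/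
structure LowerEdge (γ : Cycle Pt) where
  root : List Pt
  ne_nil : root ≠ []
  coe_root : (root : Cycle Pt) = γ
  horizontal : (root.getLast ne_nil).2 = (root.head ne_nil).2
  lowest : ∀ P ∈ root, (root.head ne_nil).2 ≤ P.2

/-- The gluing `γ₁(u) ⊔ γ₂(l)`: the path `γ₂` is translated so that its lower edge `l` lies one
lattice unit above the upper edge `u` of `γ₁`; then `u` and `l` are removed and replaced by the two
vertical sides of the tile between them. That is, one follows `γ₁` from the end of `u` to its
beginning, goes up, follows `γ₂` from the end of `l` to its beginning, and goes down. -/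
def gluing {γ₁ γ₂ : Cycle Pt} (u : UpperEdge γ₁) (l : LowerEdge γ₂) : Cycle Pt :=
  ((u.root ++ l.root.map
    (· + (u.root.head u.ne_nil + ((0, 1) : Pt) - l.root.getLast l.ne_nil)) : List Pt) : Cycle Pt)

/-- `G` is a gluing map on SOP modulo translations, for some choice, for each pair, of an upper edge
of the first SOP and a lower edge of the second SOP. -/
def IsGluingMap (G : PathClass × PathClass → PathClass) : Prop :=
  ∀ γ₁ γ₂ : Cycle Pt, IsSOP γ₁ → IsSOP γ₂ →
    ∃ (u : UpperEdge γ₁) (l : LowerEdge γ₂), G (toClass γ₁, toClass γ₂) = toClass (gluing u l)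

end SOPoly

namespace SOPoly

open Relation

/-! ### Local geometry of glued squares -/

/-! Two disks can be joined by a single square placed between the two chosen edges. Conversely, any
disk bounded by the glued path contains exactly one square in the row between the two paths, and
cutting there gives back disks bounded by the two original paths. The additivity of the area and the
product formula for multiplicities rest on this correspondence.

The degree conditions are first put in the local form `Flat`: rotating about a corner, one meets the
boundary within three corners or returns after four. Double counting of corners and sides then gives
a combinatorial Gauss-Bonnet formula, `Flat.four_mul_euler_eq_turn`: four times the Euler
characteristic is the number of signed quarter turns of the boundary. These turns can be read off
the path, so for a flat surface with a single boundary cycle the Euler characteristic is a function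
of the path alone. In the same way `∮ x dy` counts the squares (`BoundaryList.faces_eq`). Since the
squares also stay in the bounding box of the path, each path has finitely many fillings.

When two disks are joined, the rotation numbers add up to `4 + 4 - 4` quarter turns, so the result
is a disk (`Join.isDisk`). For the converse, in the row between the two paths the only free vertical
sides are those of the bridging square, and this leaves room for no other square (`exists_cut`). The
pieces inherit flatness and connectedness. Their Euler characteristic is that of the given fillings
of the same paths, by Gauss-Bonnet.

Isomorphisms must correspond as well (`Gap.iso_iff`). A closed path of rotation number one has no
proper period, so an isomorphism between two fillings of one path has to respect the marked boundary
side. In the other direction, the height of a square tells which part of the joined disk it belongs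
to.

Injectivity uses heights only: once the length of the first path is fixed, counting the points below
a given level determines the level of the cut (`not_lt_of_perm`), and the cyclic sequence then
splits into its low and high blocks in one way (`append_inj_of_isRotated`). -/

theorem offset_inj {S T : Pt} {j k : Fin 4} (h₁ : S + cornerOffset j = T + cornerOffset k)
    (h₂ : S + cornerOffset (j + 1) = T + cornerOffset (k + 1)) : j = k ∧ S = T := by
  obtain ⟨a, b⟩ := S
  obtain ⟨c, d⟩ := T
  fin_cases j <;> fin_cases k <;> simp [cornerOffset] at h₁ h₂ ⊢ <;> omega

/-- The unit outward normal of a side of a square. -/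
def normal : Fin 4 → Pt := ![(0, -1), (1, 0), (0, 1), (-1, 0)]

theorem offset_glue {S T : Pt} {j k : Fin 4} (h₁ : S + cornerOffset j = T + cornerOffset (k + 1))
    (h₂ : S + cornerOffset (j + 1) = T + cornerOffset k) : j = k + 2 ∧ S = T + normal k := by
  obtain ⟨a, b⟩ := S
  obtain ⟨c, d⟩ := T
  fin_cases j <;> fin_cases k <;> simp [cornerOffset, normal] at h₁ h₂ ⊢ <;> omega

theorem offset_of_glue (T : Pt) (k : Fin 4) :
    T + normal k + cornerOffset (k + 2) = T + cornerOffset (k + 1) ∧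
      T + normal k + cornerOffset (k + 2 + 1) = T + cornerOffset k := by
  obtain ⟨c, d⟩ := T
  fin_cases k <;> simp [cornerOffset, normal]

@[simp] theorem Side.next_fst {p : ℕ} (s : Side p) : s.next.1 = s.1 := rfl

@[simp] theorem Side.next_snd {p : ℕ} (s : Side p) : s.next.2 = s.2 + 1 := rfl

theorem Side.next_injective {p : ℕ} : Function.Injective (Side.next (p := p)) := by
  rintro ⟨f, j⟩ ⟨g, k⟩ h
  simpa [Side.next] using h

namespace SquareSurface

variable {p : ℕ} (D : SquareSurface p)

theorem glue_injective : Function.Injective D.glue :=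
  Function.LeftInverse.injective D.glue_glue

/-- Rotation about the corner `c`: crossing the side that starts there. -/
def rot (c : Side p) : Side p := (D.glue c).next

theorem rot_injective : Function.Injective D.rot :=
  Side.next_injective.comp D.glue_injective

theorem rot_of_free {s : Side p} (h : D.glue s = s) : D.rot s = s.next := by
  rw [rot, h]

theorem glue_geom {s : Side p} (h : D.glue s ≠ s) :
    (D.glue s).2 = s.2 + 2 ∧ D.tile (D.glue s).1 = D.tile s.1 + normal s.2 :=
  offset_glue (D.isometric s h).1 (D.isometric s h).2

theorem rot_snd {c : Side p} (h : D.glue c ≠ c) : (D.rot c).2 = c.2 + 3 := by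
  rw [rot, Side.next_snd, (D.glue_geom h).1, add_assoc]
  rfl

theorem start_rot {c : Side p} (h : D.glue c ≠ c) : D.start (D.rot c) = D.start c :=
  (D.isometric c h).2

theorem start_ext {q : ℕ} {D : SquareSurface p} {D' : SquareSurface q} {s : Side p} {t : Side q}
    {v : Pt} (h₁ : D'.start t = D.start s + v) (h₂ : D'.start t.next = D.start s.next + v) :
    t.2 = s.2 ∧ D'.tile t.1 = D.tile s.1 + v := by
  refine offset_inj (T := D.tile s.1 + v) ?_ ?_
  · rw [add_right_comm]; exact h₁
  · rw [add_right_comm]; exact h₂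

/-- The square of a region that lies furthest in the direction of a side has that side free. -/
theorem exists_free_dir (j : Fin 4) (S : Fin p → Prop)
    (hS : ∀ g, S g → D.glue (g, j) ≠ (g, j) → S (D.glue (g, j)).1) (φ : Pt → ℤ)
    (hφ : ∀ T, φ T < φ (T + normal j)) {g : Fin p} (hg : S g) :
    ∃ g', S g' ∧ D.glue (g', j) = (g', j) ∧ ∀ g'', S g'' → φ (D.tile g'') ≤ φ (D.tile g') := by
  classical
  obtain ⟨g', hg', hmax⟩ := (Finset.univ.filter S).exists_max_image (fun g => φ (D.tile g))
    ⟨g, by simpa using hg⟩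
  simp only [Finset.mem_filter, Finset.mem_univ, true_and] at hg' hmax
  refine ⟨g', hg', ?_, hmax⟩
  by_contra hne
  have h := hmax _ (hS g' hg' hne)
  rw [(D.glue_geom hne).2] at h
  exact absurd (hφ (D.tile g')) (not_lt.2 h)

/-! ### Rotating about a vertex until the boundary is reached -/

/-- Rotating about the corner `c` leads to the free side `t`. -/
inductive Reach : Side p → Side p → Prop
  | refl {t : Side p} : D.glue t = t → Reach t t
  | step {c t : Side p} : D.glue c ≠ c → Reach (D.rot c) t → Reach c t

variable {D}

theorem Reach.free {c t : Side p} (h : D.Reach c t) : D.glue t = t := by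
  induction h with
  | refl h => exact h
  | step _ _ ih => exact ih

theorem Reach.eq_of_free {c t : Side p} (h : D.Reach c t) (hc : D.glue c = c) : t = c := by
  cases h with
  | refl => rfl
  | step h _ => exact absurd hc h

theorem Reach.of_not_free {c t : Side p} (h : D.Reach c t) (hc : D.glue c ≠ c) :
    D.Reach (D.rot c) t := by
  cases h with
  | refl h => exact absurd h hc
  | step _ h => exact h

theorem Reach.unique {c t t' : Side p} (h : D.Reach c t) (h' : D.Reach c t') : t = t' := by
  induction h with
  | refl h => exact (h'.eq_of_free h).symm
  | step hc _ ih => exact ih (h'.of_not_free hc)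

theorem Reach.mem_of_closed {c t : Side p} (h : D.Reach c t) {S : Finset (Side p)} (ht : t ∈ S)
    (hS : ∀ c, D.glue c ≠ c → D.rot c ∈ S → c ∈ S) : c ∈ S := by
  induction h with
  | refl => exact ht
  | step hc _ ih => exact hS _ hc (ih ht)

theorem Reach.start_eq {c t : Side p} (h : D.Reach c t) : D.start c = D.start t := by
  induction h with
  | refl => rfl
  | step hc _ ih => rw [← ih, D.start_rot hc]

theorem vertex_rot {c : Side p} (hc : D.glue c ≠ c) : D.vertex (D.rot c) = D.vertex c :=
  (Quot.sound ⟨hc, rfl⟩).symm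

/-- A property of corners that is invariant under rotation is a property of vertices. -/
theorem vertex_induction {P : Side p → Prop} (hP : ∀ c, D.glue c ≠ c → (P (D.rot c) ↔ P c))
    {c d : Side p} (h : D.vertex c = D.vertex d) : P c ↔ P d := by
  have key : ∀ a b, D.CornerRel a b → P a = P b := by
    rintro a b ⟨ha, rfl⟩
    exact propext (hP a ha).symm
  exact iff_of_eq (congrArg (Quot.lift P key) h)

/-- `Reach` is invariant under crossing a glued side, so it passes to the quotient. Statements about
vertices of the boundary thus become statements about a deterministic rotation. -/
theorem vertex_eq_iff {c t : Side p} (ht : D.glue t = t) :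
    D.vertex c = D.vertex t ↔ D.Reach c t := by
  constructor
  · intro h
    refine (vertex_induction (P := fun x => D.Reach x t) (fun c hc => ?_) h).2 (.refl ht)
    exact ⟨Reach.step hc, fun h => h.of_not_free hc⟩
  · intro h
    induction h with
    | refl => rfl
    | step hc _ ih => rw [← ih ht, vertex_rot hc]

theorem free_eq_of_vertex_eq {s t : Side p} (hs : D.glue s = s) (ht : D.glue t = t)
    (h : D.vertex s = D.vertex t) : s = t :=
  (((vertex_eq_iff ht).1 h).eq_of_free hs).symm

/-! ### The degree conditions, in local form -/

variable (D)

/-- Rotating about the corner `c`, one meets the boundary after at most three corners, or one comes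
back to `c` after four of them. -/
def FlatAt (c : Side p) : Prop := D.glue c = c ∨ D.glue (D.rot c) = D.rot c ∨
  D.glue (D.rot (D.rot c)) = D.rot (D.rot c) ∨
  (D.glue (D.rot (D.rot (D.rot c))) ≠ D.rot (D.rot (D.rot c)) ∧
    D.rot (D.rot (D.rot (D.rot c))) = c)

/-- Local form of the degree conditions. -/
def Flat : Prop := ∀ c, D.FlatAt c

/-- The adjacency graph of the squares is connected. -/
def Connected : Prop := ∀ f g : Fin p,
  Relation.ReflTransGen (fun a b => ∃ k : Fin 4, (D.glue (a, k)).1 = b) f g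

variable {D}

theorem corners_eq_card {v : D.Vertex} (S : Finset (Side p)) (h : ∀ c, D.vertex c = v ↔ c ∈ S) :
    D.corners v = S.card := by
  rw [corners, Nat.card_congr (Equiv.subtypeEquivRight h)]
  simp

theorem ne_of_snd_ne {a b : Side p} (h : a.2 ≠ b.2) : a ≠ b := fun e => h (congrArg Prod.snd e)

theorem fin4_add_ne (k : Fin 4) : k + 3 ≠ k ∧ k + 3 + 3 ≠ k ∧ k + 3 + 3 + 3 ≠ k ∧
    k + 3 + 3 + 3 + 3 = k := by
  fin_cases k <;> decide

/-- Each rotation subtracts one from the side number modulo 4, so four successive corners are told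
apart by their side numbers. -/
theorem card_four {a b c d : Side p} (hb : b.2 = a.2 + 3) (hc : c.2 = b.2 + 3)
    (hd : d.2 = c.2 + 3) : ({a, b, c, d} : Finset (Side p)).card = 4 := by
  have h := fin4_add_ne a.2
  have h' := fin4_add_ne b.2
  have h'' := fin4_add_ne c.2
  have e₁ : a ≠ b := (ne_of_snd_ne (by rw [hb]; exact h.1)).symm
  have e₂ : a ≠ c := (ne_of_snd_ne (by rw [hc, hb]; exact h.2.1)).symm
  have e₃ : a ≠ d := (ne_of_snd_ne (by rw [hd, hc, hb]; exact h.2.2.1)).symm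
  have e₄ : b ≠ c := (ne_of_snd_ne (by rw [hc]; exact h'.1)).symm
  have e₅ : b ≠ d := (ne_of_snd_ne (by rw [hd, hc]; exact h'.2.1)).symm
  have e₆ : c ≠ d := (ne_of_snd_ne (by rw [hd]; exact h''.1)).symm
  simp [e₁, e₂, e₃, e₄, e₅, e₆]

theorem flat_of_degrees (h₁ : ∀ v, ¬ D.IsBoundaryVertex v → D.corners v = 4)
    (h₂ : ∀ v, D.IsBoundaryVertex v → D.corners v + 1 ∈ ({2, 3, 4} : Set ℕ)) : D.Flat := by
  classical
  intro c
  by_cases hc : D.glue c = c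
  · exact .inl hc
  by_cases hc₁ : D.glue (D.rot c) = D.rot c
  · exact .inr (.inl hc₁)
  by_cases hc₂ : D.glue (D.rot (D.rot c)) = D.rot (D.rot c)
  · exact .inr (.inr (.inl hc₂))
  refine .inr (.inr (.inr ?_))
  have i₁ := D.rot_snd hc
  have i₂ := D.rot_snd hc₁
  have i₃ := D.rot_snd hc₂
  have v₁ := vertex_rot hc
  have v₂ := (vertex_rot hc₁).trans v₁
  have v₃ := (vertex_rot hc₂).trans v₂
  set S : Finset (Side p) := {c, D.rot c, D.rot (D.rot c), D.rot (D.rot (D.rot c))} with hS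
  have hcard : S.card = 4 := card_four i₁ i₂ i₃
  set F : Finset (Side p) := Finset.univ.filter fun d => D.vertex d = D.vertex c with hF
  have hFc : D.corners (D.vertex c) = F.card := corners_eq_card F (by simp [hF])
  have hsub : S ⊆ F := by
    intro d hd
    simp only [hS, Finset.mem_insert, Finset.mem_singleton] at hd
    rcases hd with rfl | rfl | rfl | rfl <;> simp [hF, v₁, v₂, v₃]
  have hle := Finset.card_le_card hsub
  -- A boundary vertex has at most three corners, and four distinct ones have been found.
  have hbulk : ¬ D.IsBoundaryVertex (D.vertex c) := by
    intro hb
    have := h₂ _ hb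
    simp only [Set.mem_insert_iff, Set.mem_singleton_iff] at this
    omega
  have hc₃ : D.glue (D.rot (D.rot (D.rot c))) ≠ D.rot (D.rot (D.rot c)) :=
    fun h => hbulk ⟨_, h, v₃⟩
  refine ⟨hc₃, ?_⟩
  have hSF : S = F := Finset.eq_of_subset_of_card_le hsub (by rw [← hFc, h₁ _ hbulk, hcard])
  have i₄ := D.rot_snd hc₃
  -- The fibre consists of the four known corners. The next rotation stays in it, and its side
  -- number excludes all of them but `c`.
  have hmem : D.rot (D.rot (D.rot (D.rot c))) ∈ S := by
    rw [hSF]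
    simp [hF, (vertex_rot hc₃).trans v₃]
  simp only [hS, Finset.mem_insert, Finset.mem_singleton] at hmem
  have n₁ := (fin4_add_ne (D.rot c).2).2.2.1
  have n₂ := (fin4_add_ne (D.rot (D.rot c)).2).2.1
  have n₃ := (fin4_add_ne (D.rot (D.rot (D.rot c))).2).1
  rw [← i₂, ← i₃, ← i₄] at n₁
  rw [← i₃, ← i₄] at n₂
  rw [← i₄] at n₃
  rcases hmem with h | h | h | h
  · exact h
  · exact absurd (congrArg Prod.snd h) n₁
  · exact absurd (congrArg Prod.snd h) n₂
  · exact absurd (congrArg Prod.snd h) n₃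

theorem Flat.corners_bulk (hD : D.Flat) {v : D.Vertex} (hv : ¬ D.IsBoundaryVertex v) :
    D.corners v = 4 := by
  classical
  induction v using Quot.inductionOn with
  | h c =>
    change ¬ D.IsBoundaryVertex (D.vertex c) at hv
    change D.corners (D.vertex c) = 4
    have hc : D.glue c ≠ c := fun h => hv ⟨_, h, rfl⟩
    have v₁ := vertex_rot hc
    have hc₁ : D.glue (D.rot c) ≠ D.rot c := fun h => hv ⟨_, h, v₁⟩
    have v₂ := (vertex_rot hc₁).trans v₁
    have hc₂ : D.glue (D.rot (D.rot c)) ≠ D.rot (D.rot c) := fun h => hv ⟨_, h, v₂⟩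
    have v₃ := (vertex_rot hc₂).trans v₂
    obtain ⟨hc₃, hc₄⟩ := (((hD c).resolve_left hc).resolve_left hc₁).resolve_left hc₂
    rw [← card_four (D.rot_snd hc) (D.rot_snd hc₁) (D.rot_snd hc₂)]
    refine corners_eq_card _ fun d => ⟨fun h => ?_, fun h => ?_⟩
    · refine (vertex_induction (D := D) (P := fun x => x ∈
        ({c, D.rot c, D.rot (D.rot c), D.rot (D.rot (D.rot c))} : Finset (Side p)))
        (fun x _ => ?_) h).2 (by simp)
      simp only [Finset.mem_insert, Finset.mem_singleton, D.rot_injective.eq_iff]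
      constructor
      · rintro (h | h | h | h)
        · exact .inr (.inr (.inr (D.rot_injective (h.trans hc₄.symm))))
        · exact .inl h
        · exact .inr (.inl h)
        · exact .inr (.inr (.inl h))
      · rintro (h | h | h | h)
        · exact .inr (.inl h)
        · exact .inr (.inr (.inl h))
        · exact .inr (.inr (.inr h))
        · exact .inl (by rw [h, hc₄])
    · simp only [Finset.mem_insert, Finset.mem_singleton] at h
      rcases h with rfl | rfl | rfl | rfl
      exacts [rfl, v₁, v₂, v₃]

/-- The signed quarter turn from a direction to another one, which is not the opposite one. -/
def turn (j k : Fin 4) : ℤ := if k = j + 1 then 1 else if k = j + 3 then -1 else 0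

/-- At a boundary vertex, the number of corners is determined by the directions of the boundary
edges that end and start there. -/
theorem Flat.corners_boundary (hD : D.Flat) {s t : Side p} (hs : D.glue s = s)
    (h : D.Reach s.next t) : (2 : ℤ) - D.corners (D.vertex t) = turn s.2 t.2 ∧ t.2 ≠ s.2 + 2 ∧
      D.corners (D.vertex t) ∈ ({1, 2, 3} : Set ℕ) := by
  classical
  have ht := h.free
  -- Since `s` is free, `rot s = s.next`; by injectivity of `rot` no glued side rotates into
  -- `s.next`. The fan of corners at the end of `s` therefore begins at `s.next`.
  have hback : ∀ c, D.glue c ≠ c → D.rot c ≠ s.next := by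
    intro c hc h
    rw [← D.rot_of_free hs] at h
    rw [D.rot_injective h] at hc
    exact hc hs
  have key : ∀ S : Finset (Side p), t ∈ S → (∀ c ∈ S, D.Reach c t) →
      (∀ c, D.glue c ≠ c → D.rot c ∈ S → c ∈ S) → D.corners (D.vertex t) = S.card :=
    fun S h₁ h₂ h₃ => corners_eq_card S fun c => ⟨fun h => ((vertex_eq_iff ht).1 h).mem_of_closed
      h₁ h₃, fun h => (vertex_eq_iff ht).2 (h₂ c h)⟩
  have arith : ∀ k : Fin 4, turn k (k + 1) = 1 ∧ turn k (k + 1 + 3) = 0 ∧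
      turn k (k + 1 + 3 + 3) = -1 ∧ k + 1 ≠ k + 2 ∧ k + 1 + 3 ≠ k + 2 ∧ k + 1 + 3 + 3 ≠ k + 2 := by
    decide
  obtain ⟨a₁, a₂, a₃, a₄, a₅, a₆⟩ := arith s.2
  by_cases hc : D.glue s.next = s.next
  · obtain rfl := h.eq_of_free hc
    have hcard := key {s.next} (by simp) (by simpa using Reach.refl hc) (by
      intro c hc' h'
      rw [Finset.mem_singleton] at h'
      exact absurd h' (hback c hc'))
    rw [hcard]
    exact ⟨by rw [Side.next_snd, a₁]; norm_num, a₄, by simp⟩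
  have i₁ := D.rot_snd hc
  rw [Side.next_snd] at i₁
  have h' := h.of_not_free hc
  by_cases hc₁ : D.glue (D.rot s.next) = D.rot s.next
  · obtain rfl := h'.eq_of_free hc₁
    have hcard := key {s.next, D.rot s.next} (by simp) (by
        simpa using And.intro h h') (by
      intro c hc' h'
      simp only [Finset.mem_insert, Finset.mem_singleton, D.rot_injective.eq_iff] at h' ⊢
      exact .inl (h'.resolve_left (hback c hc')))
    rw [Finset.card_pair (fun e => hc (by rw [e, hc₁]))] at hcard
    rw [hcard, i₁]
    exact ⟨by rw [a₂]; norm_num, a₅, by simp⟩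
  have i₂ := D.rot_snd hc₁
  rw [i₁] at i₂
  have h'' := h'.of_not_free hc₁
  -- A full turn would come back to `s.next` through a glued side, which `hback` forbids; hence the
  -- fan has at most three corners.
  have hc₂ : D.glue (D.rot (D.rot s.next)) = D.rot (D.rot s.next) := by
    by_contra hc₂
    obtain ⟨hc₃, hc₄⟩ := (((hD s.next).resolve_left hc).resolve_left hc₁).resolve_left hc₂
    exact hback _ hc₃ hc₄
  obtain rfl := h''.eq_of_free hc₂
  have hcard := key {s.next, D.rot s.next, D.rot (D.rot s.next)} (by simp) (by
      simpa using And.intro h (And.intro h' h'')) (by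
    intro c hc' h'
    simp only [Finset.mem_insert, Finset.mem_singleton, D.rot_injective.eq_iff] at h' ⊢
    rcases h' with h' | h' | h'
    exacts [absurd h' (hback c hc'), .inl h', .inr (.inl h')])
  rw [Finset.card_eq_three.2 ⟨_, _, _, fun e => hback _ hc e.symm, fun e => hc (by rw [e, hc₂]),
    fun e => hc₁ (by rw [e, hc₂]), rfl⟩] at hcard
  rw [hcard, i₂]
  exact ⟨by rw [a₃]; norm_num, a₆, by simp⟩

end SquareSurface
/-! ### Lists arranged in a cycle -/

/-- Marked edges are placed last in their lists. This form isolates the relation that closes the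
cycle, the one that a gluing modifies. -/
theorem chain_append_singleton_iff {α : Type*} {r : α → α → Prop} {d : List α} {v x : α}
    (hx : x ∈ (d ++ [v]).head?) :
    ((d ++ [v] : List α) : Cycle α).Chain r ↔ (d ++ [v]).IsChain r ∧ r v x := by
  obtain ⟨y, l, hl⟩ : ∃ y l, d ++ [v] = y :: l := List.exists_cons_of_ne_nil (by simp)
  have hlast : (y :: l).getLast? = some v := by rw [← hl]; simp
  rw [hl] at hx ⊢
  obtain rfl : y = x := by simpa using hx
  rw [Cycle.chain_coe_cons, ← List.cons_append, List.isChain_append, hlast]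
  simp

theorem chain_iff_getElem {α : Type*} {r : α → α → Prop} {b : List α} :
    (b : Cycle α).Chain r ↔
      ∀ (i : ℕ) (h : i < b.length), r b[i] (b[(i + 1) % b.length]'(Nat.mod_lt _ (by omega))) := by
  cases b with
  | nil => simp
  | cons a l =>
    rw [Cycle.chain_coe_cons, List.isChain_iff_getElem]
    have key : ∀ (i : ℕ) (h : i < (a :: l).length) (h' : i + 1 < (a :: (l ++ [a])).length),
        (a :: (l ++ [a]))[i + 1] = (a :: l)[(i + 1) % (a :: l).length]'(Nat.mod_lt _ (by simp)) := by
      intro i h h'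
      simp only [List.length_cons] at h
      rcases Nat.lt_or_ge i l.length with hi | hi
      · simp [Nat.mod_eq_of_lt (show i + 1 < l.length + 1 by omega), hi]
      · obtain rfl : i = l.length := by omega
        simp
    have key' : ∀ (i : ℕ) (h : i < (a :: l).length) (h' : i < (a :: (l ++ [a])).length),
        (a :: (l ++ [a]))[i] = (a :: l)[i] := by
      intro i h h'
      simp only [← List.cons_append]
      exact List.getElem_append_left h
    constructor
    · intro h i hi
      have h := h i (by simpa using hi)
      rwa [key i hi, key' i hi] at h
    · intro h i hi
      have hi' : i < (a :: l).length := by simpa using hi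
      rw [key i hi', key' i hi']
      exact h i hi'

theorem exists_pred_of_chain {α : Type*} {r : α → α → Prop} {b : List α}
    (h : (b : Cycle α).Chain r) {t : α} (ht : t ∈ b) : ∃ s ∈ b, r s t := by
  obtain ⟨i, hi, rfl⟩ := List.getElem_of_mem ht
  rw [chain_iff_getElem] at h
  cases i with
  | zero =>
    have := h (b.length - 1) (by omega)
    simp only [Nat.sub_add_cancel (show 1 ≤ b.length by omega), Nat.mod_self] at this
    exact ⟨_, List.getElem_mem _, this⟩
  | succ i =>
    have := h i (by omega)
    simp only [Nat.mod_eq_of_lt hi] at this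
    exact ⟨_, List.getElem_mem _, this⟩

/-- Sum over the pairs of consecutive elements of a list. -/
def pairSum {α : Type*} (f : α → α → ℤ) : List α → ℤ
  | [] => 0
  | [_] => 0
  | a :: b :: l => f a b + pairSum f (b :: l)

theorem pairSum_append {α : Type*} (f : α → α → ℤ) (l m : List α) (a : α) :
    pairSum f (l ++ a :: m) = pairSum f (l ++ [a]) + pairSum f (a :: m) := by
  induction l with
  | nil => simp [pairSum]
  | cons x l ih =>
    cases l with
    | nil => simp [pairSum]
    | cons y l =>
      simp only [List.cons_append, pairSum] at ih ⊢
      rw [ih, add_assoc]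

/-- Sum over the pairs of cyclically consecutive elements of a list. -/
def cycSum {α : Type*} (f : α → α → ℤ) : List α → ℤ
  | [] => 0
  | a :: l => pairSum f (a :: (l ++ [a]))

theorem sum_map_eq_pairSum {α β : Type*} {f : β → β → ℤ} {g : α → ℤ} {q : α → β} {a : α}
    {m : List α} (h : (a :: m).IsChain fun x y => g y = f (q x) (q y)) :
    (m.map g).sum = pairSum f ((a :: m).map q) := by
  induction m generalizing a with
  | nil => simp [pairSum]
  | cons b m ih =>
    rw [List.isChain_cons_cons] at h
    simp only [List.map_cons, List.sum_cons, pairSum, h.1]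
    rw [ih h.2]
    simp

/-- The weight of a boundary vertex is carried by the side that starts there, and depends on that
side and its predecessor; summing over sides is summing over consecutive pairs. -/
theorem sum_map_eq_cycSum {α β : Type*} {f : β → β → ℤ} {g : α → ℤ} {q : α → β} {b : List α}
    (h : (b : Cycle α).Chain fun x y => g y = f (q x) (q y)) :
    (b.map g).sum = cycSum f (b.map q) := by
  cases b with
  | nil => simp [cycSum]
  | cons a l =>
    rw [Cycle.chain_coe_cons] at h
    have := sum_map_eq_pairSum h
    simp only [List.map_cons, cycSum, List.map_append, List.map_nil, List.sum_append,
      List.sum_cons, List.sum_nil] at this ⊢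
    rw [← this]
    ring

theorem pairSum_eq_sum_range {α : Type*} [Inhabited α] (f : α → α → ℤ) (a : α) (m : List α) :
    pairSum f (a :: m) =
      ∑ i ∈ Finset.range m.length, f ((a :: m).getD i default) ((a :: m).getD (i + 1) default) := by
  induction m generalizing a with
  | nil => simp [pairSum]
  | cons b m ih =>
    rw [pairSum, ih, List.length_cons, Finset.sum_range_succ', add_comm]
    simp

theorem cycSum_eq_sum_range {α : Type*} [Inhabited α] (f : α → α → ℤ) (b : List α) :
    cycSum f b = ∑ i ∈ Finset.range b.length,
      f (b.getD (i % b.length) default) (b.getD ((i + 1) % b.length) default) := by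
  cases b with
  | nil => simp [cycSum]
  | cons a l =>
    rw [cycSum, pairSum_eq_sum_range]
    refine Finset.sum_congr (by simp) fun i hi => ?_
    have hi : i < l.length + 1 := by simpa using hi
    have h₁ : (a :: (l ++ [a])).getD i default = (a :: l).getD (i % (a :: l).length) default := by
      rw [List.length_cons, Nat.mod_eq_of_lt hi, ← List.cons_append, List.getD_append _ _ _ _ hi]
    rw [h₁]
    congr 1
    rcases Nat.lt_or_ge i l.length with h | h
    · rw [List.length_cons, Nat.mod_eq_of_lt (by omega), ← List.cons_append,
        List.getD_append _ _ _ _ (by simpa using h)]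
    · obtain rfl : i = l.length := by omega
      simp

/-! ### Counting vertices and edges -/

/-- Double counting for a map whose fibres have `m` elements, except those of special points, which
are counted separately. -/
theorem card_mul_eq {X Y : Type*} [Fintype X] [Finite Y] {q : X → Y}
    (m : ℤ) (S : Finset X) (hS : ∀ x ∈ S, ∀ y ∈ S, q x = q y → x = y)
    (hm : ∀ y, (∀ x ∈ S, q x ≠ y) → (Nat.card {x // q x = y} : ℤ) = m) :
    m * Nat.card Y = Fintype.card X + ∑ x ∈ S, (m - Nat.card {z // q z = q x}) := by
  classical
  have := Fintype.ofFinite Y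
  have h₁ : (Fintype.card X : ℤ) = ∑ y : Y, (Nat.card {x // q x = y} : ℤ) := by
    rw [← Nat.cast_sum, ← Nat.card_eq_fintype_card, ← Nat.card_sigma,
      Nat.card_congr (Equiv.sigmaFiberEquiv q)]
  have h₂ : ∑ x ∈ S, (m - (Nat.card {z // q z = q x} : ℤ)) =
      ∑ y ∈ S.image q, (m - (Nat.card {z // q z = y} : ℤ)) := by
    rw [Finset.sum_image hS]
  have h₃ : ∑ y ∈ S.image q, (m - (Nat.card {z // q z = y} : ℤ)) =
      ∑ y : Y, (m - (Nat.card {z // q z = y} : ℤ)) := by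
    refine Finset.sum_subset (Finset.subset_univ _) fun y _ hy => ?_
    rw [hm y (fun x hx h => hy (Finset.mem_image.2 ⟨x, hx, h⟩)), sub_self]
  rw [h₂, h₃, h₁, Finset.sum_sub_distrib, Nat.card_eq_fintype_card]
  simp [mul_comm]

namespace SquareSurface

variable {p : ℕ} {D : SquareSurface p}

instance : Finite D.Vertex := inferInstanceAs (Finite (Quot _))

instance : Finite D.Edge := inferInstanceAs (Finite (Quot _))

variable (D) in
/-- The Euler characteristic. -/
noncomputable def euler : ℤ := (Nat.card D.Vertex : ℤ) - Nat.card D.Edge + p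

/-- Among the `4p` sides, an edge accounts for two if it is glued and for one if it is free. -/
theorem two_mul_card_edge (F : Finset (Side p)) (hF : ∀ s, s ∈ F ↔ D.glue s = s) :
    (2 : ℤ) * Nat.card D.Edge = 4 * p + F.card := by
  classical
  let q : Side p → D.Edge := Quot.mk _
  have hglue : ∀ s, q (D.glue s) = q s := fun s =>
    (Quot.sound (r := fun s t : Side p => t = D.glue s) rfl).symm
  have hq : ∀ s t, q s = q t ↔ s = t ∨ s = D.glue t := by
    intro s t
    constructor
    · intro h
      have key : ∀ a b : Side p, b = D.glue a → (a = t ∨ a = D.glue t) = (b = t ∨ b = D.glue t) := by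
        rintro a _ rfl
        rw [D.glue_injective.eq_iff, or_comm]
        congr! 1
        constructor
        · rintro rfl; exact D.glue_glue t
        · rintro rfl; exact (D.glue_glue a).symm
      exact (iff_of_eq (congrArg (Quot.lift (fun a => a = t ∨ a = D.glue t) key) h)).2 (.inl rfl)
    · rintro (rfl | rfl)
      exacts [rfl, hglue t]
  have hcard : ∀ t, (Nat.card {s // q s = q t} : ℤ) = if D.glue t = t then 1 else 2 := by
    intro t
    have : Nat.card {s // q s = q t} = ({t, D.glue t} : Finset (Side p)).card := by
      rw [Nat.card_congr (Equiv.subtypeEquivRight (q := fun s => s ∈ ({t, D.glue t} : Finset _))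
        (fun s => by simp [hq]))]
      rw [Nat.card_eq_fintype_card, Fintype.card_coe]
    rw [this]
    split_ifs with h
    · simp [h]
    · rw [Finset.card_pair (Ne.symm h)]
      rfl
  have := card_mul_eq (q := q) 2 F (by
    intro s hs t ht h
    rw [hF] at hs ht
    rcases (hq s t).1 h with h | h
    · exact h
    · rw [h, ht]) (by
    intro y hy
    obtain ⟨t, rfl⟩ := Quot.mk_surjective y
    change (Nat.card {s // q s = q t} : ℤ) = 2
    rw [hcard, if_neg fun h => hy t ((hF t).2 h) rfl])
  rw [this, Finset.sum_congr rfl (g := fun _ => 1) fun s hs => by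
    rw [hcard, if_pos ((hF s).1 hs)]; norm_num]
  simp [mul_comm]

theorem Flat.four_mul_card_vertex (hD : D.Flat) (F : Finset (Side p))
    (hF : ∀ s, s ∈ F ↔ D.glue s = s) :
    (4 : ℤ) * Nat.card D.Vertex = 4 * p + ∑ t ∈ F, (4 - (D.corners (D.vertex t) : ℤ)) := by
  have := card_mul_eq (q := D.vertex) 4 F (by
    intro s hs t ht h
    exact free_eq_of_vertex_eq ((hF s).1 hs) ((hF t).1 ht) h) (by
    intro v hv
    exact_mod_cast hD.corners_bulk (by rintro ⟨s, hs, rfl⟩; exact hv s ((hF s).2 hs) rfl))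
  rw [this]
  simp [mul_comm, corners]

/-- This is `4V - 4E + 4p`, with `4V = 4p + ∑ (4 - corners)` and `2E = 4p + |F|`. -/
theorem Flat.four_mul_euler (hD : D.Flat) (F : Finset (Side p))
    (hF : ∀ s, s ∈ F ↔ D.glue s = s) :
    4 * D.euler = ∑ t ∈ F, (2 - (D.corners (D.vertex t) : ℤ)) := by
  have h₁ := two_mul_card_edge F hF
  have h₂ := hD.four_mul_card_vertex F hF
  simp only [Finset.sum_sub_distrib, Finset.sum_const, nsmul_eq_mul] at h₂ ⊢
  rw [euler]
  linarith

/-! ### The boundary, as a list of free sides -/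

variable (D) in
/-- The free sides of `D`, listed in the order in which they are met along the boundary. -/
structure BoundaryList (b : List (Side p)) : Prop where
  nodup : b.Nodup
  mem_iff : ∀ s, s ∈ b ↔ D.glue s = s
  chain : (b : Cycle (Side p)).Chain fun s t => D.Reach s.next t

theorem chain_reach_iff {b : List (Side p)} (hb : ∀ s, s ∈ b ↔ D.glue s = s) :
    (b : Cycle (Side p)).Chain (fun s t => D.Reach s.next t) ↔
      (b : Cycle (Side p)).Chain (fun s t => D.vertex s.next = D.vertex t) := by
  simp only [chain_iff_getElem]
  refine forall₂_congr fun i hi => ?_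
  rw [vertex_eq_iff ((hb _).1 (List.getElem_mem _))]

/-- The cycle of free sides can be rotated so that its starting points give the chosen list exactly,
not only up to rotation. A marked edge of the path then becomes a marked free side. -/
theorem bounds_coe_iff {root : List Pt} :
    D.Bounds root ↔ ∃ b, D.BoundaryList b ∧ b.map D.start = root := by
  constructor
  · rintro ⟨β, h₁, h₂, h₃, h₄⟩
    induction β using Quotient.inductionOn' with
    | h l =>
      change ((l.map D.start : List Pt) : Cycle Pt) = root at h₄
      obtain ⟨k, hk⟩ := Cycle.coe_eq_coe.1 h₄
      refine ⟨l.rotate k, ⟨?_, ?_, ?_⟩, by rw [List.map_rotate, hk]⟩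
      · exact List.nodup_rotate.2 h₁
      · intro s
        rw [List.mem_rotate]
        exact h₂ s
      · have e : ((l.rotate k : List (Side p)) : Cycle (Side p)) = (l : Cycle _) :=
          Cycle.coe_eq_coe.2 (List.IsRotated.symm ⟨k, rfl⟩)
        rw [e, chain_reach_iff h₂]
        exact h₃
  · rintro ⟨b, h, rfl⟩
    exact ⟨b, h.nodup, h.mem_iff, (chain_reach_iff h.mem_iff).1 h.chain, rfl⟩

theorem BoundaryList.rotate {b : List (Side p)} (h : D.BoundaryList b) (k : ℕ) :
    D.BoundaryList (b.rotate k) where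
  nodup := List.nodup_rotate.2 h.nodup
  mem_iff s := by rw [List.mem_rotate, h.mem_iff]
  chain := by
    have e : ((b.rotate k : List (Side p)) : Cycle (Side p)) = (b : Cycle _) :=
      Cycle.coe_eq_coe.2 (List.IsRotated.symm ⟨k, rfl⟩)
    rw [e]
    exact h.chain

/-- The conditions on a disk, apart from the Euler characteristic, for a surface with a connected
boundary. -/
theorem isDisk_iff {b : List (Side p)} (h : D.BoundaryList b) :
    D.IsDisk ↔ 0 < p ∧ D.Connected ∧ D.Flat ∧ D.euler = 1 := by
  constructor
  · rintro ⟨h₁, h₂, h₃, h₄, h₅⟩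
    exact ⟨h₁, h₂, flat_of_degrees h₄ h₅, h₃⟩
  · rintro ⟨h₁, h₂, h₃, h₄⟩
    refine ⟨h₁, h₂, h₄, fun v hv => h₃.corners_bulk hv, ?_⟩
    rintro _ ⟨t, ht, rfl⟩
    obtain ⟨s, hs, hst⟩ := exists_pred_of_chain h.chain ((h.mem_iff t).2 ht)
    have := (h₃.corners_boundary ((h.mem_iff s).1 hs) hst).2.2
    simp only [Set.mem_insert_iff, Set.mem_singleton_iff] at this ⊢
    omega

theorem IsDisk.flat (h : D.IsDisk) : D.Flat := flat_of_degrees h.bulk_degree h.boundary_degree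

/-- Gauss-Bonnet: the Euler characteristic is the rotation number of the boundary. -/
theorem Flat.four_mul_euler_eq_turn (hD : D.Flat) {b : List (Side p)} (h : D.BoundaryList b) :
    4 * D.euler = cycSum turn (b.map Prod.snd) := by
  classical
  rw [hD.four_mul_euler b.toFinset (by simpa using h.mem_iff), List.sum_toFinset _ h.nodup]
  refine sum_map_eq_cycSum ?_
  have := h.chain
  rw [chain_iff_getElem] at this ⊢
  exact fun i hi =>
    (hD.corners_boundary ((h.mem_iff _).1 (List.getElem_mem _)) (this i hi)).1

theorem IsDisk.turn_eq (hD : D.IsDisk) {b : List (Side p)} (h : D.BoundaryList b) :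
    cycSum turn (b.map Prod.snd) = 4 := by
  rw [← hD.flat.four_mul_euler_eq_turn h, show D.euler = 1 from hD.euler]
  rfl

theorem IsDisk.boundary_ne_nil (hD : D.IsDisk) {b : List (Side p)} (h : D.BoundaryList b) :
    b ≠ [] := by
  rintro rfl
  simpa [cycSum] using hD.turn_eq h

/-- The directions of the boundary sides are determined by the boundary path. -/
theorem BoundaryList.directions_eq {q : ℕ} {D' : SquareSurface q} {b : List (Side p)}
    {b' : List (Side q)} (h : D.BoundaryList b) (h' : D'.BoundaryList b') {v : Pt}
    (e : b'.map D'.start = (b.map D.start).map (· + v)) :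
    b'.map (fun s => (D'.tile s.1, s.2)) = b.map (fun s => (D.tile s.1 + v, s.2)) := by
  have hl : b'.length = b.length := by simpa using congrArg List.length e
  have key : ∀ i (hi : i < b.length), D'.start (b'[i]'(by omega)) = D.start b[i] + v := by
    intro i hi
    have := congrArg (fun l => l[i]?) e
    simpa [hi, hl] using this
  refine List.ext_getElem (by simpa using hl) fun i h₁ h₂ => ?_
  have hi : i < b.length := by simpa using h₂
  have hi' : i < b'.length := by omega
  have c := (chain_iff_getElem.1 h.chain i hi).start_eq
  have c' := (chain_iff_getElem.1 h'.chain i hi').start_eq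
  have := start_ext (key i hi) (by
    rw [c, c']
    simp only [hl]
    exact key _ _)
  simp [this.1, this.2]

end SquareSurface

namespace SquareSurface

variable {p : ℕ} {D : SquareSurface p}

/-! ### The area -/

/-- Contribution of a side to the area `∮ x dy`. -/
def areaForm : Pt × Fin 4 → ℤ := fun s => ![0, s.1.1 + 1, 0, -s.1.1] s.2

theorem areaForm_glue (T : Pt) (k : Fin 4) :
    areaForm (T + normal k, k + 2) = -areaForm (T, k) := by
  fin_cases k <;> simp [areaForm, normal]

/-- Discrete Green formula: each square contributes `(x + 1) - x = 1`, and the two sides of a glued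
pair cancel, being opposite and on the same lattice edge. -/
theorem BoundaryList.area_eq {b : List (Side p)} (h : D.BoundaryList b) :
    ((b.map fun s => (D.tile s.1, s.2)).map areaForm).sum = (p : ℤ) := by
  classical
  set W : Side p → ℤ := fun s => areaForm (D.tile s.1, s.2) with hW
  have h₁ : ∑ s, W s = p := by
    rw [Fintype.sum_prod_type]
    simp [hW, areaForm, Fin.sum_univ_four]
  have h₂ : ∑ s ∈ Finset.univ.filter (fun s => D.glue s ≠ s), W s = 0 := by
    refine Finset.sum_involution (fun s _ => D.glue s) ?_ ?_ ?_ ?_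
    · intro s hs
      have hs : D.glue s ≠ s := by simpa using hs
      simp only [hW]
      rw [(D.glue_geom hs).1, (D.glue_geom hs).2, areaForm_glue, add_neg_cancel]
    · intro s hs _
      simpa using hs
    · intro s hs
      have hs : D.glue s ≠ s := by simpa using hs
      simpa [D.glue_glue] using hs.symm
    · intro s _
      exact D.glue_glue s
  have h₃ := Finset.sum_filter_add_sum_filter_not Finset.univ (fun s => D.glue s ≠ s) W
  rw [h₂, h₁, zero_add] at h₃
  rw [← h₃, List.map_map, ← List.sum_toFinset _ h.nodup]
  refine Finset.sum_congr ?_ fun _ _ => rfl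
  ext s
  simp [h.mem_iff]

theorem BoundaryList.faces_eq {q : ℕ} {D' : SquareSurface q} {b : List (Side p)}
    {b' : List (Side q)} (h : D.BoundaryList b) (h' : D'.BoundaryList b')
    (e : b'.map D'.start = b.map D.start) : q = p := by
  have := h.directions_eq h' (v := 0) (by rw [e]; simp [Function.comp_def])
  have h₁ := h.area_eq
  have h₂ := h'.area_eq
  rw [this] at h₂
  simp only [add_zero] at h₂
  exact_mod_cast h₂.symm.trans h₁

/-! ### Extremal squares -/

theorem exists_top (g : Fin p) : ∃ g', D.glue (g', 2) = (g', 2) ∧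
    ∀ g, (D.tile g).2 ≤ (D.tile g').2 := by
  obtain ⟨g', -, h₁, h₂⟩ := D.exists_free_dir 2 (fun _ => True) (fun _ _ _ => trivial) Prod.snd
    (fun T => by simp [normal]) (g := g) trivial
  exact ⟨g', h₁, fun g => h₂ g trivial⟩

theorem exists_bottom (g : Fin p) : ∃ g', D.glue (g', 0) = (g', 0) ∧
    ∀ g, (D.tile g').2 ≤ (D.tile g).2 := by
  obtain ⟨g', -, h₁, h₂⟩ := D.exists_free_dir 0 (fun _ => True) (fun _ _ _ => trivial)
    (fun T => -T.2) (fun T => by simp [normal]) (g := g) trivial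
  exact ⟨g', h₁, fun g => neg_le_neg_iff.1 (h₂ g trivial)⟩

theorem exists_right (g : Fin p) : ∃ g', D.glue (g', 1) = (g', 1) ∧
    ∀ g, (D.tile g).1 ≤ (D.tile g').1 := by
  obtain ⟨g', -, h₁, h₂⟩ := D.exists_free_dir 1 (fun _ => True) (fun _ _ _ => trivial) Prod.fst
    (fun T => by simp [normal]) (g := g) trivial
  exact ⟨g', h₁, fun g => h₂ g trivial⟩

theorem exists_left (g : Fin p) : ∃ g', D.glue (g', 3) = (g', 3) ∧
    ∀ g, (D.tile g').1 ≤ (D.tile g).1 := by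
  obtain ⟨g', -, h₁, h₂⟩ := D.exists_free_dir 3 (fun _ => True) (fun _ _ _ => trivial)
    (fun T => -T.1) (fun T => by simp [normal]) (g := g) trivial
  exact ⟨g', h₁, fun g => neg_le_neg_iff.1 (h₂ g trivial)⟩

theorem BoundaryList.tile_lt {b : List (Side p)} (h : D.BoundaryList b) {m : ℤ}
    (hm : ∀ s ∈ b, (D.start s).2 ≤ m) (g : Fin p) : (D.tile g).2 < m := by
  obtain ⟨g', h₁, h₂⟩ := exists_top (D := D) g
  have := hm _ ((h.mem_iff _).2 h₁)
  simp [start, cornerOffset] at this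
  linarith [h₂ g]

theorem BoundaryList.le_tile {b : List (Side p)} (h : D.BoundaryList b) {m : ℤ}
    (hm : ∀ s ∈ b, m ≤ (D.start s).2) (g : Fin p) : m ≤ (D.tile g).2 := by
  obtain ⟨g', h₁, h₂⟩ := exists_bottom (D := D) g
  have := hm _ ((h.mem_iff _).2 h₁)
  simp [start, cornerOffset] at this
  linarith [h₂ g]

/-- An extremal square in each of the four directions has a free side, so its position is controlled
by the boundary, and with it that of all squares. -/
theorem tile_mem_box {M : ℤ} (hM : ∀ s, D.glue s = s → D.start s ∈ Set.Icc (-M, -M) (M, M))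
    (g : Fin p) : D.tile g ∈ Set.Icc (-M, -M) (M, M) := by
  obtain ⟨g₀, a₀, b₀⟩ := exists_bottom (D := D) g
  obtain ⟨g₁, a₁, b₁⟩ := exists_right (D := D) g
  obtain ⟨g₂, a₂, b₂⟩ := exists_top (D := D) g
  obtain ⟨g₃, a₃, b₃⟩ := exists_left (D := D) g
  have c₀ := hM _ a₀
  have c₁ := hM _ a₁
  have c₂ := hM _ a₂
  have c₃ := hM _ a₃
  simp [start, cornerOffset, Prod.le_def] at c₀ c₁ c₂ c₃ ⊢
  have := b₀ g
  have := b₁ g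
  have := b₂ g
  have := b₃ g
  omega

theorem finite_of_box (p : ℕ) (B : Set Pt) (hB : B.Finite) :
    {D : SquareSurface p | ∀ g, D.tile g ∈ B}.Finite := by
  have := hB.to_subtype
  refine Finite.of_injective (β := (Fin p → B) × (Side p → Side p))
    (fun D => (fun g => ⟨D.1.tile g, D.2 g⟩, D.1.glue)) ?_
  rintro ⟨⟨t, g, h₁, h₂⟩, hD⟩ ⟨⟨t', g', h₁', h₂'⟩, hD'⟩ h
  simp only [Prod.mk.injEq, funext_iff, Subtype.mk.injEq] at h
  obtain ⟨e₁, e₂⟩ := h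
  obtain rfl : t = t' := funext e₁
  obtain rfl : g = g' := funext fun s => e₂ s
  rfl

end SquareSurface

/-! ### Uniqueness of the area and finiteness of the fillings -/

open SquareSurface

theorem Filling.exists_boundaryList {root : List Pt} (A : Filling root) :
    ∃ b, A.disk.BoundaryList b ∧ b.map A.disk.start = root :=
  bounds_coe_iff.1 A.bounds

theorem Filling.faces_eq {γ : Cycle Pt} (A B : Filling γ) : A.faces = B.faces := by
  induction γ using Quotient.inductionOn' with
  | h root =>
    obtain ⟨b, h₁, h₂⟩ := Filling.exists_boundaryList (root := root) A
    obtain ⟨b', h₁', h₂'⟩ := Filling.exists_boundaryList (root := root) B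
    exact h₁'.faces_eq h₁ (h₂.trans h₂'.symm)

theorem exists_box (root : List Pt) : ∃ M : ℤ, ∀ P ∈ root, P ∈ Set.Icc (-M, -M) (M, M) := by
  induction root with
  | nil => exact ⟨0, by simp⟩
  | cons P l ih =>
    obtain ⟨M, hM⟩ := ih
    refine ⟨|M| + |P.1| + |P.2|, ?_⟩
    have a₁ := abs_nonneg P.1
    have a₂ := abs_nonneg P.2
    have a₃ := abs_nonneg M
    have b₁ := le_abs_self P.1
    have b₂ := le_abs_self P.2
    have b₃ := le_abs_self M
    have c₁ := neg_abs_le P.1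
    have c₂ := neg_abs_le P.2
    intro Q hQ
    rw [Set.mem_Icc, Prod.le_def, Prod.le_def]
    rcases List.mem_cons.1 hQ with rfl | hQ
    · refine ⟨⟨?_, ?_⟩, ⟨?_, ?_⟩⟩ <;> dsimp only <;> linarith
    · have := hM Q hQ
      rw [Set.mem_Icc, Prod.le_def, Prod.le_def] at this
      obtain ⟨⟨d₁, d₂⟩, d₃, d₄⟩ := this
      dsimp only at d₁ d₂ d₃ d₄
      refine ⟨⟨?_, ?_⟩, ⟨?_, ?_⟩⟩ <;> dsimp only <;> linarith

/-- All fillings have as many squares as a fixed one, and their squares lie in a box that contains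
`γ`; this leaves finitely many tile maps and gluings. -/
instance (γ : Cycle Pt) : Finite (Filling γ) := by
  rcases isEmpty_or_nonempty (Filling γ) with _ | ⟨⟨A₀⟩⟩
  · infer_instance
  induction γ using Quotient.inductionOn' with
  | h root =>
    obtain ⟨M, hM⟩ := exists_box root
    have := (finite_of_box A₀.faces _ (Set.finite_Icc (-M, -M) (M, M))).to_subtype
    let X := {D : {D : SquareSurface A₀.faces | ∀ g, D.tile g ∈ Set.Icc (-M, -M) (M, M)} //
      D.1.IsDisk ∧ D.1.Bounds root}
    refine Finite.of_surjective (α := X) (fun D => ⟨A₀.faces, D.1.1, D.2.1, D.2.2⟩) fun A => ?_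
    have hA := A.faces_eq A₀
    obtain ⟨b, h₁, h₂⟩ := Filling.exists_boundaryList (root := root) A
    have hbox := tile_mem_box (D := A.disk) (M := M) fun s hs => by
      have hs := List.mem_map_of_mem (f := A.disk.start) ((h₁.mem_iff s).2 hs)
      rw [h₂] at hs
      exact hM _ hs
    obtain ⟨q, D, h, h'⟩ := A
    change q = A₀.faces at hA
    subst hA
    exact ⟨⟨⟨D, hbox⟩, h, h'⟩, rfl⟩

instance (γ : Cycle Pt) : Finite (DistortedDisk γ) :=
  inferInstanceAs (Finite (Quotient _))

theorem IsSOP.existsUnique_area {γ : Cycle Pt} (h : IsSOP γ) : ∃! p, HasArea γ p := by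
  obtain ⟨A⟩ := h.2
  exact ⟨A.faces, ⟨A, rfl⟩, fun q ⟨B, hB⟩ => hB ▸ B.faces_eq A⟩

/-! ### Upper and lower edges -/

namespace SquareSurface

variable {p : ℕ} {D : SquareSurface p}

theorem BoundaryList.exists_last {b : List (Side p)} (h : D.BoundaryList b) {s : Side p}
    (hs : D.glue s = s) : ∃ d, D.BoundaryList (d ++ [s]) ∧ d ++ [s] ~r b := by
  obtain ⟨l₁, l₂, rfl⟩ := List.append_of_mem ((h.mem_iff s).2 hs)
  have hr : (l₁ ++ s :: l₂).rotate (l₁ ++ [s]).length = l₂ ++ l₁ ++ [s] := by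
    rw [show l₁ ++ s :: l₂ = (l₁ ++ [s]) ++ l₂ by simp, List.rotate_append_length_eq]
    simp
  exact ⟨l₂ ++ l₁, hr ▸ h.rotate _, List.IsRotated.symm ⟨_, hr⟩⟩

theorem BoundaryList.start_last {d : List (Side p)} {u x : Side p}
    (h : D.BoundaryList (d ++ [u])) (hx : x ∈ (d ++ [u]).head?) :
    D.start u.next = D.start x :=
  ((chain_append_singleton_iff hx).1 h.chain).2.start_eq

/-- A horizontal side is a bottom or a top one. A bottom side at the maximal height of the boundary
would have its square above that height, against `tile_lt`. -/
theorem BoundaryList.upper_dir {d : List (Side p)} {u : Side p}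
    (h : D.BoundaryList (d ++ [u])) (h₁ : (D.start u.next).2 = (D.start u).2)
    (h₂ : ∀ s ∈ d ++ [u], (D.start s).2 ≤ (D.start u).2) : u.2 = 2 := by
  have := h.tile_lt h₂ u.1
  obtain ⟨f, k⟩ := u
  fin_cases k <;> simp [start, cornerOffset, Side.next] at h₁ this ⊢

theorem BoundaryList.lower_dir {d : List (Side p)} {u : Side p}
    (h : D.BoundaryList (d ++ [u])) (h₁ : (D.start u.next).2 = (D.start u).2)
    (h₂ : ∀ s ∈ d ++ [u], (D.start u).2 ≤ (D.start s).2) : u.2 = 0 := by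
  have := h.le_tile h₂ u.1
  obtain ⟨f, k⟩ := u
  fin_cases k <;> simp [start, cornerOffset, Side.next] at h₁ this ⊢

theorem start_snd_le {s : Side p} {m : ℤ} (h : ∀ g, (D.tile g).2 ≤ m) :
    (D.start s).2 ≤ m + 1 := by
  have := h s.1
  obtain ⟨f, k⟩ := s
  fin_cases k <;> simp [start, cornerOffset] at this ⊢ <;> omega

theorem le_start_snd {s : Side p} {m : ℤ} (h : ∀ g, m ≤ (D.tile g).2) :
    m ≤ (D.start s).2 := by
  have := h s.1
  obtain ⟨f, k⟩ := s
  fin_cases k <;> simp [start, cornerOffset] at this ⊢ <;> omega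

end SquareSurface

theorem head_map_eq {α β : Type*} {d : List α} {u : α} (f : α → β) (h) :
    ∃ x ∈ (d ++ [u]).head?, ((d ++ [u]).map f).head h = f x := by
  cases d <;> simp

theorem IsSOP.exists_edges {γ : Cycle Pt} (h : IsSOP γ) :
    Nonempty (UpperEdge γ) ∧ Nonempty (LowerEdge γ) := by
  obtain ⟨A⟩ := h.2
  induction γ using Quotient.inductionOn' with
  | h root =>
    obtain ⟨b, h₁, h₂⟩ := Filling.exists_boundaryList (root := root) A
    have key : ∀ s, A.disk.glue s = s → ∃ (root' : List Pt) (hne : root' ≠ []),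
        (root' : Cycle Pt) = (root : Cycle Pt) ∧ root'.getLast hne = A.disk.start s ∧
        root'.head hne = A.disk.start s.next ∧ ∀ P ∈ root', ∃ t, P = A.disk.start t := by
      intro s hs
      obtain ⟨d, h₃, h₄⟩ := h₁.exists_last hs
      refine ⟨(d ++ [s]).map A.disk.start, by simp, ?_, by simp, ?_, ?_⟩
      · exact (Cycle.coe_eq_coe.2 (h₄.map _)).trans (congrArg _ h₂)
      · obtain ⟨x, hx, e⟩ := head_map_eq (d := d) (u := s) A.disk.start (by simp)
        rw [e, h₃.start_last hx]
      · intro P hP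
        obtain ⟨t, -, rfl⟩ := List.mem_map.1 hP
        exact ⟨t, rfl⟩
    constructor
    · obtain ⟨g, hg, hmax⟩ := exists_top (D := A.disk) ⟨0, A.isDisk.pos⟩
      obtain ⟨root', hne, e₁, e₂, e₃, e₄⟩ := key _ hg
      refine ⟨⟨root', hne, e₁, ?_, ?_⟩⟩
      · rw [e₂, e₃]
        simp [start, cornerOffset, Side.next]
      · intro P hP
        obtain ⟨t, rfl⟩ := e₄ P hP
        rw [e₃]
        simpa [start, cornerOffset, Side.next] using start_snd_le (s := t) hmax
    · obtain ⟨g, hg, hmax⟩ := exists_bottom (D := A.disk) ⟨0, A.isDisk.pos⟩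
      obtain ⟨root', hne, e₁, e₂, e₃, e₄⟩ := key _ hg
      refine ⟨⟨root', hne, e₁, ?_, ?_⟩⟩
      · rw [e₂, e₃]
        simp [start, cornerOffset, Side.next]
      · intro P hP
        obtain ⟨t, rfl⟩ := e₄ P hP
        rw [e₃]
        simpa [start, cornerOffset, Side.next] using le_start_snd (s := t) hmax

/-! ### Uniqueness of the boundary list -/

theorem sum_range_mul_of_periodic {x : ℕ → ℤ} {n : ℕ} (h : ∀ i, x (n + i) = x i) (m : ℕ) :
    ∑ i ∈ Finset.range (n * m), x i = m * ∑ i ∈ Finset.range n, x i := by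
  induction m with
  | zero => simp
  | succ m ih =>
    rw [Nat.mul_succ, add_comm, Finset.sum_range_add, Finset.sum_congr rfl fun i _ => h i, ih]
    push_cast
    ring

theorem turn_modEq (j k : Fin 4) (h : k ≠ j + 2) :
    ((k : ℕ) : ℤ) ≡ (j : ℕ) + turn j k [ZMOD 4] := by
  revert h
  fin_cases j <;> fin_cases k <;> simp +decide

/-- A sequence of directions without U-turns whose rotation number over the period `n` is one has
no smaller period. -/
theorem dvd_of_periodic {δ : ℕ → Fin 4} {n k : ℕ} (hn : ∀ i, δ (n + i) = δ i)
    (hk : ∀ i, δ (k + i) = δ i) (hδ : ∀ i, δ (i + 1) ≠ δ i + 2)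
    (h4 : ∑ i ∈ Finset.range n, turn (δ i) (δ (i + 1)) = 4) : n ∣ k := by
  have hT : ∀ m, ((δ m : ℕ) : ℤ) ≡
      (δ 0 : ℕ) + ∑ i ∈ Finset.range m, turn (δ i) (δ (i + 1)) [ZMOD 4] := by
    intro m
    induction m with
    | zero => simp
    | succ m ih =>
      rw [Finset.sum_range_succ, ← add_assoc]
      exact (turn_modEq _ _ (hδ m)).trans (ih.add_right _)
  have h₁ := sum_range_mul_of_periodic (x := fun i => turn (δ i) (δ (i + 1))) (n := n)
    (fun i => by rw [hn, add_assoc, hn]) k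
  have h₂ := sum_range_mul_of_periodic (x := fun i => turn (δ i) (δ (i + 1))) (n := k)
    (fun i => by rw [hk, add_assoc, hk]) n
  -- The total turning over `n * k` steps is computed with either period.
  rw [mul_comm n k, h₂, h4] at h₁
  have h₃ := hT k
  rw [show δ k = δ 0 from hk 0] at h₃
  -- After `k` steps the direction is the initial one, so the turning over `k` steps is a multiple
  -- of four quarter turns.
  obtain ⟨j, hj⟩ : (4 : ℤ) ∣ ∑ i ∈ Finset.range k, turn (δ i) (δ (i + 1)) := by
    have := Int.modEq_iff_dvd.1 h₃
    simpa using this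
  rw [hj] at h₁
  have : (n : ℤ) * j = k := by linarith
  exact Int.natCast_dvd_natCast.1 ⟨j, this.symm⟩

namespace SquareSurface

variable {p : ℕ} {D : SquareSurface p}

/-- The free side that `Reach` leads to is unique, so two boundary lists with a common side go on in
step from there. -/
theorem BoundaryList.exists_rotate {b b' : List (Side p)} (h : D.BoundaryList b)
    (h' : D.BoundaryList b') (hne : b ≠ []) : ∃ k, b' = b.rotate k := by
  have hl : b'.length = b.length := by
    classical
    rw [← List.toFinset_card_of_nodup h.nodup, ← List.toFinset_card_of_nodup h'.nodup]
    congr 1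
    ext s
    simp [h.mem_iff, h'.mem_iff]
  have hpos : 0 < b.length := List.length_pos_iff.2 hne
  obtain ⟨k, hk, e⟩ := List.getElem_of_mem
    ((h.mem_iff _).2 ((h'.mem_iff (b'[0]'(by omega))).1 (List.getElem_mem _)))
  refine ⟨k, List.ext_getElem (by simpa using hl) fun i h₁ h₂ => ?_⟩
  rw [List.getElem_rotate]
  induction i with
  | zero => simp [Nat.mod_eq_of_lt hk, e]
  | succ i ih =>
    have c' := chain_iff_getElem.1 h'.chain i (by omega)
    have c := chain_iff_getElem.1 h.chain ((i + k) % b.length) (Nat.mod_lt _ hpos)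
    simp only [Nat.mod_eq_of_lt h₁] at c'
    simp only [Nat.mod_add_mod] at c
    rw [ih (by omega) (by simp; omega)] at c'
    have := c'.unique c
    rw [this]
    congr 2
    omega

/-- The boundary list of a disk is determined by its image: the boundary path, which has rotation
number one, is not periodic. -/
theorem IsDisk.boundaryList_unique (hD : D.IsDisk) {b b' : List (Side p)} (h : D.BoundaryList b)
    (h' : D.BoundaryList b') (e : b'.map D.start = b.map D.start) : b' = b := by
  obtain ⟨k, rfl⟩ := h.exists_rotate h' (hD.boundary_ne_nil h)
  have hpos : 0 < b.length := List.length_pos_iff.2 (hD.boundary_ne_nil h)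
  have hdir := h.directions_eq h' (v := 0) (by rw [e]; simp [Function.comp_def])
  set δ : ℕ → Fin 4 := fun i => (b.map Prod.snd).getD (i % b.length) default with hδ
  have hδ' : ∀ i, δ i = (b[i % b.length]'(Nat.mod_lt _ hpos)).2 := by
    intro i
    simp [hδ, List.getD_eq_getElem?_getD, Nat.mod_lt _ hpos]
  have hdvd : b.length ∣ k := by
    refine dvd_of_periodic (δ := δ) (fun i => ?_) (fun i => ?_) (fun i => ?_) ?_
    · simp [hδ]
    · rw [hδ', hδ']
      have := congrArg (fun l => l[i % b.length]?) hdir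
      have hi := Nat.mod_lt i hpos
      simp [hi, List.getElem_rotate] at this
      simp only [Nat.add_comm k i, ← this.2]
    · rw [hδ', hδ']
      have c := chain_iff_getElem.1 h.chain (i % b.length) (Nat.mod_lt _ hpos)
      have := (hD.flat.corners_boundary ((h.mem_iff _).1 (List.getElem_mem _)) c).2.1
      simpa using this
    · have := hD.turn_eq h
      rw [cycSum_eq_sum_range] at this
      rw [← this]
      simp [hδ]
  obtain ⟨m, rfl⟩ := hdvd
  rw [List.rotate_length_mul]

end SquareSurface

/-- The image of a side under a map of squares. -/
def Side.lift {a n : ℕ} (i : Fin a → Fin n) (s : Side a) : Side n := (i s.1, s.2)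

theorem Side.lift_next {a n : ℕ} (i : Fin a → Fin n) (s : Side a) :
    (Side.lift i s).next = Side.lift i s.next := rfl

/-- As `v` is only the last element, it never stands on the left of the relation. The correspondence
may fail there: in the application `v` is the marked side, whose image ends elsewhere. -/
theorem isChain_map_iff {α β : Type*} {r : α → α → Prop} {r' : β → β → Prop} {j : α → β}
    {d : List α} {v : α} (hv : v ∉ d) (h : ∀ s t, s ≠ v → (r s t ↔ r' (j s) (j t))) :
    (d ++ [v]).IsChain r ↔ ((d ++ [v]).map j).IsChain r' := by
  induction d with
  | nil => simp
  | cons a d ih =>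
    simp only [List.mem_cons, not_or] at hv
    have ih := ih hv.2
    cases d with
    | nil => simp [h a v (Ne.symm hv.1)]
    | cons b d =>
      simp only [List.cons_append, List.map_cons, List.isChain_cons_cons] at ih ⊢
      rw [ih, h a b (Ne.symm hv.1)]

namespace SquareSurface

/-! ### Surfaces with an arbitrary finite set of squares -/

/-- The surface obtained by numbering a finite set of squares. -/
def ofEquiv {X : Type*} {n : ℕ} (e : X ≃ Fin n) (tile : X → Pt) (glue : X × Fin 4 → X × Fin 4)
    (h₁ : ∀ s, glue (glue s) = s)
    (h₂ : ∀ s, glue s ≠ s → (glue s).2 = s.2 + 2 ∧ tile (glue s).1 = tile s.1 + normal s.2) :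
    SquareSurface n where
  tile g := tile (e.symm g)
  glue s := (e (glue (e.symm s.1, s.2)).1, (glue (e.symm s.1, s.2)).2)
  glue_glue s := by simp [h₁]
  isometric s hs := by
    have h := h₂ (e.symm s.1, s.2) fun h => hs (by simp [h])
    simp only [Equiv.symm_apply_apply, Side.next_snd, h.1, h.2]
    exact offset_of_glue _ _

theorem ofEquiv_glue {X : Type*} {n : ℕ} (e : X ≃ Fin n) (tile : X → Pt)
    (glue : X × Fin 4 → X × Fin 4) (h₁ h₂) (x : X) (k : Fin 4) :
    (ofEquiv e tile glue h₁ h₂).glue (e x, k) = (e (glue (x, k)).1, (glue (x, k)).2) := by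
  simp [ofEquiv]

theorem ofEquiv_tile {X : Type*} {n : ℕ} (e : X ≃ Fin n) (tile : X → Pt)
    (glue : X × Fin 4 → X × Fin 4) (h₁ h₂) (x : X) :
    (ofEquiv e tile glue h₁ h₂).tile (e x) = tile x := by
  simp [ofEquiv]

/-! ### A surface attached to a square -/

/-- `A`, translated by `v`, is embedded by `i` as a part of `C` that is attached to the rest of `C`
by its side `u` only, which is glued to the side `k` of the square `f`, the two adjacent sides of
`f` being free. -/
structure Half {a n : ℕ} (A : SquareSurface a) (C : SquareSurface n) (i : Fin a → Fin n)
    (f : Fin n) (u : Side a) (k : Fin 4) (v : Pt) : Prop where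
  inj : Function.Injective i
  ne_f : ∀ x, i x ≠ f
  tile : ∀ x, C.tile (i x) = A.tile x + v
  glue : ∀ s, s ≠ u → C.glue (Side.lift i s) = Side.lift i (A.glue s)
  free_u : A.glue u = u
  glue_u : C.glue (Side.lift i u) = (f, k)
  free_one : C.glue (f, k + 1) = (f, k + 1)
  free_three : C.glue (f, k + 3) = (f, k + 3)

/-- The correspondence between the free sides of `A` and those of `C`, with `u` replaced by a free
side of `f`. -/
def outer {a n : ℕ} (i : Fin a → Fin n) (f : Fin n) (u : Side a) (k : Fin 4) (s : Side a) :
    Side n :=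
  if s = u then (f, k + 1) else Side.lift i s

theorem outer_self {a n : ℕ} (i : Fin a → Fin n) (f : Fin n) (u : Side a) (k : Fin 4) :
    outer i f u k u = (f, k + 1) := if_pos rfl

theorem outer_of_ne {a n : ℕ} (i : Fin a → Fin n) (f : Fin n) {s u : Side a} (h : s ≠ u)
    (k : Fin 4) : outer i f u k s = Side.lift i s := if_neg h

namespace Half

variable {a n : ℕ} {A : SquareSurface a} {C : SquareSurface n} {i : Fin a → Fin n} {f : Fin n}
  {u : Side a} {k : Fin 4} {v : Pt}

theorem lift_injective (H : Half A C i f u k v) : Function.Injective (Side.lift i) := by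
  rintro ⟨x, j⟩ ⟨y, l⟩ h
  simp only [Side.lift, Prod.mk.injEq] at h
  rw [H.inj h.1, h.2]

theorem lift_ne (H : Half A C i f u k v) (s : Side a) (l : Fin 4) : Side.lift i s ≠ (f, l) :=
  fun h => H.ne_f _ (congrArg Prod.fst h)

theorem outer_injective (H : Half A C i f u k v) : Function.Injective (outer i f u k) := by
  intro s t h
  by_cases hs : s = u <;> by_cases ht : t = u
  · rw [hs, ht]
  · rw [hs, outer_self, outer_of_ne _ _ ht] at h
    exact absurd h.symm (H.lift_ne _ _)
  · rw [ht, outer_self, outer_of_ne _ _ hs] at h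
    exact absurd h (H.lift_ne _ _)
  · rw [outer_of_ne _ _ hs, outer_of_ne _ _ ht] at h
    exact H.lift_injective h

theorem glue_f (H : Half A C i f u k v) : C.glue (f, k) = Side.lift i u := by
  rw [← H.glue_u, C.glue_glue]

theorem glue_u_ne (H : Half A C i f u k v) : C.glue (Side.lift i u) ≠ Side.lift i u := by
  rw [H.glue_u]
  exact (H.lift_ne _ _).symm

theorem glue_f_ne (H : Half A C i f u k v) : C.glue (f, k) ≠ (f, k) := by
  rw [H.glue_f]
  exact H.lift_ne _ _

theorem u_snd (H : Half A C i f u k v) : u.2 = k + 2 := by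
  have h := (C.glue_geom H.glue_f_ne).1
  rw [H.glue_f] at h
  exact h

theorem tile_u (H : Half A C i f u k v) : A.tile u.1 + v = C.tile f + normal k := by
  have h := (C.glue_geom H.glue_f_ne).2
  rw [H.glue_f] at h
  rw [← h, ← H.tile]
  rfl

theorem start_lift (H : Half A C i f u k v) (s : Side a) :
    C.start (Side.lift i s) = A.start s + v := by
  rw [start, start, add_right_comm, ← H.tile]
  rfl

/-- The side `u` and the side `k` of `f` have opposite orientations, so `u` starts where the side
`k` ends, that is, where the side `k + 1` starts. -/
theorem start_outer (H : Half A C i f u k v) (s : Side a) :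
    C.start (outer i f u k s) = A.start s + v := by
  by_cases hs : s = u
  · subst hs
    rw [outer_self, start, start, add_right_comm, H.tile_u, H.u_snd]
    exact (offset_of_glue _ _).1.symm
  · rw [outer_of_ne _ _ hs, H.start_lift]

theorem free_lift (H : Half A C i f u k v) {s : Side a} (hs : s ≠ u) :
    C.glue (Side.lift i s) = Side.lift i s ↔ A.glue s = s := by
  rw [H.glue _ hs, H.lift_injective.eq_iff]

theorem free_outer (H : Half A C i f u k v) (s : Side a) :
    C.glue (outer i f u k s) = outer i f u k s ↔ A.glue s = s := by
  by_cases hs : s = u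
  · subst hs
    rw [outer_self]
    exact iff_of_true H.free_one H.free_u
  · rw [outer_of_ne _ _ hs, H.free_lift hs]

theorem rot_lift (H : Half A C i f u k v) {s : Side a} (hs : s ≠ u) :
    C.rot (Side.lift i s) = Side.lift i (A.rot s) := by
  rw [rot, H.glue _ hs]
  rfl

theorem rot_u (H : Half A C i f u k v) : C.rot (Side.lift i u) = (f, k + 1) := by
  rw [rot, H.glue_u]
  rfl

theorem rot_f (H : Half A C i f u k v) : C.rot (f, k) = Side.lift i u.next := by
  rw [rot, H.glue_f]
  rfl

theorem ne_u (H : Half A C i f u k v) {s : Side a} (hs : A.glue s ≠ s) : s ≠ u := by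
  rintro rfl
  exact hs H.free_u

/-- Rotation in `C` copies rotation in `A`. The only difference is at `u`, where `A` stops while `C`
makes one more step, to the free side `(f, k + 1)`. -/
theorem reach_lift (H : Half A C i f u k v) {c t : Side a} (h : A.Reach c t) :
    C.Reach (Side.lift i c) (outer i f u k t) := by
  induction h with
  | @refl t ht =>
    by_cases hs : t = u
    · subst hs
      refine .step H.glue_u_ne ?_
      rw [H.rot_u, outer_self]
      exact .refl H.free_one
    · rw [outer_of_ne _ _ hs]
      exact .refl ((H.free_lift hs).2 ht)
  | step hc _ ih =>
    have hu := H.ne_u hc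
    refine .step (fun h => hc ((H.free_lift hu).1 h)) ?_
    rwa [H.rot_lift hu]

theorem exists_of_reach (H : Half A C i f u k v) {c : Side a} {t' : Side n}
    (h : C.Reach (Side.lift i c) t') : ∃ t, t' = outer i f u k t ∧ A.Reach c t := by
  generalize hc' : Side.lift i c = c' at h
  induction h generalizing c with
  | @refl t' ht =>
    subst hc'
    have hu : c ≠ u := by rintro rfl; exact H.glue_u_ne ht
    exact ⟨c, (outer_of_ne _ _ hu _).symm, .refl ((H.free_lift hu).1 ht)⟩
  | step hc hr ih =>
    subst hc'
    by_cases hu : c = u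
    · subst hu
      rw [H.rot_u] at hr
      exact ⟨c, by rw [hr.eq_of_free H.free_one, outer_self], .refl H.free_u⟩
    · obtain ⟨t, h₁, h₂⟩ := ih (H.rot_lift hu).symm
      exact ⟨t, h₁, .step (fun h => hc ((H.free_lift hu).2 h)) h₂⟩

theorem reach_iff (H : Half A C i f u k v) {c t : Side a} :
    C.Reach (Side.lift i c) (outer i f u k t) ↔ A.Reach c t := by
  refine ⟨fun h => ?_, H.reach_lift⟩
  obtain ⟨t', h₁, h₂⟩ := H.exists_of_reach h
  rwa [H.outer_injective h₁]

/-- The corner `(f, k)` is the end of the free side `(f, k + 3)`. Rotating from it enters `A` at the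
end of `u`, so this free side precedes in `C` what `u` precedes in `A`. -/
theorem reach_f_iff (H : Half A C i f u k v) {t : Side n} :
    C.Reach (f, k) t ↔ C.Reach (Side.lift i u.next) t := by
  rw [← H.rot_f]
  exact ⟨fun h => h.of_not_free H.glue_f_ne, .step H.glue_f_ne⟩

theorem isChain_iff (H : Half A C i f u k v) {d : List (Side a)} (hd : u ∉ d) :
    (d ++ [u]).IsChain (fun s t => A.Reach s.next t) ↔
      ((d ++ [u]).map (outer i f u k)).IsChain (fun s t => C.Reach s.next t) := by
  refine isChain_map_iff hd fun s t hs => ?_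
  rw [outer_of_ne _ _ hs, Side.lift_next, H.reach_iff]

theorem flat (H : Half A C i f u k v) (hC : C.Flat) : A.Flat := by
  intro c
  by_cases hc : A.glue c = c
  · exact .inl hc
  have u₀ := H.ne_u hc
  have r₁ := H.rot_lift u₀
  by_cases hc₁ : A.glue (A.rot c) = A.rot c
  · exact .inr (.inl hc₁)
  have u₁ := H.ne_u hc₁
  have r₂ := H.rot_lift u₁
  by_cases hc₂ : A.glue (A.rot (A.rot c)) = A.rot (A.rot c)
  · exact .inr (.inr (.inl hc₂))
  have u₂ := H.ne_u hc₂
  have r₃ := H.rot_lift u₂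
  have h := hC (Side.lift i c)
  rw [FlatAt, r₁, r₂, r₃, H.free_lift u₀, H.free_lift u₁, H.free_lift u₂] at h
  obtain ⟨h₁, h₂⟩ := ((h.resolve_left hc).resolve_left hc₁).resolve_left hc₂
  -- If the last corner were `u`, the next rotation in `C` would enter `f` instead of closing up.
  have u₃ : A.rot (A.rot (A.rot c)) ≠ u := by
    intro e
    rw [e, H.rot_u] at h₂
    exact H.lift_ne _ _ h₂.symm
  rw [H.rot_lift u₃] at h₂
  exact .inr (.inr (.inr ⟨fun h => h₁ ((H.free_lift u₃).2 h), H.lift_injective h₂⟩))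

/-- In `C` the fan that ends at `u` gains a corner of `f`. It must therefore have at most two
corners in `A`; a third one would have the direction opposite to `u`, and `h₁` excludes it. -/
theorem flatAt_lift (H : Half A C i f u k v) (hA : A.Flat)
    (h₁ : ∀ c : Side a, c.2 = u.2 + 2 → A.start c ≠ A.start u) (c : Side a) :
    C.FlatAt (Side.lift i c) := by
  by_cases u₀ : c = u
  · subst u₀
    refine .inr (.inl ?_)
    rw [H.rot_u, H.free_one]
  by_cases hc : A.glue c = c
  · exact .inl ((H.free_lift u₀).2 hc)
  have r₁ := H.rot_lift u₀
  by_cases u₁ : A.rot c = u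
  · refine .inr (.inr (.inl ?_))
    rw [r₁, u₁, H.rot_u, H.free_one]
  by_cases hc₁ : A.glue (A.rot c) = A.rot c
  · refine .inr (.inl ?_)
    rw [r₁, H.free_lift u₁, hc₁]
  have r₂ := H.rot_lift u₁
  by_cases u₂ : A.rot (A.rot c) = u
  · refine absurd ?_ (h₁ c ?_)
    · rw [← u₂, A.start_rot hc₁, A.start_rot hc]
    · rw [← u₂, A.rot_snd hc₁, A.rot_snd hc]
      simp only [add_assoc]
      exact (add_zero _).symm
  by_cases hc₂ : A.glue (A.rot (A.rot c)) = A.rot (A.rot c)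
  · refine .inr (.inr (.inl ?_))
    rw [r₁, r₂, H.free_lift u₂, hc₂]
  have r₃ := H.rot_lift u₂
  obtain ⟨hc₃, hc₄⟩ := (((hA c).resolve_left hc).resolve_left hc₁).resolve_left hc₂
  have u₃ := H.ne_u hc₃
  refine .inr (.inr (.inr ?_))
  rw [r₁, r₂, r₃, H.rot_lift u₃, hc₄]
  exact ⟨fun h => hc₃ ((H.free_lift u₃).1 h), rfl⟩

/-- Likewise, the fan that begins at `u.next` is now preceded by the corner `(f, k)`, and `h₂`
excludes a third corner of `A` in it. -/
theorem flatAt_f (H : Half A C i f u k v)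
    (h₂ : ∀ c : Side a, c.2 = u.2 + 3 → A.start c ≠ A.start u.next) : C.FlatAt (f, k) := by
  have hne : A.start u.next ≠ A.start u := by
    intro h
    simp only [start, Side.next, add_right_inj] at h
    revert h
    obtain ⟨x, l⟩ := u
    fin_cases l <;> simp [cornerOffset]
  have u₀ : u.next ≠ u := fun h => hne (by rw [h])
  by_cases hc : A.glue u.next = u.next
  · refine .inr (.inl ?_)
    rw [H.rot_f, H.free_lift u₀, hc]
  have u₁ : A.rot u.next ≠ u := fun h => hne (by rw [← A.start_rot hc, h])
  by_cases hc₁ : A.glue (A.rot u.next) = A.rot u.next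
  · refine .inr (.inr (.inl ?_))
    rw [H.rot_f, H.rot_lift u₀, H.free_lift u₁, hc₁]
  refine absurd ?_ (h₂ (A.rot (A.rot u.next)) ?_)
  · rw [A.start_rot hc₁, A.start_rot hc]
  · rw [A.rot_snd hc₁, A.rot_snd hc, Side.next_snd]
    simp only [add_assoc]
    rfl

/-- Sending every square outside `A` to the square of `u` is a retraction: the gluing of `u` is the
only passage out of `A`. Paths in `C` thus project to paths in `A`. -/
theorem connected (H : Half A C i f u k v) (hC : C.Connected) : A.Connected := by
  classical
  let π : Fin n → Fin a := fun g => if h : ∃ x, i x = g then h.choose else u.1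
  have hπ : ∀ x, π (i x) = x := by
    intro x
    have h : ∃ y, i y = i x := ⟨x, rfl⟩
    simp only [π, dif_pos h]
    exact H.inj h.choose_spec
  have hπ' : ∀ g, (¬ ∃ x, i x = g) → π g = u.1 := fun g h => dif_neg h
  intro x y
  have key : ReflTransGen (fun a b => ∃ k : Fin 4, (A.glue (a, k)).1 = b) (π (i x)) (π (i y)) := by
    refine (hC (i x) (i y)).lift' π ?_
    rintro g g' ⟨l, hl⟩
    change ReflTransGen _ (π g) (π g')
    by_cases hg : ∃ x, i x = g
    · obtain ⟨x, rfl⟩ := hg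
      rw [hπ]
      by_cases hu : (x, l) = u
      · have h := H.glue_u
        rw [← hu] at h
        change C.glue (i x, l) = _ at h
        rw [h] at hl
        rw [← hl, hπ' _ (by rintro ⟨y, hy⟩; exact H.ne_f y hy), ← hu]
      · have h := H.glue _ hu
        change C.glue (i x, l) = _ at h
        rw [h] at hl
        rw [← hl]
        refine .single ⟨l, ?_⟩
        exact (hπ _).symm
    · rw [hπ' _ hg]
      by_cases hg' : ∃ x, i x = g'
      · obtain ⟨x, rfl⟩ := hg'
        obtain ⟨m, hm⟩ : ∃ m, C.glue (g, l) = Side.lift i (x, m) :=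
          ⟨(C.glue (g, l)).2, Prod.ext hl rfl⟩
        have hm' : C.glue (Side.lift i (x, m)) = (g, l) := by rw [← hm, C.glue_glue]
        by_cases hu : (x, m) = u
        · rw [hπ, ← hu]
        · rw [H.glue _ hu] at hm'
          exact absurd ⟨_, congrArg Prod.fst hm'⟩ hg
      · rw [hπ' _ hg']
  rwa [hπ, hπ] at key

theorem connected_to (H : Half A C i f u k v) (hA : A.Connected) (x : Fin a) :
    ReflTransGen (fun a b => ∃ k : Fin 4, (C.glue (a, k)).1 = b) (i x) f ∧
      ReflTransGen (fun a b => ∃ k : Fin 4, (C.glue (a, k)).1 = b) f (i x) := by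
  have key : ∀ y z, ReflTransGen (fun a b => ∃ k : Fin 4, (C.glue (a, k)).1 = b) (i y) (i z) := by
    intro y z
    refine (hA y z).lift' i ?_
    rintro g g' ⟨l, hl⟩
    change ReflTransGen _ (i g) (i g')
    by_cases hu : (g, l) = u
    · rw [hu, H.free_u, ← hu] at hl
      rw [show g = g' from hl]
    · refine .single ⟨l, ?_⟩
      have h := H.glue _ hu
      change C.glue (i g, l) = _ at h
      rw [h, ← hl]
      rfl
  exact ⟨(key x u.1).tail ⟨u.2, congrArg Prod.fst H.glue_u⟩,
    (key u.1 x).head ⟨k, congrArg Prod.fst H.glue_f⟩⟩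

end Half

end SquareSurface

namespace SquareSurface

/-! ### Two surfaces joined by a square -/

/-- `C` consists of copies of `A` and `B`, attached below and above the square `f`. -/
structure Join {a b n : ℕ} (A : SquareSurface a) (B : SquareSurface b) (C : SquareSurface n)
    (i : Fin a → Fin n) (j : Fin b → Fin n) (f : Fin n) (u : Side a) (w : Side b) (v : Pt) :
    Prop where
  lower : Half A C i f u 0 0
  upper : Half B C j f w 2 v
  disjoint : ∀ x y, i x ≠ j y
  cover : ∀ g, (∃ x, g = i x) ∨ (∃ y, g = j y) ∨ g = f

namespace Join

variable {a b n : ℕ} {A : SquareSurface a} {B : SquareSurface b} {C : SquareSurface n}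
  {i : Fin a → Fin n} {j : Fin b → Fin n} {f : Fin n} {u : Side a} {w : Side b} {v : Pt}

theorem outer_ne (J : Join A B C i j f u w v) (s : Side a) (t : Side b) :
    outer i f u 0 s ≠ outer j f w 2 t := by
  by_cases hs : s = u <;> by_cases ht : t = w
  · rw [hs, ht, outer_self, outer_self]
    simp
  · rw [hs, outer_self, outer_of_ne _ _ ht]
    exact (J.upper.lift_ne _ _).symm
  · rw [ht, outer_self, outer_of_ne _ _ hs]
    exact J.lower.lift_ne _ _
  · rw [outer_of_ne _ _ hs, outer_of_ne _ _ ht]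
    exact fun h => J.disjoint _ _ (congrArg Prod.fst h)

theorem free_iff (J : Join A B C i j f u w v) (s : Side n) :
    C.glue s = s ↔ (∃ t, A.glue t = t ∧ outer i f u 0 t = s) ∨
      ∃ t, B.glue t = t ∧ outer j f w 2 t = s := by
  constructor
  · intro hs
    obtain ⟨g, l⟩ := s
    rcases J.cover g with ⟨x, rfl⟩ | ⟨y, rfl⟩ | rfl
    · have hu : (x, l) ≠ u := by rintro rfl; exact J.lower.glue_u_ne hs
      have e : outer i f u 0 (x, l) = (i x, l) := outer_of_ne _ _ hu _
      exact .inl ⟨(x, l), (J.lower.free_outer _).1 (by rwa [e]), e⟩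
    · have hu : (y, l) ≠ w := by rintro rfl; exact J.upper.glue_u_ne hs
      have e : outer j f w 2 (y, l) = (j y, l) := outer_of_ne _ _ hu _
      exact .inr ⟨(y, l), (J.upper.free_outer _).1 (by rwa [e]), e⟩
    · have h₀ := J.lower.glue_f_ne
      have h₂ := J.upper.glue_f_ne
      fin_cases l
      · exact absurd hs h₀
      · exact .inl ⟨u, J.lower.free_u, outer_self _ _ _ _⟩
      · exact absurd hs h₂
      · exact .inr ⟨w, J.upper.free_u, outer_self _ _ _ _⟩
  · rintro (⟨t, ht, rfl⟩ | ⟨t, ht, rfl⟩)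
    · exact (J.lower.free_outer t).2 ht
    · exact (J.upper.free_outer t).2 ht

/-- Both directions are needed: joining builds the boundary of `C` from those of `A` and `B`, and
cutting recovers them. -/
theorem boundaryList_iff (J : Join A B C i j f u w v) (d : List (Side a)) (e : List (Side b)) :
    C.BoundaryList ((d ++ [u]).map (outer i f u 0) ++ (e ++ [w]).map (outer j f w 2)) ↔
      A.BoundaryList (d ++ [u]) ∧ B.BoundaryList (e ++ [w]) := by
  have hnodup : ((d ++ [u]).map (outer i f u 0) ++ (e ++ [w]).map (outer j f w 2)).Nodup ↔
      (d ++ [u]).Nodup ∧ (e ++ [w]).Nodup := by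
    rw [List.nodup_append, List.nodup_map_iff J.lower.outer_injective,
      List.nodup_map_iff J.upper.outer_injective]
    refine and_congr_right fun _ => and_iff_left ?_
    intro s hs t ht
    obtain ⟨s, -, rfl⟩ := List.mem_map.1 hs
    obtain ⟨t, -, rfl⟩ := List.mem_map.1 ht
    exact J.outer_ne s t
  have hmem : (∀ s, s ∈ (d ++ [u]).map (outer i f u 0) ++ (e ++ [w]).map (outer j f w 2) ↔
      C.glue s = s) ↔
      (∀ s, s ∈ d ++ [u] ↔ A.glue s = s) ∧ (∀ s, s ∈ e ++ [w] ↔ B.glue s = s) := by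
    constructor
    · intro h
      constructor
      · intro s
        rw [← J.lower.free_outer, ← h]
        refine Iff.trans ?_ List.mem_append.symm
        rw [List.mem_map_of_injective J.lower.outer_injective, or_iff_left]
        intro hs
        obtain ⟨t, -, ht⟩ := List.mem_map.1 hs
        exact J.outer_ne _ _ ht.symm
      · intro s
        rw [← J.upper.free_outer, ← h]
        refine Iff.trans ?_ List.mem_append.symm
        rw [List.mem_map_of_injective J.upper.outer_injective, or_iff_right]
        intro hs
        obtain ⟨t, -, ht⟩ := List.mem_map.1 hs
        exact J.outer_ne _ _ ht
    · rintro ⟨h₁, h₂⟩ s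
      rw [J.free_iff, List.mem_append, List.mem_map, List.mem_map]
      simp only [h₁, h₂]
  have hchain : (d ++ [u]).Nodup → (e ++ [w]).Nodup →
      ((((d ++ [u]).map (outer i f u 0) ++ (e ++ [w]).map (outer j f w 2) : List (Side n)) :
        Cycle (Side n)).Chain (fun s t => C.Reach s.next t) ↔
      ((d ++ [u] : List (Side a)) : Cycle (Side a)).Chain (fun s t => A.Reach s.next t) ∧
      ((e ++ [w] : List (Side b)) : Cycle (Side b)).Chain (fun s t => B.Reach s.next t)) := by
    intro hd he
    have hd : u ∉ d := by
      intro h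
      exact (List.disjoint_of_nodup_append hd) h (by simp)
    have he : w ∉ e := by
      intro h
      exact (List.disjoint_of_nodup_append he) h (by simp)
    obtain ⟨x, hx⟩ : ∃ x, x ∈ (d ++ [u]).head? := by cases d <;> simp
    obtain ⟨y, hy⟩ : ∃ y, y ∈ (e ++ [w]).head? := by cases e <;> simp
    -- The side after `(f, 1)` is `(f, 2)`, the one glued to `w`; similarly the side after `(f, 3)`
    -- is `(f, 0)`, glued to `u`.
    have e₁ : C.Reach (Side.next (f, 1)) (outer j f w 2 y) ↔ B.Reach w.next y :=
      J.upper.reach_f_iff.trans J.upper.reach_iff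
    have e₂ : C.Reach (Side.next (f, 3)) (outer i f u 0 x) ↔ A.Reach u.next x :=
      J.lower.reach_f_iff.trans J.lower.reach_iff
    rw [chain_append_singleton_iff hx, chain_append_singleton_iff hy, J.lower.isChain_iff hd,
      J.upper.isChain_iff he]
    have hL : (d ++ [u]).map (outer i f u 0) ++ (e ++ [w]).map (outer j f w 2) =
        ((d ++ [u]).map (outer i f u 0) ++ e.map (outer j f w 2)) ++ [(f, 3)] := by
      simp [outer_self]
    have hx' : outer i f u 0 x ∈
        (((d ++ [u]).map (outer i f u 0) ++ e.map (outer j f w 2)) ++ [(f, 3)]).head? := by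
      cases d <;> simp at hx ⊢ <;> exact congrArg _ hx
    rw [hL, chain_append_singleton_iff hx', ← hL, List.isChain_append]
    have hlast : ((d ++ [u]).map (outer i f u 0)).getLast? = some (f, 1) := by
      simp [outer_self]
    have hhead : ((e ++ [w]).map (outer j f w 2)).head? = some (outer j f w 2 y) := by
      rw [List.head?_map, Option.mem_def.1 hy]
      rfl
    rw [hlast, hhead, e₂]
    simp only [Option.mem_def, Option.some.injEq, forall_eq', e₁]
    tauto
  constructor
  · rintro ⟨h₁, h₂, h₃⟩
    rw [hnodup] at h₁
    rw [hmem] at h₂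
    rw [hchain h₁.1 h₁.2] at h₃
    exact ⟨⟨h₁.1, h₂.1, h₃.1⟩, ⟨h₁.2, h₂.2, h₃.2⟩⟩
  · rintro ⟨⟨h₁, h₂, h₃⟩, ⟨k₁, k₂, k₃⟩⟩
    exact ⟨hnodup.2 ⟨h₁, k₁⟩, hmem.2 ⟨h₂, k₂⟩, (hchain h₁ k₁).2 ⟨h₃, k₃⟩⟩

theorem map_start (J : Join A B C i j f u w v) (d : List (Side a)) (e : List (Side b)) :
    (d.map (outer i f u 0) ++ e.map (outer j f w 2)).map C.start =
      d.map A.start ++ (e.map B.start).map (· + v) := by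
  rw [List.map_append, List.map_map, List.map_map, List.map_map]
  congr 1
  · refine List.map_congr_left fun s _ => ?_
    simp [J.lower.start_outer]
  · exact List.map_congr_left fun s _ => J.upper.start_outer s

theorem flat (J : Join A B C i j f u w v) (hA : A.Flat) (hB : B.Flat)
    (a₁ : ∀ c : Side a, c.2 = u.2 + 2 → A.start c ≠ A.start u)
    (a₂ : ∀ c : Side a, c.2 = u.2 + 3 → A.start c ≠ A.start u.next)
    (b₁ : ∀ c : Side b, c.2 = w.2 + 2 → B.start c ≠ B.start w)
    (b₂ : ∀ c : Side b, c.2 = w.2 + 3 → B.start c ≠ B.start w.next) : C.Flat := by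
  rintro ⟨g, l⟩
  rcases J.cover g with ⟨x, rfl⟩ | ⟨y, rfl⟩ | rfl
  · exact J.lower.flatAt_lift hA a₁ (x, l)
  · exact J.upper.flatAt_lift hB b₁ (y, l)
  · have h₀ := J.lower.flatAt_f a₂
    have h₂ := J.upper.flatAt_f b₂
    fin_cases l
    · exact h₀
    · exact .inl J.lower.free_one
    · exact h₂
    · exact .inl J.lower.free_three

theorem connected (J : Join A B C i j f u w v) (hA : A.Connected) (hB : B.Connected) :
    C.Connected := by
  have key : ∀ g, ReflTransGen (fun a b => ∃ k : Fin 4, (C.glue (a, k)).1 = b) g f ∧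
      ReflTransGen (fun a b => ∃ k : Fin 4, (C.glue (a, k)).1 = b) f g := by
    intro g
    rcases J.cover g with ⟨x, rfl⟩ | ⟨y, rfl⟩ | rfl
    · exact J.lower.connected_to hA x
    · exact J.upper.connected_to hB y
    · exact ⟨.refl, .refl⟩
  exact fun g g' => (key g).1.trans (key g').2

end Join

/-! ### Joining and cutting -/

/-- Two surfaces can be joined by a square, if there is room for it. -/
theorem exists_join {a b : ℕ} (A : SquareSurface a) (B : SquareSurface b) {u : Side a}
    {w : Side b} {v T : Pt} (hu : A.glue u = u) (hw : B.glue w = w) (hu₂ : u.2 = 2)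
    (hw₂ : w.2 = 0) (hTu : A.tile u.1 = T + normal 0) (hTw : B.tile w.1 + v = T + normal 2) :
    ∃ (C : SquareSurface (a + b + 1)) (i : Fin a → Fin (a + b + 1))
      (j : Fin b → Fin (a + b + 1)) (f : Fin (a + b + 1)), Join A B C i j f u w v := by
  classical
  let X := (Fin a ⊕ Fin b) ⊕ Fin 1
  let e : X ≃ Fin (a + b + 1) := (Equiv.sumCongr finSumFinEquiv (Equiv.refl _)).trans finSumFinEquiv
  let tile : X → Pt := Sum.elim (Sum.elim A.tile fun y => B.tile y + v) fun _ => T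
  let glue : X × Fin 4 → X × Fin 4 := fun s => match s with
    | (.inl (.inl x), k) => if (x, k) = u then (.inr 0, 0) else
        (.inl (.inl (A.glue (x, k)).1), (A.glue (x, k)).2)
    | (.inl (.inr y), k) => if (y, k) = w then (.inr 0, 2) else
        (.inl (.inr (B.glue (y, k)).1), (B.glue (y, k)).2)
    | (.inr z, k) => if k = 0 then (.inl (.inl u.1), u.2) else
        if k = 2 then (.inl (.inr w.1), w.2) else (.inr z, k)
  have g₁ : ∀ s, s ≠ u → glue (.inl (.inl s.1), s.2) =
      (.inl (.inl (A.glue s).1), (A.glue s).2) := fun s hs => if_neg hs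
  have g₂ : ∀ s, s ≠ w → glue (.inl (.inr s.1), s.2) =
      (.inl (.inr (B.glue s).1), (B.glue s).2) := fun s hs => if_neg hs
  have g₃ : glue (.inl (.inl u.1), u.2) = (.inr 0, 0) := if_pos rfl
  have g₄ : glue (.inl (.inr w.1), w.2) = (.inr 0, 2) := if_pos rfl
  have g₅ : ∀ z, glue (.inr z, 0) = (.inl (.inl u.1), u.2) := fun z => rfl
  have g₆ : ∀ z, glue (.inr z, 2) = (.inl (.inr w.1), w.2) := fun z => rfl
  have g₇ : ∀ z, glue (.inr z, 1) = (.inr z, 1) := fun z => rfl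
  have g₈ : ∀ z, glue (.inr z, 3) = (.inr z, 3) := fun z => rfl
  have h₁ : ∀ s, glue (glue s) = s := by
    rintro ⟨(x | y) | z, k⟩
    · by_cases hs : (x, k) = u
      · subst hs
        exact (congrArg glue g₃).trans (g₅ 0)
      · have g := g₁ _ hs
        dsimp only at g
        rw [g, g₁ _ (fun h => hs (by rw [← A.glue_glue (x, k), h, hu])), A.glue_glue]
    · by_cases hs : (y, k) = w
      · subst hs
        exact (congrArg glue g₄).trans (g₆ 0)
      · have g := g₂ _ hs
        dsimp only at g
        rw [g, g₂ _ (fun h => hs (by rw [← B.glue_glue (y, k), h, hw])), B.glue_glue]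
    · obtain rfl := Subsingleton.elim z 0
      fin_cases k
      · exact (congrArg glue (g₅ 0)).trans g₃
      · rfl
      · exact (congrArg glue (g₆ 0)).trans g₄
      · rfl
  have h₂ : ∀ s, glue s ≠ s →
      (glue s).2 = s.2 + 2 ∧ tile (glue s).1 = tile s.1 + normal s.2 := by
    rintro ⟨(x | y) | z, k⟩ hne
    · by_cases hs : (x, k) = u
      · subst hs
        dsimp only at hu₂ hTu
        subst hu₂
        rw [g₃]
        refine ⟨rfl, ?_⟩
        change T = A.tile x + normal 2
        rw [hTu]
        ext <;> simp [normal]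
      · have g := g₁ _ hs
        dsimp only at g
        rw [g] at hne ⊢
        have h := A.glue_geom (s := (x, k)) fun h => hne (by rw [h])
        exact h
    · by_cases hs : (y, k) = w
      · subst hs
        dsimp only at hw₂ hTw
        subst hw₂
        rw [g₄]
        refine ⟨rfl, ?_⟩
        change T = B.tile y + v + normal 0
        rw [hTw]
        ext <;> simp [normal]
      · have g := g₂ _ hs
        dsimp only at g
        rw [g] at hne ⊢
        have h := B.glue_geom (s := (y, k)) fun h => hne (by rw [h])
        refine ⟨h.1, ?_⟩
        change B.tile (B.glue (y, k)).1 + v = B.tile y + v + normal k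
        rw [h.2, add_right_comm]
    · obtain rfl := Subsingleton.elim z 0
      fin_cases k
      · exact ⟨hu₂, hTu⟩
      · exact absurd rfl hne
      · exact ⟨hw₂, hTw⟩
      · exact absurd rfl hne
  have G := ofEquiv_glue e tile glue h₁ h₂
  have G' := ofEquiv_tile e tile glue h₁ h₂
  refine ⟨ofEquiv e tile glue h₁ h₂, fun x => e (.inl (.inl x)), fun y => e (.inl (.inr y)),
    e (.inr 0), ⟨?_, ?_, ?_, ?_, hu, ?_, G _ _, G _ _⟩, ⟨?_, ?_, ?_, ?_, hw, ?_, G _ _, G _ _⟩,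
      ?_, ?_⟩
  · exact fun x y h => Sum.inl_injective (Sum.inl_injective (e.injective h))
  · intro x h
    simpa using e.injective h
  · intro x
    rw [G', add_zero]
    rfl
  · intro s hs
    change _ = (e _, _)
    rw [Side.lift, G, g₁ s hs]
  · rw [Side.lift, G, g₃]
  · exact fun x y h => Sum.inr_injective (Sum.inl_injective (e.injective h))
  · intro x h
    simpa using e.injective h
  · intro x
    rw [G']
    rfl
  · intro s hs
    change _ = (e _, _)
    rw [Side.lift, G, g₂ s hs]
  · rw [Side.lift, G, g₄]
  · exact fun x y h => Sum.inl_ne_inr (Sum.inl_injective (e.injective h))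
  · intro g
    obtain ⟨(x | y) | z, rfl⟩ := e.surjective g
    · exact .inl ⟨x, rfl⟩
    · exact .inr (.inl ⟨y, rfl⟩)
    · obtain rfl := Subsingleton.elim z 0
      exact .inr (.inr rfl)

/-- A part of a surface that is attached to the rest by one side can be cut off. -/
theorem exists_half {n : ℕ} (C : SquareSurface n) (S : Fin n → Prop) {f : Fin n} {k : Fin 4}
    (v : Pt) (hf : ¬ S f) (hk : S (C.glue (f, k)).1)
    (hS : ∀ s, S s.1 → S (C.glue s).1 ∨ C.glue s = (f, k))
    (h₁ : C.glue (f, k + 1) = (f, k + 1)) (h₃ : C.glue (f, k + 3) = (f, k + 3)) :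
    ∃ (a : ℕ) (A : SquareSurface a) (i : Fin a → Fin n) (u : Side a),
      Half A C i f u k v ∧ ∀ g, S g ↔ ∃ x, g = i x := by
  classical
  let X := {g // S g}
  let e : X ≃ Fin (Fintype.card X) := Fintype.equivFin X
  let tile : X → Pt := fun g => C.tile g - v
  -- A side whose partner lies outside the region becomes free. By `hS` this creates only one new
  -- free side, the partner of `(f, k)`.
  let glue : X × Fin 4 → X × Fin 4 := fun s =>
    if h : S (C.glue (s.1.1, s.2)).1 then (⟨_, h⟩, (C.glue (s.1.1, s.2)).2) else s
  have g₁ : ∀ s, (h : S (C.glue (s.1.1, s.2)).1) → glue s = (⟨_, h⟩, (C.glue (s.1.1, s.2)).2) :=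
    fun s h => dif_pos h
  have g₂ : ∀ s, (h : ¬ S (C.glue (s.1.1, s.2)).1) → glue s = s := fun s h => dif_neg h
  have e₁ : ∀ s, glue (glue s) = s := by
    intro s
    by_cases h : S (C.glue (s.1.1, s.2)).1
    · rw [g₁ s h]
      have h' : C.glue ((C.glue (s.1.1, s.2)).1, (C.glue (s.1.1, s.2)).2) = (s.1.1, s.2) :=
        C.glue_glue _
      rw [g₁ _ (by dsimp only; rw [h']; exact s.1.2)]
      exact Prod.ext (Subtype.ext (congrArg (fun t : Side n => t.1) h'))
        (congrArg (fun t : Side n => t.2) h')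
    · rw [g₂ s h, g₂ s h]
  have e₂ : ∀ s, glue s ≠ s →
      (glue s).2 = s.2 + 2 ∧ tile (glue s).1 = tile s.1 + normal s.2 := by
    intro s hs
    by_cases h : S (C.glue (s.1.1, s.2)).1
    · rw [g₁ s h] at hs ⊢
      have := C.glue_geom (s := (s.1.1, s.2)) fun h' => hs
        (Prod.ext (Subtype.ext (congrArg (fun t : Side n => t.1) h'))
          (congrArg (fun t : Side n => t.2) h'))
      refine ⟨this.1, ?_⟩
      change C.tile _ - v = C.tile _ - v + normal _
      rw [this.2, add_sub_right_comm]
    · exact absurd (g₂ s h) hs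
  have G := ofEquiv_glue e tile glue e₁ e₂
  have G' := ofEquiv_tile e tile glue e₁ e₂
  let u₀ : X × Fin 4 := (⟨_, hk⟩, (C.glue (f, k)).2)
  have hu₀ : C.glue (u₀.1.1, u₀.2) = (f, k) := C.glue_glue _
  have hu₁ : glue u₀ = u₀ := g₂ _ (by rw [hu₀]; exact hf)
  refine ⟨_, ofEquiv e tile glue e₁ e₂, fun x => (e.symm x).1, (e u₀.1, u₀.2),
    ⟨?_, ?_, ?_, ?_, ?_, ?_, h₁, h₃⟩, ?_⟩
  · exact fun x y h => e.symm.injective (Subtype.ext h)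
  · rintro x rfl
    exact hf (e.symm x).2
  · intro x
    obtain ⟨g, rfl⟩ := e.surjective x
    rw [G', e.symm_apply_apply]
    exact (sub_add_cancel _ _).symm
  · rintro ⟨x, l⟩ hs
    obtain ⟨g, rfl⟩ := e.surjective x
    rw [G]
    simp only [Side.lift, Equiv.symm_apply_apply]
    rcases hS (g, l) g.2 with h | h
    · rw [g₁ (g, l) h]
    · refine absurd ?_ hs
      have h' := congrArg C.glue h
      rw [C.glue_glue] at h'
      have e₁ : g = u₀.1 := Subtype.ext (congrArg Prod.fst h')
      have e₂ : l = u₀.2 := congrArg Prod.snd h'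
      rw [e₁, e₂]
  · rw [G, hu₁]
  · simp only [Side.lift, Equiv.symm_apply_apply]
    exact hu₀
  · intro g
    exact ⟨fun h => ⟨e ⟨g, h⟩, by simp⟩, by rintro ⟨x, rfl⟩; exact (e.symm x).2⟩

end SquareSurface

/-! ### Rotation number of a joined boundary -/

theorem pairSum_append_of {α : Type*} (f : α → α → ℤ) {l m : List α} {x y : α}
    (hy : l.getLast? = some y) (hx : m.head? = some x) :
    pairSum f (l ++ m) = pairSum f l + f y x + pairSum f m := by
  obtain ⟨l', rfl⟩ := List.getLast?_eq_some_iff.1 hy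
  obtain ⟨m', rfl⟩ := List.head?_eq_some_iff.1 hx
  rw [List.append_assoc, List.singleton_append, pairSum_append]
  simp [pairSum, add_assoc]

theorem cycSum_eq_of {α : Type*} (f : α → α → ℤ) {l : List α} {x y : α}
    (hx : l.head? = some x) (hy : l.getLast? = some y) :
    cycSum f l = pairSum f l + f y x := by
  obtain ⟨m', rfl⟩ := List.head?_eq_some_iff.1 hx
  rw [cycSum, ← List.cons_append, pairSum_append_of f hy (x := x) rfl]
  simp [pairSum]

/-- The rotation number of two boundaries joined by a square. -/
theorem cycSum_turn_join {l m : List (Fin 4)} {x y x' y' : Fin 4} (hx : l.head? = some x)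
    (hy : l.getLast? = some y) (hx' : m.head? = some x') (hy' : m.getLast? = some y')
    (x₀ : x ≠ 0) (x₁ : x ≠ 1) (y₀ : y ≠ 0) (y₃ : y ≠ 3) (x₂' : x' ≠ 2) (x₃' : x' ≠ 3)
    (y₁' : y' ≠ 1) (y₂' : y' ≠ 2) :
    cycSum turn ((l ++ [1]) ++ (m ++ [3])) =
      cycSum turn (l ++ [2]) + cycSum turn (m ++ [0]) - 4 := by
  have h : ∀ a, (l ++ [a]).head? = some x := fun a => by simp [hx]
  have h' : ∀ a, (m ++ [a]).head? = some x' := fun a => by simp [hx']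
  have k : ∀ a, pairSum turn (l ++ [a]) = pairSum turn l + turn y a := fun a => by
    rw [pairSum_append_of _ hy (x := a) rfl]; simp [pairSum]
  have k' : ∀ a, pairSum turn (m ++ [a]) = pairSum turn m + turn y' a := fun a => by
    rw [pairSum_append_of _ hy' (x := a) rfl]; simp [pairSum]
  rw [cycSum_eq_of _ (h 2) (y := 2) (by simp), cycSum_eq_of _ (h' 0) (y := 0) (by simp),
    cycSum_eq_of _ (x := x) (y := 3) (by simp [hx])
      (by rw [← List.append_assoc, List.getLast?_append]; rfl),
    pairSum_append_of _ (y := 1) (by simp) (h' 3), k, k, k', k']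
  -- Replacing direction 2 by 1 at the end of the lower path, and by 3 before its beginning, loses
  -- one quarter turn at each place; the excluded directions are those for which the count would
  -- wrap around.
  have e₁ : turn y 1 + turn 3 x = turn y 2 + turn 2 x - 2 := by
    revert x₀ x₁ y₀ y₃; clear * -; revert x y; decide
  have e₂ : turn 1 x' + turn y' 3 = turn y' 0 + turn 0 x' - 2 := by
    revert x₂' x₃' y₁' y₂'; clear * -; revert x' y'; decide
  linarith

theorem exists_succ_of_isChain {α : Type*} {r : α → α → Prop} {d : List α} {v : α}
    (h : (d ++ [v]).IsChain r) {s : α} (hs : s ∈ d) : ∃ t ∈ d ++ [v], r s t := by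
  induction d with
  | nil => simp at hs
  | cons a d ih =>
    obtain ⟨b, l, hl⟩ : ∃ b l, d ++ [v] = b :: l := List.exists_cons_of_ne_nil (by simp)
    rw [List.cons_append, hl, List.isChain_cons_cons] at h
    rcases List.mem_cons.1 hs with rfl | hs
    · exact ⟨b, by simp [hl], h.1⟩
    · obtain ⟨t, ht, hst⟩ := ih (hl ▸ h.2) hs
      exact ⟨t, List.mem_cons_of_mem _ ht, hst⟩

/-- The position of two paths before they are glued: the last edge of `root₁`, at the maximal
height, is the lower side of the tile at `P`; the last edge of `root₂` translated by `v`, at the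
minimal height, is the upper side of this tile. -/
structure Gap (root₁ root₂ : List Pt) (P v : Pt) : Prop where
  head₁ : root₁.head? = some P
  last₁ : root₁.getLast? = some (P + (1, 0))
  le₁ : ∀ Q ∈ root₁, Q.2 ≤ P.2
  head₂ : (root₂.map (· + v)).head? = some (P + (1, 1))
  last₂ : (root₂.map (· + v)).getLast? = some (P + (0, 1))
  le₂ : ∀ Q ∈ root₂.map (· + v), P.2 + 1 ≤ Q.2

/-! ### Boundaries of disks as closed paths, and joined disks -/

namespace SquareSurface

variable {p : ℕ} {D : SquareSurface p}

theorem IsDisk.isClosedPath (hD : D.IsDisk) {b : List (Side p)} (h : D.BoundaryList b) :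
    IsClosedPath (b.map D.start : List Pt) where
  chain := by
    have hadj : ∀ s : Side p, Adj (D.start s) (D.start s.next) := by
      rintro ⟨g, k⟩
      fin_cases k <;> simp [Adj, start, cornerOffset, Side.next]
    have hc := h.chain
    rw [chain_iff_getElem] at hc ⊢
    intro i hi
    simp only [List.length_map] at hi
    simp only [List.getElem_map, List.length_map]
    rw [← (hc i hi).start_eq]
    exact hadj _
  no_uturn P Q l e := by
    obtain ⟨k, hk⟩ := Cycle.coe_eq_coe.1 e.symm
    rw [← List.map_rotate] at hk
    have h := h.rotate k
    generalize b.rotate k = b' at hk h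
    obtain _ | ⟨s, _ | ⟨t, b'⟩⟩ := b'
    · simp at hk
    · simp at hk
    simp only [List.map_cons, List.cons.injEq] at hk
    obtain ⟨rfl, rfl, rfl⟩ := hk
    have hs : D.glue s = s := (h.mem_iff s).1 (by simp)
    have hc := h.chain
    rw [Cycle.chain_coe_cons] at hc
    simp only [List.cons_append, List.isChain_cons_cons] at hc
    -- A return to the start of `s` would make `t` the reversed copy of `s`, and flatness excludes
    -- opposite directions at a boundary vertex.
    have hne : D.start t.next ≠ D.start s := fun e =>
      (hD.flat.corners_boundary hs hc.1).2.1 (offset_glue hc.1.start_eq.symm e).1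
    obtain _ | ⟨c, b'⟩ := b'
    · simp only [List.nil_append, List.isChain_cons_cons] at hc
      exact absurd hc.2.1.start_eq hne
    · simp only [List.cons_append, List.isChain_cons_cons] at hc
      refine ⟨D.start c, b'.map D.start, rfl, ?_⟩
      rw [← hc.2.1.start_eq]
      exact hne

theorem side_two_of {s : Side p} {P : Pt} (h₁ : D.start s = P + (1, 0)) (h₂ : D.start s.next = P) :
    s.2 = 2 ∧ D.tile s.1 = P + normal 0 :=
  offset_inj (T := P + normal 0) (k := 2) (h₁.trans (by ext <;> simp [cornerOffset, normal]))
    (h₂.trans (by ext <;> simp [cornerOffset, normal]))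

theorem side_one_of {s : Side p} {P : Pt} (h₁ : D.start s = P + (1, 0))
    (h₂ : D.start s.next = P + (1, 1)) : s.2 = 1 ∧ D.tile s.1 = P :=
  offset_inj (k := 1) h₁ h₂

theorem side_three_of {s : Side p} {P : Pt} (h₁ : D.start s = P + (0, 1))
    (h₂ : D.start s.next = P) : s.2 = 3 ∧ D.tile s.1 = P :=
  offset_inj (k := 3) h₁ (h₂.trans (by simp [cornerOffset]))

theorem side_zero_of {s : Side p} {P v : Pt} (h₁ : D.start s + v = P + (0, 1))
    (h₂ : D.start s.next + v = P + (1, 1)) : s.2 = 0 ∧ D.tile s.1 + v = P + normal 2 :=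
  offset_inj (T := P + normal 2) (k := 0)
    ((add_right_comm _ _ _).trans (h₁.trans (by ext <;> simp [cornerOffset, normal])))
    ((add_right_comm _ _ _).trans (h₂.trans (by ext <;> simp [cornerOffset, normal])))

theorem start_snd (s : Side p) :
    (D.start s).2 = (D.tile s.1).2 + if s.2 = 2 ∨ s.2 = 3 then 1 else 0 := by
  obtain ⟨g, k⟩ := s
  fin_cases k <;> simp [start, cornerOffset]

/-- The last side of the lower path. -/
structure LowerData (D : SquareSurface p) (d : List (Side p)) (u : Side p) (P : Pt) : Prop where
  dir : u.2 = 2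
  tile_eq : D.tile u.1 = P + normal 0
  tile_lt : ∀ g, (D.tile g).2 < P.2
  start_eq : D.start u = P + (1, 0)
  start_next : D.start u.next = P
  head_last : ∃ x y, d.head? = some x ∧ d.getLast? = some y ∧ D.Reach u.next x ∧ D.Reach y.next u

/-- If `d` were empty, `u` would be followed by itself and its two endpoints would coincide. -/
theorem exists_head_last {d : List (Side p)} {u : Side p} (h : D.BoundaryList (d ++ [u]))
    (hne : D.start u.next ≠ D.start u) :
    ∃ x y, d.head? = some x ∧ d.getLast? = some y ∧ D.Reach u.next x ∧ D.Reach y.next u := by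
  obtain ⟨x, hx⟩ : ∃ x, x ∈ (d ++ [u]).head? := by cases d <;> simp
  obtain ⟨h₁, h₂⟩ := (chain_append_singleton_iff hx).1 h.chain
  obtain _ | ⟨z, d⟩ := d
  · simp only [List.nil_append, List.head?_cons, Option.mem_def, Option.some.injEq] at hx
    subst hx
    exact absurd h₂.start_eq hne
  · simp only [List.cons_append, List.head?_cons, Option.mem_def, Option.some.injEq] at hx
    subst hx
    refine ⟨z, (z :: d).getLast (by simp), rfl, List.getLast?_eq_some_getLast _, h₂, ?_⟩
    rw [List.isChain_append] at h₁
    exact h₁.2.2 _ (List.getLast?_eq_some_getLast _) _ rfl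

theorem BoundaryList.lowerData {root₁ root₂ : List Pt} {P v : Pt} (G : Gap root₁ root₂ P v)
    {d : List (Side p)} {u : Side p} (h : D.BoundaryList (d ++ [u]))
    (e : (d ++ [u]).map D.start = root₁) : LowerData D d u P := by
  obtain ⟨x, hx⟩ : ∃ x, x ∈ (d ++ [u]).head? := by cases d <;> simp
  have h₁ : D.start u = P + (1, 0) := by
    have := G.last₁
    rw [← e] at this
    simpa using this
  have h₂ : D.start u.next = P := by
    have := G.head₁
    rw [← e, List.head?_map, Option.mem_def.1 hx] at this
    rw [h.start_last hx]
    simpa using this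
  obtain ⟨h₃, h₄⟩ := side_two_of h₁ h₂
  refine ⟨h₃, h₄, h.tile_lt fun s hs => G.le₁ _ (e ▸ List.mem_map_of_mem hs), h₁, h₂,
    exists_head_last h ?_⟩
  rw [h₁, h₂]
  intro h
  simpa using congrArg Prod.fst h

/-- The last side of the upper path. -/
structure UpperData (D : SquareSurface p) (d : List (Side p)) (u : Side p) (P v : Pt) :
    Prop where
  dir : u.2 = 0
  tile_eq : D.tile u.1 + v = P + normal 2
  le_tile : ∀ g, P.2 + 1 - v.2 ≤ (D.tile g).2
  start_eq : D.start u + v = P + (0, 1)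
  start_next : D.start u.next + v = P + (1, 1)
  head_last : ∃ x y, d.head? = some x ∧ d.getLast? = some y ∧ D.Reach u.next x ∧ D.Reach y.next u

theorem BoundaryList.upperData {root₁ root₂ : List Pt} {P v : Pt} (G : Gap root₁ root₂ P v)
    {d : List (Side p)} {u : Side p} (h : D.BoundaryList (d ++ [u]))
    (e : (d ++ [u]).map D.start = root₂) : UpperData D d u P v := by
  obtain ⟨x, hx⟩ : ∃ x, x ∈ (d ++ [u]).head? := by cases d <;> simp
  have h₁ : D.start u + v = P + (0, 1) := by
    have := G.last₂
    rw [← e] at this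
    simpa using this
  have h₂ : D.start u.next + v = P + (1, 1) := by
    have := G.head₂
    rw [← e, List.head?_map, List.head?_map, Option.mem_def.1 hx] at this
    rw [h.start_last hx]
    simpa using this
  obtain ⟨h₃, h₄⟩ := side_zero_of h₁ h₂
  refine ⟨h₃, h₄, h.le_tile fun s hs => ?_, h₁, h₂, exists_head_last h ?_⟩
  · have := G.le₂ _ (List.mem_map_of_mem (e ▸ List.mem_map_of_mem hs))
    simp only [Prod.snd_add] at this
    linarith
  · intro h
    rw [h, h₁] at h₂
    simpa using congrArg Prod.fst h₂

/-- Two disks joined by a square form a disk. -/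
theorem Join.isDisk {a b n : ℕ} {A : SquareSurface a} {B : SquareSurface b} {C : SquareSurface n}
    {i : Fin a → Fin n} {j : Fin b → Fin n} {f : Fin n} {u : Side a} {w : Side b} {P v : Pt}
    (J : Join A B C i j f u w v) (hA : A.IsDisk) (hB : B.IsDisk) {d : List (Side a)}
    {e : List (Side b)} (bA : A.BoundaryList (d ++ [u])) (bB : B.BoundaryList (e ++ [w]))
    (L : LowerData A d u P) (U : UpperData B e w P v) : C.IsDisk := by
  have hne : (0 : Fin 4) ≠ 2 ∧ (0 : Fin 4) ≠ 3 ∧ (1 : Fin 4) ≠ 2 ∧ (1 : Fin 4) ≠ 3 := by decide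
  have l₁ := congrArg Prod.snd L.start_eq
  have l₂ := congrArg Prod.snd L.start_next
  have m₁ := congrArg Prod.snd U.start_eq
  have m₂ := congrArg Prod.snd U.start_next
  simp only [Prod.snd_add, add_zero] at l₁ l₂ m₁ m₂
  have hflat : C.Flat := by
    -- Each corner to be excluded would belong to a square on the wrong side of the gap.
    refine J.flat hA.flat hB.flat ?_ ?_ ?_ ?_ <;> intro c hc heq
    · rw [L.dir, show (2 : Fin 4) + 2 = 0 from rfl] at hc
      have h := congrArg Prod.snd heq
      rw [start_snd c, hc, l₁] at h
      have := L.tile_lt c.1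
      simp at h
      omega
    · rw [L.dir, show (2 : Fin 4) + 3 = 1 from rfl] at hc
      have h := congrArg Prod.snd heq
      rw [start_snd c, hc, l₂] at h
      have := L.tile_lt c.1
      simp at h
      omega
    · rw [U.dir, show (0 : Fin 4) + 2 = 2 from rfl] at hc
      have h := congrArg Prod.snd heq
      rw [start_snd c, hc] at h
      have := U.le_tile c.1
      simp at h
      omega
    · rw [U.dir, show (0 : Fin 4) + 3 = 3 from rfl] at hc
      have h := congrArg Prod.snd heq
      rw [start_snd c, hc] at h
      have := U.le_tile c.1
      simp at h
      omega
  have bC := (J.boundaryList_iff d e).2 ⟨bA, bB⟩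
  refine (isDisk_iff bC).2 ⟨Fin.pos f, J.connected hA.connected hB.connected, hflat, ?_⟩
  have key := hflat.four_mul_euler_eq_turn bC
  have tA := hA.turn_eq bA
  have tB := hB.turn_eq bB
  have hud : u ∉ d := fun h => (List.disjoint_of_nodup_append bA.nodup) h (by simp)
  have hwe : w ∉ e := fun h => (List.disjoint_of_nodup_append bB.nodup) h (by simp)
  have oA : (d.map (outer i f u 0)).map Prod.snd = d.map Prod.snd := by
    rw [List.map_map]
    refine List.map_congr_left fun s hs => ?_
    rw [Function.comp_apply, outer_of_ne _ _ (by rintro rfl; exact hud hs)]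
    rfl
  have oB : (e.map (outer j f w 2)).map Prod.snd = e.map Prod.snd := by
    rw [List.map_map]
    refine List.map_congr_left fun s hs => ?_
    rw [Function.comp_apply, outer_of_ne _ _ (by rintro rfl; exact hwe hs)]
    rfl
  have hidx : (((d ++ [u]).map (outer i f u 0) ++ (e ++ [w]).map (outer j f w 2)).map Prod.snd) =
      (d.map Prod.snd ++ [1]) ++ (e.map Prod.snd ++ [3]) := by
    rw [List.map_append, List.map_append, List.map_append, List.map_append, List.map_append, oA, oB]
    simp [outer_self]
  rw [List.map_append, List.map_singleton, L.dir] at tA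
  rw [List.map_append, List.map_singleton, U.dir] at tB
  obtain ⟨x, y, hx, hy, hux, hyu⟩ := L.head_last
  obtain ⟨x', y', hx', hy', hux', hyu'⟩ := U.head_last
  have cx := (hA.flat.corners_boundary ((bA.mem_iff u).1 (by simp)) hux).2.1
  have cy := (hA.flat.corners_boundary ((bA.mem_iff y).1 (by
    simp [List.mem_of_getLast? hy])) hyu).2.1
  have cx' := (hB.flat.corners_boundary ((bB.mem_iff w).1 (by simp)) hux').2.1
  have cy' := (hB.flat.corners_boundary ((bB.mem_iff y').1 (by
    simp [List.mem_of_getLast? hy'])) hyu').2.1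
  rw [L.dir] at cx cy
  rw [U.dir] at cx' cy'
  have sx := congrArg Prod.snd hux.start_eq
  have sy := congrArg Prod.snd hyu.start_eq
  have sx' := congrArg Prod.snd hux'.start_eq
  have sy' := congrArg Prod.snd hyu'.start_eq
  rw [start_snd x, l₂] at sx
  rw [start_snd y.next, l₁] at sy
  rw [start_snd x'] at sx'
  rw [start_snd y'.next] at sy'
  have tx := L.tile_lt x.1
  have ty := L.tile_lt y.1
  have tx' := U.le_tile x'.1
  have ty' := U.le_tile y'.1
  -- Of the eight excluded directions, four would be U-turns at the marked side and four would make
  -- the path leave its half-plane.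
  rw [hidx, cycSum_turn_join (x := x.2) (y := y.2) (x' := x'.2) (y' := y'.2) (by simp [hx])
    (by simp [hy]) (by simp [hx']) (by simp [hy']), tA, tB] at key
  · linarith
  · exact cx
  · intro h
    simp [h] at sx
    omega
  · intro h
    simp [h] at cy
  · intro h
    simp [h] at sy
    omega
  · exact cx'
  · intro h
    simp [h] at sx'
    omega
  · intro h
    simp [h] at sy'
    omega
  · intro h
    rw [h] at cy'
    exact cy' rfl

end SquareSurface

/-! ### Cutting a disk along a square -/

namespace SquareSurface

variable {n : ℕ} {C : SquareSurface n}

/-- If the first side were followed on its square by the free side `r`, then `r` would be both the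
second and the last side of a list of length at least three without repetition. -/
theorem next_ne_of_chain {d : List (Side n)} {r x : Side n}
    (h : (d ++ [r]).IsChain fun s t => C.Reach s.next t) (hd : (d ++ [r]).Nodup)
    (h3 : 3 ≤ (d ++ [r]).length) (hx : (d ++ [r]).head? = some x) (hr : C.glue r = r) :
    x.next ≠ r := by
  intro hxr
  obtain _ | ⟨y, _ | ⟨z, d⟩⟩ := d
  · simp at h3
  · simp at h3
  · simp only [List.cons_append, List.head?_cons, Option.some.injEq, List.isChain_cons_cons,
      List.nodup_cons] at hx h hd
    subst hx
    rw [hxr] at h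
    obtain rfl := h.1.eq_of_free hr
    exact hd.2.1 (by simp)

theorem exists_half_of_sub {a : ℕ} {A : SquareSurface a} {i : Fin a → Fin n} {f : Fin n}
    {u : Side a} {k : Fin 4} {v : Pt} (H : Half A C i f u k v) {d : List (Side n)}
    (hd : ∀ s ∈ d, C.glue s = s ∧ ∃ x, s.1 = i x) :
    ∃ d' : List (Side a), d'.map (outer i f u k) = d := by
  induction d with
  | nil => exact ⟨[], rfl⟩
  | cons s d ih =>
    obtain ⟨d', rfl⟩ := ih fun t ht => hd t (List.mem_cons_of_mem _ ht)
    obtain ⟨hs, x, hx⟩ := hd s (by simp)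
    refine ⟨(x, s.2) :: d', ?_⟩
    rw [List.map_cons]
    congr 1
    have e : Side.lift i (x, s.2) = s := Prod.ext hx.symm rfl
    rw [outer_of_ne _ _ ?_, e]
    rintro rfl
    rw [← e] at hs
    exact H.glue_u_ne hs

/-- The boundary leaves the row of tiles at height `P.2` empty except for the vertical sides `r` and
`t`. This forces the row of `C` to be one square, and removing it separates the lower squares from
the upper ones. -/
theorem exists_cut {root₁ root₂ : List Pt} {P v : Pt} (G : Gap root₁ root₂ P v)
    (h3 : 3 ≤ root₁.length) (h3' : 3 ≤ root₂.length) {b : List (Side n)} (hb : C.BoundaryList b)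
    (hroot : b.map C.start = root₁ ++ root₂.map (· + v)) :
    ∃ (a : ℕ) (A : SquareSurface a) (m : ℕ) (B : SquareSurface m) (i : Fin a → Fin n)
      (j : Fin m → Fin n) (f : Fin n) (u : Side a) (w : Side m) (d : List (Side a))
      (e : List (Side m)), Join A B C i j f u w v ∧ A.BoundaryList (d ++ [u]) ∧
        (d ++ [u]).map A.start = root₁ ∧ B.BoundaryList (e ++ [w]) ∧
        (e ++ [w]).map B.start = root₂ := by
  obtain ⟨b₁, b₂, rfl, e₁, e₂⟩ := List.map_eq_append_iff.1 hroot
  obtain ⟨d₁, r, rfl⟩ : ∃ d r, b₁ = d ++ [r] := by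
    rcases List.eq_nil_or_concat b₁ with rfl | ⟨d, r, h⟩
    · rw [← e₁] at h3
      simp at h3
    · exact ⟨d, r, by simpa using h⟩
  obtain ⟨d₂, t, rfl⟩ : ∃ d r, b₂ = d ++ [r] := by
    rcases List.eq_nil_or_concat b₂ with rfl | ⟨d, r, h⟩
    · have := congrArg List.length e₂
      simp at this
      omega
    · exact ⟨d, r, by simpa using h⟩
  obtain ⟨x, hx⟩ : ∃ x, (d₁ ++ [r]).head? = some x := by cases d₁ <;> simp
  obtain ⟨y, hy⟩ : ∃ y, (d₂ ++ [t]).head? = some y := by cases d₂ <;> simp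
  have sx : C.start x = P := by
    have := G.head₁
    rw [← e₁, List.head?_map, hx] at this
    simpa using this
  have sy : C.start y = P + (1, 1) := by
    have := G.head₂
    rw [← e₂, List.head?_map, hy] at this
    simpa using this
  have sr : C.start r = P + (1, 0) := by
    have := G.last₁
    rw [← e₁] at this
    simpa using this
  have st : C.start t = P + (0, 1) := by
    have := G.last₂
    rw [← e₂] at this
    simpa using this
  obtain ⟨hc₁, hc₂, hry, htx⟩ : (d₁ ++ [r]).IsChain (fun s t => C.Reach s.next t) ∧
      (d₂ ++ [t]).IsChain (fun s t => C.Reach s.next t) ∧ C.Reach r.next y ∧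
        C.Reach t.next x := by
    have h := hb.chain
    rw [← List.append_assoc, chain_append_singleton_iff (x := x) (by
        rw [Option.mem_def, List.head?_append, List.head?_append, hx]; rfl),
      List.append_assoc, List.isChain_append] at h
    exact ⟨h.1.1, h.1.2.1, h.1.2.2 r (by simp) y hy, h.2⟩
  obtain ⟨r₂, hr⟩ := side_one_of sr (hry.start_eq.trans sy)
  obtain ⟨t₂, ht⟩ := side_three_of st (htx.start_eq.trans sx)
  have hmem : ∀ s, C.glue s = s ↔ s ∈ d₁ ∨ s = r ∨ s ∈ d₂ ∨ s = t := by
    intro s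
    rw [← hb.mem_iff]
    simp
  have fr : C.glue r = r := (hmem r).2 (by simp)
  have ft : C.glue t = t := (hmem t).2 (by simp)
  have F₁ : ∀ s ∈ d₁, (C.start s).2 ≤ P.2 ∧ (C.start s.next).2 ≤ P.2 := by
    intro s hs
    obtain ⟨s', hs', h⟩ := exists_succ_of_isChain hc₁ hs
    rw [h.start_eq]
    exact ⟨G.le₁ _ (e₁ ▸ List.mem_map_of_mem (List.mem_append_left _ hs)),
      G.le₁ _ (e₁ ▸ List.mem_map_of_mem hs')⟩
  have F₂ : ∀ s ∈ d₂, P.2 + 1 ≤ (C.start s).2 ∧ P.2 + 1 ≤ (C.start s.next).2 := by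
    intro s hs
    obtain ⟨s', hs', h⟩ := exists_succ_of_isChain hc₂ hs
    rw [h.start_eq]
    exact ⟨G.le₂ _ (e₂ ▸ List.mem_map_of_mem (List.mem_append_left _ hs)),
      G.le₂ _ (e₂ ▸ List.mem_map_of_mem hs')⟩
  -- A free right side in this row joins the heights `P.2` and `P.2 + 1`, whereas the sides of `d₁`
  -- stay below the row, those of `d₂` above it, and `t` is a left side.
  have R₁ : ∀ g, (C.tile g).2 = P.2 → C.glue (g, 1) = (g, 1) → (g, 1) = r := by
    intro g hg h
    rcases (hmem _).1 h with h | h | h | h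
    · have := (F₁ _ h).2
      simp [start, cornerOffset, Side.next] at this
      omega
    · exact h
    · have := (F₂ _ h).1
      simp [start, cornerOffset] at this
      omega
    · rw [← h] at t₂
      simp at t₂
  have R₃ : ∀ g, (C.tile g).2 = P.2 → C.glue (g, 3) = (g, 3) → (g, 3) = t := by
    intro g hg h
    rcases (hmem _).1 h with h | h | h | h
    · have := (F₁ _ h).1
      simp [start, cornerOffset] at this
      omega
    · rw [← h] at r₂
      simp at r₂
    · have := (F₂ _ h).2
      simp [start, cornerOffset, Side.next] at this
      omega
    · exact h
  -- Horizontal moves stay in the row, so its rightmost square has a free right side, which is `r`,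
  -- and its leftmost one has a free left side, which is `t`. Both lie on the tile at `P`; hence
  -- every square of the row does, and has both vertical sides free.
  have hrow : ∀ g, (C.tile g).2 = P.2 → (g, 1) = r ∧ (g, 3) = t := by
    intro g hg
    obtain ⟨g₁, a₁, b₁, c₁⟩ := C.exists_free_dir 1 (fun g => (C.tile g).2 = P.2)
      (fun g hg hne => by rw [(C.glue_geom hne).2]; simpa [normal] using hg) Prod.fst
      (fun T => by simp [normal]) hg
    obtain ⟨g₃, a₃, b₃, c₃⟩ := C.exists_free_dir 3 (fun g => (C.tile g).2 = P.2)
      (fun g hg hne => by rw [(C.glue_geom hne).2]; simpa [normal] using hg) (fun T => -T.1)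
      (fun T => by simp [normal]) hg
    have q₁ := R₁ g₁ a₁ b₁
    have q₃ := R₃ g₃ a₃ b₃
    rw [show g₁ = r.1 from congrArg Prod.fst q₁, hr] at c₁
    rw [show g₃ = t.1 from congrArg Prod.fst q₃, ht] at c₃
    have k₁ := c₁ g hg
    have k₃ := c₃ g hg
    constructor
    · refine R₁ g hg ?_
      by_contra hne
      have h := (C.glue_geom hne).2
      have := c₁ (C.glue (g, 1)).1 (by rw [h]; simpa [normal] using hg)
      rw [h] at this
      simp [normal] at this
      omega
    · refine R₃ g hg ?_
      by_contra hne
      have h := (C.glue_geom hne).2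
      have := c₃ (C.glue (g, 3)).1 (by rw [h]; simpa [normal] using hg)
      rw [h] at this
      simp [normal] at this
      omega
  obtain ⟨f, rfl⟩ : ∃ f, r = (f, 1) := ⟨r.1, Prod.ext rfl r₂⟩
  dsimp only at hr
  obtain ⟨-, rfl⟩ := hrow f (by rw [hr])
  have hrow : ∀ g, (C.tile g).2 = P.2 → g = f := fun g hg =>
    congrArg Prod.fst (hrow g hg).1
  have nd := hb.nodup
  rw [List.nodup_append] at nd
  have l₁ : 3 ≤ (d₁ ++ [(f, 1)]).length := by
    have := congrArg List.length e₁
    rw [List.length_map] at this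
    omega
  have l₂ : 3 ≤ (d₂ ++ [(f, 3)]).length := by
    have := congrArg List.length e₂
    rw [List.length_map, List.length_map] at this
    omega
  -- If the bottom of `f` were free, it would follow `t` on the boundary and precede `r`, and the
  -- lower path would have only two sides.
  have n₀ : C.glue (f, 0) ≠ (f, 0) := by
    intro h
    have hxf : x = (f, 0) := htx.eq_of_free h
    subst hxf
    exact next_ne_of_chain hc₁ nd.1 l₁ hx fr rfl
  have n₂ : C.glue (f, 2) ≠ (f, 2) := by
    intro h
    have hyf : y = (f, 2) := hry.eq_of_free h
    subst hyf
    exact next_ne_of_chain hc₂ nd.2.1 l₂ hy ft rfl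
  -- A gluing changes the height by at most one, so a passage from the lower or upper squares to the
  -- rest can only lead into `f`.
  have gs := fun s hs => C.glue_geom (s := s) hs
  obtain ⟨a, A, i, u, H₁, S₁⟩ := C.exists_half (fun g => (C.tile g).2 < P.2) (f := f) (k := 0) 0
    (by simp [hr]) (by rw [(gs _ n₀).2, hr]; simp [normal]) (by
      rintro ⟨g, l⟩ hg
      by_cases hne : C.glue (g, l) = (g, l)
      · exact .inl (by rw [hne]; exact hg)
      obtain ⟨h₁, h₂⟩ := gs _ hne
      by_contra! hcon
      have h₃ := congrArg Prod.snd h₂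
      dsimp only at h₁ hg h₃
      have h₄ : l = 2 := by
        have hz := hcon.1
        clear hcon h₂ h₁ hne
        generalize (C.tile (C.glue (g, l)).1).2 = z at h₃ hz
        fin_cases l <;> simp [normal] at h₃ ⊢ <;> omega
      subst h₄
      simp [normal] at h₃
      exact hcon.2 (Prod.ext (hrow _ (by omega)) h₁)) fr ft
  obtain ⟨m, B, j, w, H₂, S₂⟩ := C.exists_half (fun g => P.2 < (C.tile g).2) (f := f) (k := 2) v
    (by simp [hr]) (by rw [(gs _ n₂).2, hr]; simp [normal]) (by
      rintro ⟨g, l⟩ hg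
      by_cases hne : C.glue (g, l) = (g, l)
      · exact .inl (by rw [hne]; exact hg)
      obtain ⟨h₁, h₂⟩ := gs _ hne
      by_contra! hcon
      have h₃ := congrArg Prod.snd h₂
      dsimp only at h₁ hg h₃
      have h₄ : l = 0 := by
        have hz := hcon.1
        clear hcon h₂ h₁ hne
        generalize (C.tile (C.glue (g, l)).1).2 = z at h₃ hz
        fin_cases l <;> simp [normal] at h₃ ⊢ <;> omega
      subst h₄
      simp [normal] at h₃
      exact hcon.2 (Prod.ext (hrow _ (by omega)) h₁)) ft fr
  have J : Join A B C i j f u w v := by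
    refine ⟨H₁, H₂, fun x y h => ?_, fun g => ?_⟩
    · have h₁ := (S₁ (i x)).2 ⟨x, rfl⟩
      have h₂ := (S₂ (j y)).2 ⟨y, rfl⟩
      rw [h] at h₁
      exact lt_asymm h₁ h₂
    · rcases lt_trichotomy (C.tile g).2 P.2 with h | h | h
      · exact .inl ((S₁ g).1 h)
      · exact .inr (.inr (hrow g h))
      · exact .inr (.inl ((S₂ g).1 h))
  obtain ⟨d, hd⟩ := exists_half_of_sub H₁ (d := d₁) fun s hs => by
    have hs' := (hmem s).2 (.inl hs)
    refine ⟨hs', (S₁ _).1 ?_⟩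
    have hF := F₁ s hs
    by_contra! hlt
    rw [start_snd, start_snd] at hF
    obtain ⟨g, l⟩ := s
    have hg : g = f := hrow g (by dsimp only at hF hlt; split_ifs at hF <;> omega)
    subst hg
    rw [Side.next_fst, hr] at hF
    fin_cases l
    · exact n₀ hs'
    · simp at hF
    · exact n₂ hs'
    · simp at hF
  obtain ⟨e, he⟩ := exists_half_of_sub H₂ (d := d₂) fun s hs => by
    have hs' := (hmem s).2 (.inr (.inr (.inl hs)))
    refine ⟨hs', (S₂ _).1 ?_⟩
    have hF := F₂ s hs
    by_contra! hlt
    rw [start_snd, start_snd] at hF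
    obtain ⟨g, l⟩ := s
    have hg : g = f := hrow g (by dsimp only at hF hlt; split_ifs at hF <;> omega)
    subst hg
    rw [Side.next_fst, hr] at hF
    fin_cases l
    · exact n₀ hs'
    · simp at hF
    · exact n₂ hs'
    · simp at hF
  have k₁ : (d ++ [u]).map (outer i f u 0) = d₁ ++ [(f, 1)] := by
    rw [List.map_append, hd, List.map_singleton, outer_self]
    rfl
  have k₂ : (e ++ [w]).map (outer j f w 2) = d₂ ++ [(f, 3)] := by
    rw [List.map_append, he, List.map_singleton, outer_self]
    rfl
  rw [← k₁, ← k₂] at hb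
  obtain ⟨bA, bB⟩ := (J.boundaryList_iff d e).1 hb
  refine ⟨a, A, m, B, i, j, f, u, w, d, e, J, bA, ?_, bB, ?_⟩
  · rw [← e₁, ← k₁, List.map_map]
    refine List.map_congr_left fun s _ => ?_
    simp [H₁.start_outer]
  · rw [← k₂, List.map_map] at e₂
    refine List.map_injective_iff.2 (add_left_injective v) ?_
    rw [← e₂, List.map_map]
    exact List.map_congr_left fun s _ => (H₂.start_outer s).symm

end SquareSurface

/-! ### Renumbering the squares -/

namespace SquareSurface

/-- `e` is a renumbering of the squares that turns `D` into `D'`. -/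
def IsIso {p q : ℕ} (D : SquareSurface p) (D' : SquareSurface q) (e : Fin p ≃ Fin q) : Prop :=
  (∀ f, D'.tile (e f) = D.tile f) ∧ ∀ s, D'.glue (Side.lift e s) = Side.lift e (D.glue s)

theorem lift_equiv_injective {p q : ℕ} (e : Fin p ≃ Fin q) :
    Function.Injective (Side.lift e) := by
  rintro ⟨x, j⟩ ⟨y, l⟩ h
  simp only [Side.lift, Prod.mk.injEq, e.injective.eq_iff] at h
  rw [h.1, h.2]

section IsIso

variable {p q : ℕ} {D : SquareSurface p} {D' : SquareSurface q} {e : Fin p ≃ Fin q}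

theorem IsIso.free_iff (h : IsIso D D' e) (s : Side p) :
    D'.glue (Side.lift e s) = Side.lift e s ↔ D.glue s = s := by
  rw [h.2, (lift_equiv_injective e).eq_iff]

theorem IsIso.reach (h : IsIso D D' e) {c t : Side p} (hr : D.Reach c t) :
    D'.Reach (Side.lift e c) (Side.lift e t) := by
  induction hr with
  | refl ht => exact .refl ((h.free_iff _).2 ht)
  | step hc _ ih =>
    refine .step (fun h' => hc ((h.free_iff _).1 h')) ?_
    rw [rot, h.2]
    exact ih

theorem IsIso.boundaryList (h : IsIso D D' e) {b : List (Side p)} (hb : D.BoundaryList b) :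
    D'.BoundaryList (b.map (Side.lift e)) where
  nodup := hb.nodup.map (lift_equiv_injective e)
  mem_iff s := by
    obtain ⟨t, rfl⟩ : ∃ t, Side.lift e t = s :=
      ⟨(e.symm s.1, s.2), Prod.ext (e.apply_symm_apply _) rfl⟩
    rw [List.mem_map_of_injective (lift_equiv_injective e), h.free_iff, hb.mem_iff]
  chain := by
    have hc := hb.chain
    rw [chain_iff_getElem] at hc ⊢
    intro i hi
    simp only [List.length_map] at hi
    simp only [List.getElem_map, List.length_map]
    exact h.reach (hc i hi)

theorem IsIso.start (h : IsIso D D' e) (s : Side p) : D'.start (Side.lift e s) = D.start s := by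
  rw [SquareSurface.start, SquareSurface.start, ← h.1]
  rfl

/-- A renumbering respects the marked sides of the boundaries. -/
theorem IsIso.lift_last (h : IsIso D D' e) (hD' : D'.IsDisk) {d : List (Side p)} {u : Side p}
    {d' : List (Side q)} {u' : Side q} (b : D.BoundaryList (d ++ [u]))
    (b' : D'.BoundaryList (d' ++ [u'])) (hs : (d ++ [u]).map D.start = (d' ++ [u']).map D'.start) :
    Side.lift e u = u' := by
  have := hD'.boundaryList_unique b' (h.boundaryList b) (by
    rw [← hs, List.map_map]
    exact List.map_congr_left fun s _ => h.start s)
  simpa using congrArg List.getLast? this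

end IsIso

/-- A renumbering of `C` that carries one part to the other restricts to the parts. The marked sides
match because they are the partners of the side `k` of `f` and of `f'`. -/
theorem Half.exists_isIso {a a' n n' : ℕ} {A : SquareSurface a} {A' : SquareSurface a'}
    {C : SquareSurface n} {C' : SquareSurface n'} {i : Fin a → Fin n} {i' : Fin a' → Fin n'}
    {f : Fin n} {f' : Fin n'} {u : Side a} {u' : Side a'} {k : Fin 4} {v : Pt}
    (H : Half A C i f u k v) (H' : Half A' C' i' f' u' k v) {e : Fin n ≃ Fin n'}
    (h : IsIso C C' e) (hf : e f = f') (hr : ∀ g, (∃ x, i x = g) ↔ ∃ x, i' x = e g) :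
    ∃ e', IsIso A A' e' := by
  choose φ hφ using fun x => (hr (i x)).1 ⟨x, rfl⟩
  have hbij : Function.Bijective φ := by
    constructor
    · intro x y hxy
      apply H.inj
      apply e.injective
      rw [← hφ, ← hφ, hxy]
    · intro y
      obtain ⟨x, hx⟩ := (hr (e.symm (i' y))).2 ⟨y, (e.apply_symm_apply _).symm⟩
      refine ⟨x, H'.inj ?_⟩
      rw [hφ, hx, e.apply_symm_apply]
  have hl : ∀ s, Side.lift i' (Side.lift φ s) = Side.lift e (Side.lift i s) :=
    fun s => Prod.ext (hφ s.1) rfl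
  have hu : Side.lift φ u = u' := by
    apply H'.lift_injective
    rw [hl, ← H.glue_f, ← h.2, ← H'.glue_f]
    exact congrArg _ (Prod.ext hf rfl)
  refine ⟨Equiv.ofBijective φ hbij, fun x => ?_, fun s => ?_⟩
  · apply add_right_cancel (b := v)
    rw [← H.tile, Equiv.ofBijective_apply, ← H'.tile, hφ, h.1]
  · change A'.glue (Side.lift φ s) = Side.lift φ (A.glue s)
    by_cases hs : s = u
    · rw [hs, H.free_u, hu, H'.free_u]
    · apply H'.lift_injective
      have hs' : Side.lift φ s ≠ u' := by
        intro h'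
        apply hs
        apply H.lift_injective
        apply lift_equiv_injective e
        rw [← hl, ← hl, h', hu]
      rw [← H'.glue _ hs', hl, h.2, H.glue _ hs, hl]

section Join

variable {a b n : ℕ} {A : SquareSurface a} {B : SquareSurface b} {C : SquareSurface n}
  {i : Fin a → Fin n} {j : Fin b → Fin n} {f : Fin n} {u : Side a} {w : Side b} {v : Pt}

/-- The squares of a joined surface. -/
theorem Join.exists_equiv (J : Join A B C i j f u w v) :
    ∃ E : (Fin a ⊕ Fin b) ⊕ Unit ≃ Fin n, (∀ x, E (.inl (.inl x)) = i x) ∧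
      (∀ y, E (.inl (.inr y)) = j y) ∧ E (.inr ()) = f := by
  refine ⟨Equiv.ofBijective (Sum.elim (Sum.elim i j) fun _ => f) ⟨?_, ?_⟩, fun _ => rfl,
    fun _ => rfl, rfl⟩
  · refine Function.Injective.sumElim (Function.Injective.sumElim J.lower.inj J.upper.inj
      J.disjoint) (fun _ _ _ => rfl) ?_
    rintro (x | y) -
    exacts [J.lower.ne_f x, J.upper.ne_f y]
  · intro g
    rcases J.cover g with ⟨x, rfl⟩ | ⟨y, rfl⟩ | rfl
    exacts [⟨.inl (.inl x), rfl⟩, ⟨.inl (.inr y), rfl⟩, ⟨.inr (), rfl⟩]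

variable {a' b' n' : ℕ} {A' : SquareSurface a'} {B' : SquareSurface b'} {C' : SquareSurface n'}
  {i' : Fin a' → Fin n'} {j' : Fin b' → Fin n'} {f' : Fin n'} {u' : Side a'} {w' : Side b'}

theorem Half.glue_lift_eq {k : Fin 4} (H : Half A C i f u k v) (H' : Half A' C' i' f' u' k v)
    {e₁ : Fin a ≃ Fin a'} (h₁ : IsIso A A' e₁) (hu : Side.lift e₁ u = u') {e : Fin n ≃ Fin n'}
    (he : ∀ x, e (i x) = i' (e₁ x)) (hf : e f = f') (s : Side a) :
    C'.glue (Side.lift e (Side.lift i s)) = Side.lift e (C.glue (Side.lift i s)) := by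
  have hl : ∀ s, Side.lift e (Side.lift i s) = Side.lift i' (Side.lift e₁ s) :=
    fun s => Prod.ext (he s.1) rfl
  rw [hl]
  by_cases hs : s = u
  · rw [hs, hu, H'.glue_u, H.glue_u]
    exact Prod.ext hf.symm rfl
  · have hs' : Side.lift e₁ s ≠ u' := fun h => hs (lift_equiv_injective e₁ (h.trans hu.symm))
    rw [H'.glue _ hs', h₁.2, H.glue _ hs, hl]

theorem Join.exists_isIso (J : Join A B C i j f u w v) (J' : Join A' B' C' i' j' f' u' w' v)
    {e₁ : Fin a ≃ Fin a'} {e₂ : Fin b ≃ Fin b'} (h₁ : IsIso A A' e₁) (h₂ : IsIso B B' e₂)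
    (hu : Side.lift e₁ u = u') (hw : Side.lift e₂ w = w') : ∃ e, IsIso C C' e := by
  obtain ⟨E, E₁, E₂, E₃⟩ := J.exists_equiv
  obtain ⟨E', E₁', E₂', E₃'⟩ := J'.exists_equiv
  let e : Fin n ≃ Fin n' :=
    (E.symm.trans (Equiv.sumCongr (Equiv.sumCongr e₁ e₂) (Equiv.refl _))).trans E'
  have p₁ : ∀ x, e (i x) = i' (e₁ x) := fun x => by simp [e, ← E₁, ← E₁']
  have p₂ : ∀ y, e (j y) = j' (e₂ y) := fun y => by simp [e, ← E₂, ← E₂']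
  have p₃ : e f = f' := by simp [e, ← E₃, ← E₃']
  have g₁ := J.lower.glue_lift_eq J'.lower h₁ hu p₁ p₃
  have g₂ := J.upper.glue_lift_eq J'.upper h₂ hw p₂ p₃
  refine ⟨e, fun g => ?_, fun s => ?_⟩
  · rcases J.cover g with ⟨x, rfl⟩ | ⟨y, rfl⟩ | rfl
    · rw [p₁, J'.lower.tile, J.lower.tile, h₁.1]
    · rw [p₂, J'.upper.tile, J.upper.tile, h₂.1]
    · have t := J.lower.tile_u
      have t' := J'.lower.tile_u
      rw [← hu, Side.lift, h₁.1, t] at t'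
      rw [p₃, add_right_cancel t']
  · obtain ⟨g, l⟩ := s
    have q : Side.lift e (f, l) = (f', l) := Prod.ext p₃ rfl
    rcases J.cover g with ⟨x, rfl⟩ | ⟨y, rfl⟩ | rfl
    · exact g₁ (x, l)
    · exact g₂ (y, l)
    · rw [q]
      fin_cases l
      · refine J'.lower.glue_f.trans (Eq.trans ?_ (congrArg _ J.lower.glue_f.symm))
        exact Prod.ext (by rw [← hu]; exact (p₁ _).symm) (by rw [← hu]; rfl)
      · exact J'.lower.free_one.trans (q.symm.trans (congrArg _ J.lower.free_one.symm))
      · refine J'.upper.glue_f.trans (Eq.trans ?_ (congrArg _ J.upper.glue_f.symm))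
        exact Prod.ext (by rw [← hw]; exact (p₂ _).symm) (by rw [← hw]; rfl)
      · exact J'.lower.free_three.trans (q.symm.trans (congrArg _ J.lower.free_three.symm))

theorem Join.tile_f {P : Pt} {d : List (Side a)} (J : Join A B C i j f u w v)
    (L : LowerData A d u P) : C.tile f = P := by
  have := J.lower.tile_u
  rw [add_zero, L.tile_eq] at this
  exact (add_right_cancel this).symm

/-- Heights are preserved by isomorphisms, so this intrinsic description of the three parts forces
an isomorphism of joined surfaces to respect them. -/
theorem Join.lower_iff {P : Pt} {d : List (Side a)} {e : List (Side b)}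
    (J : Join A B C i j f u w v) (L : LowerData A d u P) (U : UpperData B e w P v) (g : Fin n) :
    ((∃ x, i x = g) ↔ (C.tile g).2 < P.2) ∧ ((∃ y, j y = g) ↔ P.2 < (C.tile g).2) ∧
      (g = f ↔ (C.tile g).2 = P.2) := by
  have h₁ : ∀ x, (C.tile (i x)).2 < P.2 := fun x => by
    rw [J.lower.tile, add_zero]
    exact L.tile_lt x
  have h₂ : ∀ y, P.2 < (C.tile (j y)).2 := fun y => by
    rw [J.upper.tile, Prod.snd_add]
    linarith [U.le_tile y]
  have h₃ := J.tile_f L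
  rcases J.cover g with ⟨x, rfl⟩ | ⟨y, rfl⟩ | rfl
  · have := h₁ x
    refine ⟨iff_of_true ⟨x, rfl⟩ this, iff_of_false ?_ this.not_gt, iff_of_false (J.lower.ne_f x)
      this.ne⟩
    rintro ⟨y, hy⟩
    exact J.disjoint x y hy.symm
  · have := h₂ y
    refine ⟨iff_of_false ?_ this.not_gt, iff_of_true ⟨y, rfl⟩ this, iff_of_false (J.upper.ne_f y)
      this.ne'⟩
    rintro ⟨x, hx⟩
    exact J.disjoint x y hx
  · refine ⟨iff_of_false ?_ (by rw [h₃]; exact lt_irrefl _), iff_of_false ?_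
      (by rw [h₃]; exact lt_irrefl _), iff_of_true rfl (by rw [h₃])⟩
    · rintro ⟨x, hx⟩
      exact J.lower.ne_f x hx
    · rintro ⟨y, hy⟩
      exact J.upper.ne_f y hy

end Join

end SquareSurface

/-! ### Fillings of a glued path -/

/-- `C` is obtained by joining `A` and `B` by a square. -/
def IsJoin {root₁ root₂ : List Pt} (v : Pt) (A : Filling root₁) (B : Filling root₂)
    (C : Filling (root₁ ++ root₂.map (· + v) : List Pt)) : Prop :=
  ∃ i j f u w d e, Join A.disk B.disk C.disk i j f u w v ∧ A.disk.BoundaryList (d ++ [u]) ∧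
    (d ++ [u]).map A.disk.start = root₁ ∧ B.disk.BoundaryList (e ++ [w]) ∧
      (e ++ [w]).map B.disk.start = root₂

section

variable {root₁ root₂ : List Pt} {P v : Pt}

theorem Filling.exists_boundaryList_append (A : Filling root₁) :
    ∃ d u, A.disk.BoundaryList (d ++ [u]) ∧ (d ++ [u]).map A.disk.start = root₁ := by
  obtain ⟨b, h₁, h₂⟩ := A.exists_boundaryList
  rcases List.eq_nil_or_concat b with rfl | ⟨d, u, h⟩
  · exact absurd rfl (A.isDisk.boundary_ne_nil h₁)
  · obtain rfl : b = d ++ [u] := by simpa using h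
    exact ⟨d, u, h₁, h₂⟩

theorem Gap.exists_filling (G : Gap root₁ root₂ P v) (A : Filling root₁) (B : Filling root₂) :
    ∃ C, IsJoin v A B C ∧ C.faces = A.faces + B.faces + 1 := by
  obtain ⟨d, u, a₁, a₂⟩ := A.exists_boundaryList_append
  obtain ⟨e, w, b₁, b₂⟩ := B.exists_boundaryList_append
  have L := a₁.lowerData G a₂
  have U := b₁.upperData G b₂
  obtain ⟨C, i, j, f, J⟩ := exists_join A.disk B.disk ((a₁.mem_iff u).1 (by simp))
    ((b₁.mem_iff w).1 (by simp)) L.dir U.dir L.tile_eq U.tile_eq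
  have hC := J.isDisk A.isDisk B.isDisk a₁ b₁ L U
  have hb := (J.boundaryList_iff d e).2 ⟨a₁, b₁⟩
  refine ⟨⟨_, C, hC, bounds_coe_iff.2 ⟨_, hb, ?_⟩⟩, ⟨i, j, f, u, w, d, e, J, a₁, a₂, b₁, b₂⟩, rfl⟩
  rw [J.map_start, a₂, b₂]

/-- The pieces produced by the cut are flat and connected. The fillings `A₀` and `B₀` serve only to
know the rotation numbers of the two paths, hence the Euler characteristics of the pieces. -/
theorem Gap.exists_isJoin (G : Gap root₁ root₂ P v) (h₁ : 3 ≤ root₁.length)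
    (h₂ : 3 ≤ root₂.length) (A₀ : Filling root₁) (B₀ : Filling root₂)
    (C : Filling (root₁ ++ root₂.map (· + v) : List Pt)) :
    ∃ A B, IsJoin v A B C := by
  obtain ⟨b, c₁, c₂⟩ := C.exists_boundaryList
  obtain ⟨a, A, m, B, i, j, f, u, w, d, e, J, a₁, a₂, b₁, b₂⟩ := exists_cut G h₁ h₂ c₁ c₂
  obtain ⟨bA, a₁', a₂'⟩ := A₀.exists_boundaryList
  obtain ⟨bB, b₁', b₂'⟩ := B₀.exists_boundaryList
  have key : ∀ {q q' : ℕ} {D : SquareSurface q} {D' : SquareSurface q'} {b : List (Side q)}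
      {b' : List (Side q')}, 0 < q → D.Flat → D.Connected → D'.IsDisk → D.BoundaryList b →
        D'.BoundaryList b' → b'.map D'.start = b.map D.start → D.IsDisk := by
    intro q q' D D' b b' hq hflat hconn hD' hb hb' hbb
    refine (isDisk_iff hb).2 ⟨hq, hconn, hflat, ?_⟩
    have h := hflat.four_mul_euler_eq_turn hb
    have h' := congrArg (List.map Prod.snd)
      (hb.directions_eq hb' (v := 0) (by rw [hbb]; simp [Function.comp_def]))
    rw [List.map_map, List.map_map] at h'
    have h'' := hD'.turn_eq hb'
    rw [show b'.map Prod.snd = b.map Prod.snd from h', ← h] at h''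
    omega
  have hA : A.IsDisk := key (Fin.pos u.1) (J.lower.flat C.isDisk.flat)
    (J.lower.connected C.isDisk.connected) A₀.isDisk a₁ a₁' (a₂'.trans a₂.symm)
  have hB : B.IsDisk := key (Fin.pos w.1) (J.upper.flat C.isDisk.flat)
    (J.upper.connected C.isDisk.connected) B₀.isDisk b₁ b₁' (b₂'.trans b₂.symm)
  exact ⟨⟨a, A, hA, bounds_coe_iff.2 ⟨_, a₁, a₂⟩⟩, ⟨m, B, hB, bounds_coe_iff.2 ⟨_, b₁, b₂⟩⟩,
    i, j, f, u, w, d, e, J, a₁, a₂, b₁, b₂⟩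

/-- Isomorphisms of the parts extend across the square since they respect the marked sides, by
`IsIso.lift_last`; an isomorphism of the joined disks restricts to the parts since it preserves
heights. -/
theorem Gap.iso_iff (G : Gap root₁ root₂ P v) {A A' : Filling root₁} {B B' : Filling root₂}
    {C C' : Filling (root₁ ++ root₂.map (· + v) : List Pt)} (h : IsJoin v A B C)
    (h' : IsJoin v A' B' C') : (A.Iso A' ∧ B.Iso B') ↔ C.Iso C' := by
  obtain ⟨i, j, f, u, w, d, e, J, a₁, a₂, b₁, b₂⟩ := h
  obtain ⟨i', j', f', u', w', d', e', J', a₁', a₂', b₁', b₂'⟩ := h'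
  have L := a₁.lowerData G a₂
  have U := b₁.upperData G b₂
  have L' := a₁'.lowerData G a₂'
  have U' := b₁'.upperData G b₂'
  constructor
  · rintro ⟨⟨e₁, h₁⟩, e₂, h₂⟩
    have h₁ : IsIso A.disk A'.disk e₁ := h₁
    have h₂ : IsIso B.disk B'.disk e₂ := h₂
    exact J.exists_isIso J' h₁ h₂ (h₁.lift_last A'.isDisk a₁ a₁' (a₂.trans a₂'.symm))
      (h₂.lift_last B'.isDisk b₁ b₁' (b₂.trans b₂'.symm))
  · rintro ⟨e, h⟩
    have h : IsIso C.disk C'.disk e := h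
    have hf : e f = f' := by
      rw [(J'.lower_iff L' U' _).2.2, h.1]
      exact (J.lower_iff L U f).2.2.1 rfl
    constructor
    · refine J.lower.exists_isIso J'.lower h hf fun g => ?_
      rw [(J.lower_iff L U g).1, (J'.lower_iff L' U' _).1, h.1]
    · refine J.upper.exists_isIso J'.upper h hf fun g => ?_
      rw [(J.lower_iff L U g).2.1, (J'.lower_iff L' U' _).2.1, h.1]

end

theorem card_quotient_mul {X Y Z : Type*} {sX : Setoid X} {sY : Setoid Y} {sZ : Setoid Z}
    (R : X → Y → Z → Prop) (h₁ : ∀ x y, ∃ z, R x y z) (h₂ : ∀ z, ∃ x y, R x y z)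
    (h₃ : ∀ {x y z x' y' z'}, R x y z → R x' y' z' → ((sX x x' ∧ sY y y') ↔ sZ z z')) :
    Nat.card (Quotient sZ) = Nat.card (Quotient sX) * Nat.card (Quotient sY) := by
  choose F hF using h₁
  rw [← Nat.card_prod]
  symm
  refine Nat.card_congr (Equiv.ofBijective
    (fun q : Quotient sX × Quotient sY => (Quotient.mk sZ (F q.1.out q.2.out))) ⟨?_, ?_⟩)
  · rintro ⟨x, y⟩ ⟨x', y'⟩ h
    have := (h₃ (hF _ _) (hF _ _)).2 (Quotient.exact h)
    exact Prod.ext (Quotient.out_equiv_out.1 this.1) (Quotient.out_equiv_out.1 this.2)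
  · intro q
    obtain ⟨z, rfl⟩ := Quotient.exists_rep q
    obtain ⟨x, y, h⟩ := h₂ z
    exact ⟨(Quotient.mk sX x, Quotient.mk sY y), Quotient.sound ((h₃ (hF _ _) h).1
      ⟨Quotient.mk_out x, Quotient.mk_out y⟩)⟩

theorem Gap.multiplicity_eq {root₁ root₂ : List Pt} {P v : Pt} (G : Gap root₁ root₂ P v)
    (h₁ : 3 ≤ root₁.length) (h₂ : 3 ≤ root₂.length) (A₀ : Filling root₁) (B₀ : Filling root₂) :
    multiplicity (root₁ ++ root₂.map (· + v) : List Pt) =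
      multiplicity root₁ * multiplicity root₂ :=
  card_quotient_mul (IsJoin v) (fun A B => (G.exists_filling A B).imp fun _ h => h.1)
    (G.exists_isJoin h₁ h₂ A₀ B₀) G.iso_iff

/-! ### Gluing two self-overlapping polygons -/

theorem IsClosedPath.three_le {root : List Pt} (h : IsClosedPath (root : Cycle Pt))
    (hne : root ≠ []) : 3 ≤ root.length := by
  obtain _ | ⟨P, _ | ⟨Q, l⟩⟩ := root
  · exact absurd rfl hne
  · have := h.chain
    simp [Adj] at this
  · obtain ⟨R, l', rfl, -⟩ := h.no_uturn P Q l rfl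
    simp

theorem SquareSurface.BoundaryList.getLast_upper {p : ℕ} {D : SquareSurface p}
    {d : List (Side p)} {s : Side p} (h : D.BoundaryList (d ++ [s])) {root : List Pt}
    (e : (d ++ [s]).map D.start = root) (hne : root ≠ [])
    (hor : (root.getLast hne).2 = (root.head hne).2) (hhigh : ∀ P ∈ root, P.2 ≤ (root.head hne).2) :
    root.getLast hne = root.head hne + (1, 0) := by
  subst e
  obtain ⟨x, hx, ex⟩ := head_map_eq (d := d) (u := s) D.start (by simp)
  rw [← h.start_last hx] at ex
  simp only [ex, List.getLast_map, List.getLast_append_singleton] at hor hhigh ⊢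
  have h2 := h.upper_dir hor.symm fun t ht => hor ▸ hhigh _ (List.mem_map_of_mem ht)
  obtain ⟨g, k⟩ := s
  dsimp only at h2
  subst h2
  ext <;> simp [start, Side.next, cornerOffset]

theorem SquareSurface.BoundaryList.head_lower {p : ℕ} {D : SquareSurface p}
    {d : List (Side p)} {s : Side p} (h : D.BoundaryList (d ++ [s])) {root : List Pt}
    (e : (d ++ [s]).map D.start = root) (hne : root ≠ [])
    (hor : (root.getLast hne).2 = (root.head hne).2) (hlow : ∀ P ∈ root, (root.head hne).2 ≤ P.2) :
    root.head hne = root.getLast hne + (1, 0) := by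
  subst e
  obtain ⟨x, hx, ex⟩ := head_map_eq (d := d) (u := s) D.start (by simp)
  rw [← h.start_last hx] at ex
  simp only [ex, List.getLast_map, List.getLast_append_singleton] at hor hlow ⊢
  have h2 := h.lower_dir hor.symm fun t ht => hor ▸ hlow _ (List.mem_map_of_mem ht)
  obtain ⟨g, k⟩ := s
  dsimp only at h2
  subst h2
  ext <;> simp [start, Side.next, cornerOffset]

theorem UpperEdge.getLast_eq {γ : Cycle Pt} (u : UpperEdge γ) (h : IsSOP γ) :
    u.root.getLast u.ne_nil = u.root.head u.ne_nil + (1, 0) := by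
  obtain ⟨root, hne, rfl, hor, hhigh⟩ := u
  obtain ⟨A⟩ := h.2
  obtain ⟨d, s, h₁, h₂⟩ := A.exists_boundaryList_append
  exact h₁.getLast_upper h₂ hne hor hhigh

theorem LowerEdge.head_eq {γ : Cycle Pt} (l : LowerEdge γ) (h : IsSOP γ) :
    l.root.head l.ne_nil = l.root.getLast l.ne_nil + (1, 0) := by
  obtain ⟨root, hne, rfl, hor, hlow⟩ := l
  obtain ⟨A⟩ := h.2
  obtain ⟨d, s, h₁, h₂⟩ := A.exists_boundaryList_append
  exact h₁.head_lower h₂ hne hor hlow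

/-- The translation applied to the second path before gluing. -/
def shift {γ₁ γ₂ : Cycle Pt} (u : UpperEdge γ₁) (l : LowerEdge γ₂) : Pt :=
  u.root.head u.ne_nil + ((0, 1) : Pt) - l.root.getLast l.ne_nil

theorem LowerEdge.le_shift {γ₁ γ₂ : Cycle Pt} (u : UpperEdge γ₁) (l : LowerEdge γ₂) :
    ∀ Q ∈ l.root.map (· + shift u l), (u.root.head u.ne_nil).2 + 1 ≤ Q.2 := by
  intro Q hQ
  obtain ⟨R, hR, rfl⟩ := List.mem_map.1 hQ
  have := l.lowest R hR
  have := l.horizontal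
  simp only [shift, Prod.snd_add, Prod.snd_sub]
  linarith

theorem gap {γ₁ γ₂ : Cycle Pt} (h₁ : IsSOP γ₁) (h₂ : IsSOP γ₂) (u : UpperEdge γ₁)
    (l : LowerEdge γ₂) : Gap u.root l.root (u.root.head u.ne_nil) (shift u l) where
  head₁ := List.head?_eq_some_head _
  last₁ := by rw [← u.getLast_eq h₁]; exact List.getLast?_eq_some_getLast _
  le₁ := u.highest
  head₂ := by
    rw [List.head?_map, List.head?_eq_some_head l.ne_nil, Option.map_some, l.head_eq h₂, shift]
    congr 1
    ext
    · simp; ring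
    · simp
  last₂ := by
    rw [List.getLast?_map, List.getLast?_eq_some_getLast l.ne_nil, Option.map_some, shift]
    congr 1
    abel
  le₂ := l.le_shift u

theorem isSOP_gluing {γ₁ γ₂ : Cycle Pt} (h₁ : IsSOP γ₁) (h₂ : IsSOP γ₂) (u : UpperEdge γ₁)
    (l : LowerEdge γ₂) : IsSOP (gluing u l) ∧ (gluing u l).length = γ₁.length + γ₂.length ∧
      (∀ p₁ p₂ : ℕ, HasArea γ₁ p₁ → HasArea γ₂ p₂ → HasArea (gluing u l) (p₁ + p₂ + 1)) ∧
        multiplicity (gluing u l) = multiplicity γ₁ * multiplicity γ₂ := by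
  have G := gap h₁ h₂ u l
  obtain ⟨root₁, ne₁, rfl, hor₁, hhigh⟩ := u
  obtain ⟨root₂, ne₂, rfl, hor₂, hlow⟩ := l
  obtain ⟨A⟩ := h₁.2
  obtain ⟨B⟩ := h₂.2
  refine ⟨?_, ?_, ?_, ?_⟩
  · obtain ⟨C, -, -⟩ := G.exists_filling A B
    obtain ⟨b, c₁, c₂⟩ := C.exists_boundaryList
    have h := C.isDisk.isClosedPath c₁
    rw [c₂] at h
    exact ⟨h, ⟨C⟩⟩
  · change List.length (_ ++ List.map _ _) = List.length _ + List.length _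
    rw [List.length_append, List.length_map]
  · rintro _ _ ⟨A', rfl⟩ ⟨B', rfl⟩
    obtain ⟨C, -, hC⟩ := G.exists_filling A' B'
    exact ⟨C, hC⟩
  · exact G.multiplicity_eq (h₁.1.three_le ne₁) (h₂.1.three_le ne₂) A B

/-! ### Classes modulo translations -/

theorem toClass_eq_iff {γ γ' : Cycle Pt} : toClass γ = toClass γ' ↔ Translate γ γ' :=
  Quotient.eq (r := (⟨Translate, translate_equivalence⟩ : Setoid (Cycle Pt)))

theorem toClass_map (γ : Cycle Pt) (v : Pt) : toClass (γ.map (· + v)) = toClass γ :=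
  (toClass_eq_iff.2 ⟨v, rfl⟩).symm

theorem map_coe (l : List Pt) (v : Pt) :
    (l : Cycle Pt).map (· + v) = ((l.map (· + v) : List Pt) : Cycle Pt) := rfl

/-- Translation of an upper edge. -/
def UpperEdge.translate {γ : Cycle Pt} (u : UpperEdge γ) (a : Pt) :
    UpperEdge (γ.map (· + a)) where
  root := u.root.map (· + a)
  ne_nil := by simpa using u.ne_nil
  coe_root := by rw [← map_coe, u.coe_root]
  horizontal := by simpa using u.horizontal
  highest Q hQ := by
    obtain ⟨R, hR, rfl⟩ := List.mem_map.1 hQ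
    simpa using u.highest R hR

/-- Translation of a lower edge. -/
def LowerEdge.translate {γ : Cycle Pt} (l : LowerEdge γ) (a : Pt) :
    LowerEdge (γ.map (· + a)) where
  root := l.root.map (· + a)
  ne_nil := by simpa using l.ne_nil
  coe_root := by rw [← map_coe, l.coe_root]
  horizontal := by simpa using l.horizontal
  lowest Q hQ := by
    obtain ⟨R, hR, rfl⟩ := List.mem_map.1 hQ
    simpa using l.lowest R hR

theorem gluing_translate {γ₁ γ₂ : Cycle Pt} (u : UpperEdge γ₁) (l : LowerEdge γ₂) (a b : Pt) :
    gluing (u.translate a) (l.translate b) = (gluing u l).map (· + a) := by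
  rw [gluing, gluing, map_coe, List.map_append]
  simp only [UpperEdge.translate, LowerEdge.translate, List.map_map]
  congr 2
  refine List.map_congr_left fun Q _ => ?_
  simp only [Function.comp_apply, List.head_map, List.getLast_map]
  abel

/-- Edges chosen for one pair of representatives can be translated to any other pair, and the glued
path is translated accordingly; a choice on classes is therefore consistent. -/
theorem exists_isGluingMap : ∃ G, IsGluingMap G := by
  classical
  let E : PathClass × PathClass → PathClass → Prop := fun c c' =>
    ∃ (γ₁ γ₂ : Cycle Pt) (u : UpperEdge γ₁) (l : LowerEdge γ₂),
      toClass γ₁ = c.1 ∧ toClass γ₂ = c.2 ∧ toClass (gluing u l) = c'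
  refine ⟨fun c => if h : ∃ c', E c c' then h.choose else c.1, fun γ₁ γ₂ h₁ h₂ => ?_⟩
  have h : ∃ c', E (toClass γ₁, toClass γ₂) c' := by
    obtain ⟨u⟩ := h₁.exists_edges.1
    obtain ⟨l⟩ := h₂.exists_edges.2
    exact ⟨_, γ₁, γ₂, u, l, rfl, rfl, rfl⟩
  simp only [dif_pos h]
  suffices key : ∀ c', E (toClass γ₁, toClass γ₂) c' →
      ∃ (u : UpperEdge γ₁) (l : LowerEdge γ₂), c' = toClass (gluing u l) from key _ h.choose_spec
  rintro _ ⟨γ₁', γ₂', u, l, e₁, e₂, rfl⟩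
  obtain ⟨a, rfl⟩ := toClass_eq_iff.1 e₁
  obtain ⟨b, rfl⟩ := toClass_eq_iff.1 e₂
  refine ⟨u.translate a, l.translate b, ?_⟩
  rw [gluing_translate, toClass_map]

/-! ### Finiteness -/

theorem box_of_isChain {P : Pt} {l : List Pt} (h : (P :: l).IsChain Adj) :
    ∀ Q ∈ P :: l, (Q.1 - P.1).natAbs ≤ l.length ∧ (Q.2 - P.2).natAbs ≤ l.length := by
  induction l generalizing P with
  | nil => simp
  | cons R l ih =>
    rw [List.isChain_cons_cons] at h
    intro Q hQ
    rcases List.mem_cons.1 hQ with rfl | hQ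
    · simp
    · have := ih h.2 Q hQ
      have := h.1
      simp only [Adj, List.length_cons] at this ⊢
      omega

/-- Up to translation the path starts at the origin, and its `2n` unit steps keep it in a fixed box.
-/
theorem sopLength_finite (n : ℕ) : (sopLength n).Finite := by
  let M : ℤ := 2 * n
  let X := Set.Icc ((-M, -M) : Pt) (M, M)
  have hX : Finite X := (Set.finite_Icc _ _).to_subtype
  have hfin : {l : List X | l.length = 2 * n}.Finite := List.finite_length_eq X (2 * n)
  refine (hfin.image fun l => toClass (l.map Subtype.val : List Pt)).subset ?_
  rintro _ ⟨γ, ⟨hγ, hlen⟩, rfl⟩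
  induction γ using Quotient.inductionOn' with
  | h l =>
    have hlen : l.length = 2 * n := hlen
    have hch : ((l : List Pt) : Cycle Pt).Chain Adj := hγ.1.chain
    obtain _ | ⟨P, l⟩ := l
    · exact ⟨[], hlen, rfl⟩
    rw [Cycle.chain_coe_cons, ← List.cons_append, List.isChain_append] at hch
    have hbox := box_of_isChain hch.1
    have hmem : ∀ Q ∈ (P :: l).map (· + -P), Q ∈ X := by
      intro Q hQ
      obtain ⟨R, hR, rfl⟩ := List.mem_map.1 hQ
      have := hbox R hR
      rw [List.length_cons] at hlen
      simp only [X, M, Set.mem_Icc, Prod.le_def, Prod.fst_add, Prod.snd_add, Prod.fst_neg,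
        Prod.snd_neg]
      omega
    obtain ⟨l', hl'⟩ : ∃ l' : List X, l'.map Subtype.val = (P :: l).map (· + -P) := by
      refine ⟨((P :: l).map (· + -P)).attach.map fun Q => ⟨Q.1, hmem _ Q.2⟩, ?_⟩
      rw [List.map_map]
      exact List.attach_map_subtype_val _
    refine ⟨l', ?_, ?_⟩
    · have := congrArg List.length hl'
      rw [List.length_map, List.length_map, hlen] at this
      exact this
    · simp only [hl']
      exact toClass_map ((P :: l : List Pt) : Cycle Pt) (-P)

/-! ### Injectivity -/

/-- A rotation that cuts inside `c` would put an element satisfying `p` at the end, and one that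
cuts inside `d` would put an element violating `p` at the beginning. Only the trivial rotations
remain. -/
theorem append_inj_of_isRotated {α : Type*} {p : α → Prop} {a b c d : List α}
    (h : a ++ b ~r c ++ d) (ha : a ≠ []) (hb : b ≠ []) (pa : ∀ x ∈ a, p x) (pb : ∀ x ∈ b, ¬ p x)
    (pc : ∀ x ∈ c, p x) (pd : ∀ x ∈ d, ¬ p x) (hl : a.length = c.length) : a = c ∧ b = d := by
  obtain ⟨k, hk, e⟩ := List.isRotated_iff_mod.1 h.symm
  have hhead : ∀ x, (a ++ b).head? = some x → p x := by
    intro x hx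
    rw [List.head?_append, List.head?_eq_some_head ha] at hx
    obtain rfl : a.head ha = x := by simpa using hx
    exact pa _ (List.head_mem _)
  have hlast : ∀ x, (a ++ b).getLast? = some x → ¬ p x := by
    intro x hx
    rw [List.getLast?_append, List.getLast?_eq_some_getLast hb] at hx
    obtain rfl : b.getLast hb = x := by simpa using hx
    exact pb _ (List.getLast_mem _)
  rw [List.rotate_eq_drop_append_take hk] at e
  have hc : c ≠ [] := fun h => ha (List.length_eq_zero_iff.1 (by rw [hl, h]; rfl))
  rcases Nat.eq_zero_or_pos k with rfl | hpos
  · simp only [List.drop_zero, List.take_zero, List.append_nil] at e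
    exact List.append_inj e.symm hl
  rcases hk.eq_or_lt with rfl | hkd
  · simp only [List.drop_length, List.take_length, List.nil_append] at e
    exact List.append_inj e.symm hl
  exfalso
  rcases Nat.lt_or_ge k c.length with hkc | hkc
  · have hne : c.take k ≠ [] := by simp [hc]; omega
    refine hlast ((c.take k).getLast hne) ?_ (pc _ (List.mem_of_mem_take (List.getLast_mem hne)))
    rw [← e, List.take_append_of_le_length hkc.le, List.getLast?_append,
      List.getLast?_eq_some_getLast hne]
    rfl
  · have hne : d.drop (k - c.length) ≠ [] := by
      rw [List.length_append] at hkd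
      simp only [ne_eq, List.drop_eq_nil_iff]
      omega
    refine pd _ (List.mem_of_mem_drop (List.head_mem hne)) (hhead _ ?_)
    rw [← e, List.drop_append, List.drop_eq_nil_of_le hkc, List.nil_append, List.head?_append,
      List.head?_eq_some_head hne]
    rfl

/-- Exactly `a.length` points lie at height at most `h`. If `h' < h`, all of `c` and at least one
point of `d` would lie there, which is one point too many. -/
theorem not_lt_of_perm {a b c d : List Pt} {h h' : ℤ} (hp : (a ++ b).Perm (c ++ d))
    (hl : a.length = c.length) (ha : ∀ x ∈ a, x.2 ≤ h) (hb : ∀ x ∈ b, h + 1 ≤ x.2)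
    (hc : ∀ x ∈ c, x.2 ≤ h') (hd : ∃ x ∈ d, x.2 = h' + 1) : ¬ h' < h := by
  intro hlt
  have e := hp.countP_eq (fun x => decide (x.2 ≤ h))
  rw [List.countP_append, List.countP_append,
    (List.countP_eq_length (l := a)).2 (fun x hx => by simpa using ha x hx),
    (List.countP_eq_length (l := c)).2 (fun x hx => by simpa using (hc x hx).trans hlt.le),
    (List.countP_eq_zero (l := b)).2 (fun x hx => by simpa using hb x hx)] at e
  obtain ⟨x, hx, hxd⟩ := hd
  have : 0 < d.countP fun x => decide (x.2 ≤ h) :=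
    List.countP_pos_iff.2 ⟨x, hx, by simp only [decide_eq_true_eq]; omega⟩
  omega

/-- Equal lengths of the first paths force equal levels for the two cuts, and the cyclic sequence
then splits into its low and high blocks. The second path is recovered only up to translation, as
its block is shifted. -/
theorem toClass_eq_of_gluing {γ₁ γ₂ γ₁' γ₂' : Cycle Pt} (hl : γ₁'.length = γ₁.length)
    (u : UpperEdge γ₁) (l : LowerEdge γ₂) (u' : UpperEdge γ₁') (l' : LowerEdge γ₂')
    (h : toClass (gluing u l) = toClass (gluing u' l')) :
    toClass γ₁ = toClass γ₁' ∧ toClass γ₂ = toClass γ₂' := by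
  obtain ⟨a, ha⟩ := toClass_eq_iff.1 h
  rw [← gluing_translate u l a 0] at ha
  have hl : (u'.root).length = (u.translate a).root.length := by
    rw [← u'.coe_root, ← u.coe_root] at hl
    simpa [UpperEdge.translate] using hl
  suffices key : ∀ {γ₁ γ₂ γ₁' γ₂' : Cycle Pt} (u : UpperEdge γ₁) (l : LowerEdge γ₂)
      (u' : UpperEdge γ₁') (l' : LowerEdge γ₂'), u'.root.length = u.root.length →
      gluing u' l' = gluing u l → γ₁ = γ₁' ∧ toClass γ₂ = toClass γ₂' by
    obtain ⟨h₁, h₂⟩ := key _ _ u' l' hl ha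
    rw [toClass_map] at h₂
    rw [← h₁, toClass_map]
    exact ⟨rfl, h₂⟩
  clear * -
  intro γ₁ γ₂ γ₁' γ₂' u l u' l' hl h
  have hr : u'.root ++ l'.root.map (· + shift u' l') ~r u.root ++ l.root.map (· + shift u l) :=
    Cycle.coe_eq_coe.1 h
  have hlow : ∀ {γ₁ γ₂ : Cycle Pt} (u : UpperEdge γ₁) (l : LowerEdge γ₂),
      ∃ x ∈ l.root.map (· + shift u l), x.2 = (u.root.head u.ne_nil).2 + 1 := by
    intro γ₁ γ₂ u l
    refine ⟨_, List.mem_map_of_mem (List.getLast_mem l.ne_nil), ?_⟩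
    simp [shift]
  have hh : (u.root.head u.ne_nil).2 = (u'.root.head u'.ne_nil).2 :=
    le_antisymm
      (not_lt.1 (not_lt_of_perm hr.perm.symm hl.symm u.highest (l.le_shift u) u'.highest
        (hlow u' l')))
      (not_lt.1 (not_lt_of_perm hr.perm hl u'.highest (l'.le_shift u') u.highest (hlow u l)))
  obtain ⟨e₁, e₂⟩ := append_inj_of_isRotated (p := fun x => x.2 ≤ (u.root.head u.ne_nil).2) hr
    u'.ne_nil (by simpa using l'.ne_nil) (fun x hx => hh ▸ u'.highest x hx)
    (fun x hx => by have := l'.le_shift u' x hx; omega) u.highest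
    (fun x hx => by have := l.le_shift u x hx; omega) hl
  constructor
  · rw [← u.coe_root, ← u'.coe_root, e₁]
  · have k : γ₂.map (· + shift u l) = γ₂'.map (· + shift u' l') := by
      have k₁ : γ₂.map (· + shift u l) = (l.root.map (· + shift u l) : List Pt) := by
        rw [← map_coe, l.coe_root]
      have k₂ : γ₂'.map (· + shift u' l') = (l'.root.map (· + shift u' l') : List Pt) := by
        rw [← map_coe, l'.coe_root]
      rw [k₁, k₂, e₂]
    rw [← toClass_map γ₂' (shift u' l'), ← k, toClass_map]

/-! ### Gluing maps on classes and supermultiplicativity -/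

theorem IsGluingMap.injOn {G : PathClass × PathClass → PathClass} (hG : IsGluingMap G)
    (n₁ n₂ : ℕ) : Set.InjOn G (sopLength n₁ ×ˢ sopLength n₂) := by
  rintro ⟨_, _⟩ ⟨⟨γ₁, ⟨s₁, k₁⟩, rfl⟩, ⟨γ₂, ⟨s₂, k₂⟩, rfl⟩⟩ ⟨_, _⟩
    ⟨⟨γ₁', ⟨s₁', k₁'⟩, rfl⟩, ⟨γ₂', ⟨s₂', k₂'⟩, rfl⟩⟩ h
  obtain ⟨u, l, e⟩ := hG γ₁ γ₂ s₁ s₂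
  obtain ⟨u', l', e'⟩ := hG γ₁' γ₂' s₁' s₂'
  rw [e, e'] at h
  obtain ⟨h₁, h₂⟩ := toClass_eq_of_gluing (k₁'.trans k₁.symm) u l u' l' h
  exact Prod.ext h₁ h₂

theorem sopMult_subset (n p μ : ℕ) : sopMult n p μ ⊆ sopLength n :=
  Set.image_mono fun _ h => ⟨h.1, h.2.1⟩

theorem sopArea_subset (n p : ℕ) : sopArea n p ⊆ sopLength n :=
  Set.image_mono fun _ h => ⟨h.1, h.2.1⟩

theorem IsGluingMap.mapsTo_length {G : PathClass × PathClass → PathClass} (hG : IsGluingMap G)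
    (n₁ n₂ : ℕ) : Set.MapsTo G (sopLength n₁ ×ˢ sopLength n₂) (sopLength (n₁ + n₂)) := by
  rintro ⟨_, _⟩ ⟨⟨γ₁, ⟨s₁, k₁⟩, rfl⟩, ⟨γ₂, ⟨s₂, k₂⟩, rfl⟩⟩
  obtain ⟨u, l, e⟩ := hG γ₁ γ₂ s₁ s₂
  obtain ⟨q₁, q₂, -, -⟩ := isSOP_gluing s₁ s₂ u l
  exact ⟨_, ⟨q₁, by rw [q₂, k₁, k₂, mul_add]⟩, e.symm⟩

theorem IsGluingMap.mapsTo_area {G : PathClass × PathClass → PathClass} (hG : IsGluingMap G)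
    (n₁ n₂ p₁ p₂ : ℕ) :
    Set.MapsTo G (sopArea n₁ p₁ ×ˢ sopArea n₂ p₂) (sopArea (n₁ + n₂) (p₁ + p₂ + 1)) := by
  rintro ⟨_, _⟩ ⟨⟨γ₁, ⟨s₁, k₁, a₁⟩, rfl⟩, ⟨γ₂, ⟨s₂, k₂, a₂⟩, rfl⟩⟩
  obtain ⟨u, l, e⟩ := hG γ₁ γ₂ s₁ s₂
  obtain ⟨q₁, q₂, q₃, -⟩ := isSOP_gluing s₁ s₂ u l
  exact ⟨_, ⟨q₁, by rw [q₂, k₁, k₂, mul_add], q₃ _ _ a₁ a₂⟩, e.symm⟩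

theorem IsGluingMap.mapsTo_mult {G : PathClass × PathClass → PathClass} (hG : IsGluingMap G)
    (n₁ n₂ p₁ p₂ μ₁ μ₂ : ℕ) : Set.MapsTo G (sopMult n₁ p₁ μ₁ ×ˢ sopMult n₂ p₂ μ₂)
      (sopMult (n₁ + n₂) (p₁ + p₂ + 1) (μ₁ * μ₂)) := by
  rintro ⟨_, _⟩ ⟨⟨γ₁, ⟨s₁, k₁, a₁, m₁⟩, rfl⟩, ⟨γ₂, ⟨s₂, k₂, a₂, m₂⟩, rfl⟩⟩
  obtain ⟨u, l, e⟩ := hG γ₁ γ₂ s₁ s₂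
  obtain ⟨q₁, q₂, q₃, q₄⟩ := isSOP_gluing s₁ s₂ u l
  exact ⟨_, ⟨q₁, by rw [q₂, k₁, k₂, mul_add], q₃ _ _ a₁ a₂, by rw [q₄, m₁, m₂]⟩, e.symm⟩

theorem ncard_mul_le {X : Type*} {G : X × X → X} {S T U : Set X}
    (h : Set.MapsTo G (S ×ˢ T) U) (hi : Set.InjOn G (S ×ˢ T)) (hU : U.Finite) :
    S.ncard * T.ncard ≤ U.ncard := by
  rw [← Set.ncard_prod]
  exact Set.ncard_le_ncard_of_injOn G h hi hU

end SOPoly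

theorem mainTheorem3 :
    -- The counting numbers, the area and the multiplicity are well defined.
    (∀ n : ℕ, (SOPoly.sopLength n).Finite) ∧
    (∀ γ : Cycle SOPoly.Pt, Finite (SOPoly.DistortedDisk γ)) ∧
    (∀ γ : Cycle SOPoly.Pt, SOPoly.IsSOP γ → ∃! p : ℕ, SOPoly.HasArea γ p) ∧
    -- Any SOP has an upper edge and a lower edge, so that gluing maps exist.
    (∀ γ : Cycle SOPoly.Pt, SOPoly.IsSOP γ →
      Nonempty (SOPoly.UpperEdge γ) ∧ Nonempty (SOPoly.LowerEdge γ)) ∧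
    (∃ G : SOPoly.PathClass × SOPoly.PathClass → SOPoly.PathClass, SOPoly.IsGluingMap G) ∧
    -- Gluing two SOP yields a SOP, of known length, area and multiplicity.
    (∀ (γ₁ γ₂ : Cycle SOPoly.Pt), SOPoly.IsSOP γ₁ → SOPoly.IsSOP γ₂ →
      ∀ (u : SOPoly.UpperEdge γ₁) (l : SOPoly.LowerEdge γ₂),
        SOPoly.IsSOP (SOPoly.gluing u l) ∧
        (SOPoly.gluing u l).length = γ₁.length + γ₂.length ∧
        (∀ p₁ p₂ : ℕ, SOPoly.HasArea γ₁ p₁ → SOPoly.HasArea γ₂ p₂ →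
          SOPoly.HasArea (SOPoly.gluing u l) (p₁ + p₂ + 1)) ∧
        SOPoly.multiplicity (SOPoly.gluing u l) =
          SOPoly.multiplicity γ₁ * SOPoly.multiplicity γ₂) ∧
    -- For any choice of the edges, the gluing is injective once the lengths are fixed.
    (∀ G : SOPoly.PathClass × SOPoly.PathClass → SOPoly.PathClass, SOPoly.IsGluingMap G →
      (∀ n₁ n₂ p₁ p₂ μ₁ μ₂ : ℕ,
        Set.MapsTo G (SOPoly.sopMult n₁ p₁ μ₁ ×ˢ SOPoly.sopMult n₂ p₂ μ₂)
          (SOPoly.sopMult (n₁ + n₂) (p₁ + p₂ + 1) (μ₁ * μ₂)) ∧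
        Set.InjOn G (SOPoly.sopMult n₁ p₁ μ₁ ×ˢ SOPoly.sopMult n₂ p₂ μ₂)) ∧
      (∀ n₁ n₂ p₁ p₂ : ℕ,
        Set.MapsTo G (SOPoly.sopArea n₁ p₁ ×ˢ SOPoly.sopArea n₂ p₂)
          (SOPoly.sopArea (n₁ + n₂) (p₁ + p₂ + 1)) ∧
        Set.InjOn G (SOPoly.sopArea n₁ p₁ ×ˢ SOPoly.sopArea n₂ p₂)) ∧
      (∀ n₁ n₂ : ℕ,
        Set.MapsTo G (SOPoly.sopLength n₁ ×ˢ SOPoly.sopLength n₂)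
          (SOPoly.sopLength (n₁ + n₂)) ∧
        Set.InjOn G (SOPoly.sopLength n₁ ×ˢ SOPoly.sopLength n₂))) ∧
    -- The supermultiplicativity inequalities.
    (∀ n₁ n₂ p₁ p₂ μ₁ μ₂ : ℕ,
      SOPoly.calW n₁ p₁ μ₁ * SOPoly.calW n₂ p₂ μ₂ ≤
        SOPoly.calW (n₁ + n₂) (p₁ + p₂ + 1) (μ₁ * μ₂)) ∧
    (∀ n₁ n₂ p₁ p₂ : ℕ,
      SOPoly.hatW n₁ p₁ * SOPoly.hatW n₂ p₂ ≤ SOPoly.hatW (n₁ + n₂) (p₁ + p₂ + 1)) ∧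
    (∀ n₁ n₂ : ℕ, SOPoly.hatw n₁ * SOPoly.hatw n₂ ≤ SOPoly.hatw (n₁ + n₂)) := by
  obtain ⟨G₀, hG₀⟩ := SOPoly.exists_isGluingMap
  have hm := SOPoly.sopMult_subset
  have ha := SOPoly.sopArea_subset
  refine ⟨SOPoly.sopLength_finite, fun γ => inferInstance, fun γ h => h.existsUnique_area,
    fun γ h => h.exists_edges, ⟨G₀, hG₀⟩, fun γ₁ γ₂ h₁ h₂ u l => SOPoly.isSOP_gluing h₁ h₂ u l,
    fun G hG => ⟨fun n₁ n₂ p₁ p₂ μ₁ μ₂ => ⟨hG.mapsTo_mult _ _ _ _ _ _,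
        (hG.injOn n₁ n₂).mono (Set.prod_mono (hm _ _ _) (hm _ _ _))⟩,
      fun n₁ n₂ p₁ p₂ => ⟨hG.mapsTo_area _ _ _ _,
        (hG.injOn n₁ n₂).mono (Set.prod_mono (ha _ _) (ha _ _))⟩,
      fun n₁ n₂ => ⟨hG.mapsTo_length _ _, hG.injOn n₁ n₂⟩⟩, ?_, ?_, ?_⟩
  · intro n₁ n₂ p₁ p₂ μ₁ μ₂
    exact SOPoly.ncard_mul_le (hG₀.mapsTo_mult n₁ n₂ p₁ p₂ μ₁ μ₂)
      ((hG₀.injOn n₁ n₂).mono (Set.prod_mono (hm _ _ _) (hm _ _ _)))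
      ((SOPoly.sopLength_finite _).subset (hm _ _ _))
  · intro n₁ n₂ p₁ p₂
    exact SOPoly.ncard_mul_le (hG₀.mapsTo_area n₁ n₂ p₁ p₂)
      ((hG₀.injOn n₁ n₂).mono (Set.prod_mono (ha _ _) (ha _ _)))
      ((SOPoly.sopLength_finite _).subset (ha _ _))
  · intro n₁ n₂
    exact SOPoly.ncard_mul_le (hG₀.mapsTo_length n₁ n₂) (hG₀.injOn n₁ n₂)
      (SOPoly.sopLength_finite _)
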